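/- **Setting.** Let $(N^{3,1},g)$ be a smooth Lorentzian 4-manifold of signature $(-,+,+,+)$ and let $\Sigma$ be a closed connected smooth surface, smoothly and spacelike immersed (e.g. embedded) in $N$, with induced metric $\sigma$ and with everywhere timelike mean curvature vector $H=\sum_a(\overline\nabla_{e_a}e_a)^\perp$. Let $X:\Sigma\to\mathbb R^{3,1}$ be a smooth isometric immersion (e.g. embedding) with everywhere spacelike mean curvature vector $H_0$, let $T_0$ be a future-pointing timelike unit vector of $\mathbb R^{3,1}$, put $\tau=-\langle X,T_0\rangle$, and assume $|\nabla\tau|<1$. Here $\nabla$, $\Delta$, $\nabla\cdot$ are those of $\sigma$. Write $|H|=\sqrt{|\langle H,H\rangle|}$ and $|H_0|=\sqrt{|\langle H_0,H_0\rangle|}$. Let $e_H=-H/|H|$, and let $e_J=J/|H|$ be a smooth spacelike unit normal field of $\Sigma$ in $N$ orthogonal to $H$ (the outward one, or the opposite one). Let $e_{H_0}=-H_0/|H_0|$, and let $e_{J_0}=J_0/|H_0|$ be the smooth future-pointing timelike unit normal field of $X$ orthogonal to $H_0$. Define $\theta_0,\theta,v,u$ by $$\sinh\theta_0=\frac{-\Delta\tau}{|H_0|\sqrt{1+|\nabla\tau|^2}},\qquad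 \sinh\theta=\frac{\Delta\tau}{|H|\sqrt{1-|\nabla\tau|^2}},$$ $$v=\cosh\theta\,e_J-\sinh\theta\,e_H,\qquad u=-\sinh\theta\,e_J+\cosh\theta\,e_H,$$ and put $\alpha_v=\langle\overline\nabla v,u\rangle$, $\alpha_J=\langle\overline\nabla e_J,e_H\rangle$, $\alpha_{H_0}=\langle\nabla^{\mathbb R^{3,1}}e_{H_0},e_{J_0}\rangle$. Let $\hat\Sigma$ be the projection of $X(\Sigma)$ to the Euclidean hyperplane $T_0^\perp\cong\mathbb R^3$ (as an immersed surface), and $\hat k$ its mean curvature in $T_0^\perp$ with respect to the smooth outward unit normal $\hat\nu$ (positive for round spheres), where outward means: wherever a linear function $\langle\cdot,a\rangle$, $a\in T_0^\perp$, attains its maximum over $\hat\Sigma$, one has $\langle\hat\nu,a\rangle\ge0$. The new quasi-local energy is $$QLE^{new}=\frac1{8\pi}\int_{\hat\Sigma}\hat k-\frac1{8\pi}\int_\Sigma\Big(-\sqrt{1-|\nabla\tau|^2}\,\langle H,u\rangle-\alpha_v(\nabla\tau)\Big).$$ The new mass density and the new current are $$\rho^{new}=\frac{|H_0|\cosh\theta_0}{\sqrt{1+|\nabla\tau|^2}}+\frac{|H|\cosh\theta}{\sqrt{1-|\nabla\tau|^2}},$$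 $$j^{new}=\frac{|H_0|\cosh\theta_0}{\sqrt{1+|\nabla\tau|^2}}\nabla\tau-\frac{|H|\cosh\theta}{\sqrt{1-|\nabla\tau|^2}}\nabla\tau-\nabla(\theta_0-\theta)-\alpha_{H_0}+\alpha_J .$$ **Claim.** Suppose that $\tau$ satisfies the Euler–Lagrange equation $\nabla\cdot j^{new}=0$ on $\Sigma$. Then the integrands $\hat k$, $-\sqrt{1-|\nabla\tau|^2}\langle H,u\rangle-\alpha_v(\nabla\tau)$ and $\rho^{new}$ are integrable, and $$QLE^{new}=\frac1{8\pi}\int_\Sigma\rho^{new}.$$ Moreover, pointwise on $\Sigma$, $$\rho^{new}=\frac{\sqrt{|H_0|^2+\frac{(\Delta\tau)^2}{1+|\nabla\tau|^2}}}{\sqrt{1+|\nabla\tau|^2}}+\frac{\sqrt{|H|^2+\frac{(\Delta\tau)^2}{1-|\nabla\tau|^2}}}{\sqrt{1-|\nabla\tau|^2}},$$ where both terms are nonnegative. Consequently the new quasi-local mass, i.e. the value of $QLE^{new}$ at such a $\tau$, is nonnegative. -/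

import Mathlib

open scoped Manifold ContDiff
open MeasureTheory

noncomputable section

namespace QuasiLocal

/-! ## Tensor calculus in charts

A tangent vector at `x` is, in Mathlib, the tuple of its components in the preferred chart at `x`;
`tangentCoordChange I x y z` converts components with respect to the chart at `x` into components
with respect to the chart at `y`, for tangent vectors based at `z`. -/

/-- A field of bilinear forms on the tangent spaces of an `n`-manifold. -/
abbrev MetricField (n : ℕ) (M : Type*) [TopologicalSpace M]
    [ChartedSpace (EuclideanSpace ℝ (Fin n)) M] : Type _ :=
  ∀ x : M, TangentSpace (𝓡 n) x →L[ℝ] TangentSpace (𝓡 n) x →L[ℝ] ℝ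

section Charts

variable {n : ℕ} {M : Type*} [TopologicalSpace M] [ChartedSpace (EuclideanSpace ℝ (Fin n)) M]

/-- The `i`-th coordinate vector at `x` of the preferred chart at `x`. -/
def stdVec (x : M) (i : Fin n) : TangentSpace (𝓡 n) x :=
  (EuclideanSpace.single i (1 : ℝ) : EuclideanSpace ℝ (Fin n))

/-- The matrix of `σ` at `x` in the preferred chart at `x`. -/
def gram (σ : MetricField n M) (x : M) : Matrix (Fin n) (Fin n) ℝ :=
  Matrix.of fun i j => σ x (stdVec x i) (stdVec x j)

/-- The differential of a real function. -/
def diff (f : M → ℝ) (x : M) (w : TangentSpace (𝓡 n) x) : ℝ :=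
  mfderiv (𝓡 n) 𝓘(ℝ, ℝ) f x w

/-- The tangent vector metrically dual to a linear form, `(σ⁻¹)ⁱʲ b(∂ⱼ) ∂ᵢ`. -/
def sharp (σ : MetricField n M) (x : M) (b : TangentSpace (𝓡 n) x → ℝ) : TangentSpace (𝓡 n) x :=
  ∑ i, ∑ j, ((gram σ x)⁻¹ i j * b (stdVec x j)) • stdVec x i

/-- The gradient of `f`. -/
def grad (σ : MetricField n M) (f : M → ℝ) (x : M) : TangentSpace (𝓡 n) x :=
  sharp σ x (diff f x)

variable [IsManifold (𝓡 n) ∞ M]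

/-- The value at `y` of `σ` on the vector fields with constant components `a`, `b` in the chart
at `x`. -/
def coordMetric (σ : MetricField n M) (x y : M) (a b : EuclideanSpace ℝ (Fin n)) : ℝ :=
  σ y (tangentCoordChange (𝓡 n) x y y a) (tangentCoordChange (𝓡 n) x y y b)

/-- `√(det σ)` at `y`, computed in the chart at `x`. -/
def volDensity (σ : MetricField n M) (x y : M) : ℝ :=
  √(Matrix.of fun i j : Fin n =>
    coordMetric σ x y (EuclideanSpace.single i 1) (EuclideanSpace.single j 1)).det

/-- The `i`-th component at `y`, in the chart at `x`, of the vector field `V`. -/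
def coordComponent (V : ∀ y : M, TangentSpace (𝓡 n) y) (x : M) (i : Fin n) (y : M) : ℝ :=
  (tangentCoordChange (𝓡 n) y x y (V y) : EuclideanSpace ℝ (Fin n)) i

/-- The divergence `(det σ)^(-1/2) ∂ᵢ ((det σ)^(1/2) Vⁱ)`, evaluated at `x` in the chart at `x`. -/
def divergence (σ : MetricField n M) (V : ∀ y : M, TangentSpace (𝓡 n) y) (x : M) : ℝ :=
  (volDensity σ x x)⁻¹ *
    ∑ i, diff (fun y => volDensity σ x y * coordComponent V x i y) x (stdVec x i)

/-- The Laplace-Beltrami operator. -/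
def laplacian (σ : MetricField n M) (f : M → ℝ) (x : M) : ℝ :=
  divergence σ (grad σ f) x

/-- The Riemannian measure on the domain of the chart at `x`: the image of `√(det σ) du`. -/
def chartMeasure [MeasurableSpace M] (σ : MetricField n M) (x : M) : Measure M :=
  (((volume : Measure (EuclideanSpace ℝ (Fin n))).restrict (extChartAt (𝓡 n) x).target).withDensity
    fun u => ENNReal.ofReal (volDensity σ x ((extChartAt (𝓡 n) x).symm u))).map
      (extChartAt (𝓡 n) x).symm

/-- The Riemannian measure of `σ`: the least measure that dominates all the measures
`chartMeasure σ x`. These agree on overlaps of charts, so it restricts to each of them on the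
domain of the corresponding chart. -/
def riemannianMeasure [MeasurableSpace M] (σ : MetricField n M) : Measure M :=
  ⨆ x : M, chartMeasure σ x

/-- The Levi-Civita Christoffel symbol of `g` at `x`, in the chart at `x`:
`½ gᵏˡ (∂ₐ g_{bl} + ∂_b g_{al} - ∂ₗ g_{ab})`, contracted with `a` and `b`. -/
def christoffel (g : MetricField n M) (x : M) (a b : TangentSpace (𝓡 n) x) :
    TangentSpace (𝓡 n) x :=
  sharp g x fun c =>
    (diff (fun y => coordMetric g x y b c) x a + diff (fun y => coordMetric g x y a c) x b
      - diff (fun y => coordMetric g x y a b) x c) / 2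

end Charts

section Immersions

variable {m n : ℕ} {S M : Type*}
  [TopologicalSpace S] [ChartedSpace (EuclideanSpace ℝ (Fin m)) S]
  [TopologicalSpace M] [ChartedSpace (EuclideanSpace ℝ (Fin n)) M]

/-- The metric on `S` induced by `F : S → M`. -/
def induced (g : MetricField n M) (F : S → M) : MetricField m S :=
  fun p =>
    let G : EuclideanSpace ℝ (Fin n) →L[ℝ] EuclideanSpace ℝ (Fin n) →L[ℝ] ℝ := g (F p)
    let A : EuclideanSpace ℝ (Fin m) →L[ℝ] EuclideanSpace ℝ (Fin n) := mfderiv (𝓡 m) (𝓡 n) F p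
    G.bilinearComp A A

theorem induced_apply (g : MetricField n M) (F : S → M) (p : S) (w w' : TangentSpace (𝓡 m) p) :
    induced g F p w w'
      = g (F p) (mfderiv (𝓡 m) (𝓡 n) F p w) (mfderiv (𝓡 m) (𝓡 n) F p w') := rfl

/-- The component of `Z` normal to the immersed submanifold `F : S → M` at `p`. -/
def normalPart (g : MetricField n M) (F : S → M) (p : S) (Z : TangentSpace (𝓡 n) (F p)) :
    TangentSpace (𝓡 n) (F p) :=
  Z - mfderiv (𝓡 m) (𝓡 n) F p
    (sharp (induced g F) p fun w => g (F p) Z (mfderiv (𝓡 m) (𝓡 n) F p w))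

variable [IsManifold (𝓡 m) ∞ S] [IsManifold (𝓡 n) ∞ M]

/-- The components at `q`, in the chart at `F p`, of a vector field `V` along `F : S → M`. -/
def coordsAlong (F : S → M) (V : ∀ q : S, TangentSpace (𝓡 n) (F q)) (p q : S) :
    EuclideanSpace ℝ (Fin n) :=
  tangentCoordChange (𝓡 n) (F q) (F p) (F q) (V q)

/-- The derivative in the direction `w`, at `p`, of the components of `V` in the chart at `F p`. -/
def coordDeriv (F : S → M) (V : ∀ q : S, TangentSpace (𝓡 n) (F q)) (p : S)
    (w : TangentSpace (𝓡 m) p) : TangentSpace (𝓡 n) (F p) :=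
  mfderiv (𝓡 m) 𝓘(ℝ, EuclideanSpace ℝ (Fin n)) (coordsAlong F V p) p w

/-- The Levi-Civita derivative in the direction `w` of a vector field `V` along `F : S → M`:
`w(Vᵏ) + Γᵏᵢⱼ dF(w)ⁱ Vʲ`, at `p`, in the chart at `F p`. -/
def covDeriv (g : MetricField n M) (F : S → M) (V : ∀ q : S, TangentSpace (𝓡 n) (F q)) (p : S)
    (w : TangentSpace (𝓡 m) p) : TangentSpace (𝓡 n) (F p) :=
  coordDeriv F V p w + christoffel g (F p) (mfderiv (𝓡 m) (𝓡 n) F p w) (V p)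

/-- The image under `dF` of the `i`-th coordinate vector field of the chart at `p`. -/
def coordField (F : S → M) (p : S) (i : Fin m) (q : S) : TangentSpace (𝓡 n) (F q) :=
  mfderiv (𝓡 m) (𝓡 n) F q (tangentCoordChange (𝓡 m) p q q (EuclideanSpace.single i (1 : ℝ)))

/-- The mean curvature vector `σⁱʲ (∇ᵢ ∂ⱼF)^⊥` of `F : S → M` (unnormalized trace), where `σ` is
the induced metric. -/
def meanCurvature (g : MetricField n M) (F : S → M) (p : S) : TangentSpace (𝓡 n) (F p) :=
  normalPart (m := m) g F p (∑ i : Fin m, ∑ j : Fin m,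
    (gram (induced (m := m) g F) p)⁻¹ i j • covDeriv g F (coordField F p j) p (stdVec p i))

end Immersions

/-! ## Lorentzian metrics and Minkowski space -/

/-- The diagonal `(-1, 1, 1, 1)`. -/
def signature (i : Fin 4) : ℝ := if i = 0 then -1 else 1

/-- `g` is a smooth Lorentzian metric of signature `(-,+,+,+)`. -/
structure IsLorentzian {N : Type*} [TopologicalSpace N]
    [ChartedSpace (EuclideanSpace ℝ (Fin 4)) N] [IsManifold (𝓡 4) ∞ N]
    (g : MetricField 4 N) : Prop where
  symm : ∀ (x : N) (v w : TangentSpace (𝓡 4) x), g x v w = g x w v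
  smooth : ContMDiff (𝓡 4)
    ((𝓡 4).prod 𝓘(ℝ, EuclideanSpace ℝ (Fin 4) →L[ℝ] EuclideanSpace ℝ (Fin 4) →L[ℝ] ℝ)) ∞
    (fun x => Bundle.TotalSpace.mk'
      (EuclideanSpace ℝ (Fin 4) →L[ℝ] EuclideanSpace ℝ (Fin 4) →L[ℝ] ℝ)
      (E := fun x : N => TangentSpace (𝓡 4) x →L[ℝ] TangentSpace (𝓡 4) x →L[ℝ] ℝ) x (g x))
  lorentz : ∀ x : N, ∃ e : Fin 4 → TangentSpace (𝓡 4) x,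
    ∀ i j, g x (e i) (e j) = if i = j then signature i else 0

/-- The Minkowski inner product `-a₀b₀ + a₁b₁ + a₂b₂ + a₃b₃` on `ℝ^{3,1}`. -/
def eta : EuclideanSpace ℝ (Fin 4) →L[ℝ] EuclideanSpace ℝ (Fin 4) →L[ℝ] ℝ :=
  ∑ i : Fin 4, signature i •
    (EuclideanSpace.proj i : EuclideanSpace ℝ (Fin 4) →L[ℝ] ℝ).smulRight
      (EuclideanSpace.proj i : EuclideanSpace ℝ (Fin 4) →L[ℝ] ℝ)

/-- The Minkowski metric on `ℝ^{3,1}`. -/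
def minkowski : MetricField 4 (EuclideanSpace ℝ (Fin 4)) := fun _ => eta

/-! ## The new quasi-local energy -/

/-- A surface `F : S → N` in a spacetime `(N, g)` together with a reference immersion `X` into
Minkowski space, an observer `T0`, and the unit normal fields that fix orientations:
`eJ = J / |H|` along `F`, `eJ0 = J₀ / |H₀|` along `X`, and the normal `nu` of the projection of
`X(S)` to the orthogonal complement of `T0`. See `Configuration.Admissible`. -/
structure Configuration (N S : Type*)
    [TopologicalSpace N] [ChartedSpace (EuclideanSpace ℝ (Fin 4)) N]
    [TopologicalSpace S] [ChartedSpace (EuclideanSpace ℝ (Fin 2)) S] where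
  g : MetricField 4 N
  F : S → N
  eJ : ∀ p : S, TangentSpace (𝓡 4) (F p)
  X : S → EuclideanSpace ℝ (Fin 4)
  T0 : EuclideanSpace ℝ (Fin 4)
  eJ0 : S → EuclideanSpace ℝ (Fin 4)
  nu : S → EuclideanSpace ℝ (Fin 4)

namespace Configuration

section

variable {N S : Type*}
  [TopologicalSpace N] [ChartedSpace (EuclideanSpace ℝ (Fin 4)) N]
  [TopologicalSpace S] [ChartedSpace (EuclideanSpace ℝ (Fin 2)) S]
  (D : Configuration N S)

/-- The induced metric of the surface. -/
def sigma : MetricField 2 S := induced D.g D.F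

/-- The time function `τ = -⟨X, T₀⟩`. -/
def tau (p : S) : ℝ := -eta (D.X p) D.T0

/-- `∇τ`. -/
def gradTau (p : S) : TangentSpace (𝓡 2) p := grad D.sigma D.tau p

/-- `|∇τ|²`. -/
def normSqGradTau (p : S) : ℝ := D.sigma p (D.gradTau p) (D.gradTau p)

/-- The projection of `X` to the orthogonal complement of `T₀`, `X + ⟨X, T₀⟩ T₀`. -/
def Xhat (p : S) : EuclideanSpace ℝ (Fin 4) := D.X p + eta (D.X p) D.T0 • D.T0

/-- The metric of the projected surface. -/
def sigmaHat : MetricField 2 S := induced minkowski D.Xhat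

variable [IsManifold (𝓡 4) ∞ N] [IsManifold (𝓡 2) ∞ S]

/-- `Δτ`. -/
def lapTau (p : S) : ℝ := laplacian D.sigma D.tau p

/-- The mean curvature vector `H` of the surface in the spacetime. -/
def H (p : S) : TangentSpace (𝓡 4) (D.F p) := meanCurvature (m := 2) D.g D.F p

/-- `|H|`. -/
def normH (p : S) : ℝ := √|D.g (D.F p) (D.H p) (D.H p)|

/-- `e_H = -H / |H|`. -/
def eH (p : S) : TangentSpace (𝓡 4) (D.F p) := -((D.normH p)⁻¹ • D.H p)

/-- `sinh θ = Δτ / (|H| √(1 - |∇τ|²))`. -/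
def theta (p : S) : ℝ := Real.arsinh (D.lapTau p / (D.normH p * √(1 - D.normSqGradTau p)))

/-- The canonical normal `v = cosh θ e_J - sinh θ e_H`. -/
def v (p : S) : TangentSpace (𝓡 4) (D.F p) :=
  Real.cosh (D.theta p) • D.eJ p - Real.sinh (D.theta p) • D.eH p

/-- The canonical normal `u = -sinh θ e_J + cosh θ e_H`. -/
def u (p : S) : TangentSpace (𝓡 4) (D.F p) :=
  -(Real.sinh (D.theta p) • D.eJ p) + Real.cosh (D.theta p) • D.eH p

/-- `α_v = ⟨∇ v, u⟩`. -/
def alphaV (p : S) (w : TangentSpace (𝓡 2) p) : ℝ :=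
  D.g (D.F p) (covDeriv D.g D.F D.v p w) (D.u p)

/-- `α_J = ⟨∇ (J / |H|), -H / |H|⟩`. -/
def alphaJ (p : S) (w : TangentSpace (𝓡 2) p) : ℝ :=
  D.g (D.F p) (covDeriv D.g D.F D.eJ p w) (D.eH p)

/-- The mean curvature vector `H₀` of the reference surface in Minkowski space. -/
def H0 (p : S) : EuclideanSpace ℝ (Fin 4) := meanCurvature (m := 2) minkowski D.X p

/-- `|H₀|`. -/
def normH0 (p : S) : ℝ := √|eta (D.H0 p) (D.H0 p)|

/-- `e_{H₀} = -H₀ / |H₀|`. -/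
def eH0 (p : S) : EuclideanSpace ℝ (Fin 4) := -((D.normH0 p)⁻¹ • D.H0 p)

/-- `sinh θ₀ = -Δτ / (|H₀| √(1 + |∇τ|²))`. -/
def theta0 (p : S) : ℝ := Real.arsinh (-D.lapTau p / (D.normH0 p * √(1 + D.normSqGradTau p)))

/-- `α_{H₀} = ⟨∇ (-H₀ / |H₀|), J₀ / |H₀|⟩`. -/
def alphaH0 (p : S) (w : TangentSpace (𝓡 2) p) : ℝ :=
  eta (covDeriv minkowski D.X (fun q => D.eH0 q) p w) (D.eJ0 p)

/-- The mean curvature of the projected surface in the Euclidean hyperplane orthogonal to `T₀`,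
with respect to `nu`, positive for round spheres with outward normal. The hyperplane is totally
geodesic, so that the mean curvature vector may be computed in `ℝ^{3,1}`. -/
def kHat (p : S) : ℝ := -eta (meanCurvature (m := 2) minkowski D.Xhat p) (D.nu p)

/-- The standing assumptions. -/
structure Admissible : Prop where
  /-- `(N, g)` is a smooth spacetime. -/
  lorentzian : IsLorentzian D.g
  /-- The surface is smooth, -/
  smooth_F : ContMDiff (𝓡 2) (𝓡 4) ∞ D.F
  /-- spacelike, -/
  spacelike : ∀ (p : S) (w : TangentSpace (𝓡 2) p), w ≠ 0 → 0 < D.sigma p w w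
  /-- and its mean curvature vector is timelike. -/
  timelike_H : ∀ p, D.g (D.F p) (D.H p) (D.H p) < 0
  /-- `e_J` is a smooth unit spacelike normal field orthogonal to `H`. -/
  smooth_eJ : ContMDiff (𝓡 2) (𝓡 4).tangent ∞
    (fun p => (⟨D.F p, D.eJ p⟩ : TangentBundle (𝓡 4) N))
  normal_eJ : ∀ (p : S) (w : TangentSpace (𝓡 2) p),
    D.g (D.F p) (D.eJ p) (mfderiv (𝓡 2) (𝓡 4) D.F p w) = 0
  unit_eJ : ∀ p, D.g (D.F p) (D.eJ p) (D.eJ p) = 1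
  orth_eJ : ∀ p, D.g (D.F p) (D.eJ p) (D.H p) = 0
  /-- `X` is a smooth isometric immersion into Minkowski space. -/
  smooth_X : ContMDiff (𝓡 2) (𝓡 4) ∞ D.X
  isometric : ∀ (p : S) (w w' : TangentSpace (𝓡 2) p),
    induced minkowski D.X p w w' = D.sigma p w w'
  /-- `T₀` is a future-pointing timelike unit vector. -/
  unit_T0 : eta D.T0 D.T0 = -1
  future_T0 : 0 < D.T0 0
  /-- `|∇τ| < 1`. -/
  gradTau_lt : ∀ p, D.normSqGradTau p < 1
  /-- The mean curvature vector of the reference surface is spacelike. -/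
  spacelike_H0 : ∀ p, 0 < eta (D.H0 p) (D.H0 p)
  /-- `e_{J₀}` is the smooth future-pointing timelike unit normal field orthogonal to `H₀`. -/
  smooth_eJ0 : ContMDiff (𝓡 2) 𝓘(ℝ, EuclideanSpace ℝ (Fin 4)) ∞ D.eJ0
  normal_eJ0 : ∀ (p : S) (w : TangentSpace (𝓡 2) p),
    eta (D.eJ0 p) (mfderiv (𝓡 2) (𝓡 4) D.X p w) = 0
  unit_eJ0 : ∀ p, eta (D.eJ0 p) (D.eJ0 p) = -1
  orth_eJ0 : ∀ p, eta (D.eJ0 p) (D.H0 p) = 0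
  future_eJ0 : ∀ p, 0 < D.eJ0 p 0
  /-- `nu` is the smooth outward unit normal field of the projected surface in the Euclidean
  hyperplane orthogonal to `T₀`. Outward: wherever a linear function `⟨·, a⟩` on that hyperplane
  attains its maximum over the projected surface, `nu` points to the side of `a`. -/
  smooth_nu : ContMDiff (𝓡 2) 𝓘(ℝ, EuclideanSpace ℝ (Fin 4)) ∞ D.nu
  horizontal_nu : ∀ p, eta (D.nu p) D.T0 = 0
  normal_nu : ∀ (p : S) (w : TangentSpace (𝓡 2) p),
    eta (D.nu p) (mfderiv (𝓡 2) (𝓡 4) D.Xhat p w) = 0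
  unit_nu : ∀ p, eta (D.nu p) (D.nu p) = 1
  outward_nu : ∀ (p : S) (a : EuclideanSpace ℝ (Fin 4)), eta a D.T0 = 0 →
    (∀ q, eta (D.Xhat q) a ≤ eta (D.Xhat p) a) → 0 ≤ eta (D.nu p) a

/-- The integrand `-√(1 - |∇τ|²) ⟨H, u⟩ - α_v(∇τ)` of the physical term. -/
def physicalIntegrand (p : S) : ℝ :=
  -√(1 - D.normSqGradTau p) * D.g (D.F p) (D.H p) (D.u p) - D.alphaV p (D.gradTau p)

/-- The new quasi-local energy. -/
def QLEnew [MeasurableSpace S] : ℝ :=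
  1 / (8 * Real.pi) * ∫ p, D.kHat p ∂(riemannianMeasure D.sigmaHat)
    - 1 / (8 * Real.pi) * ∫ p, D.physicalIntegrand p ∂(riemannianMeasure D.sigma)

/-- The new surface mass density. -/
def rhoNew (p : S) : ℝ :=
  D.normH0 p * Real.cosh (D.theta0 p) / √(1 + D.normSqGradTau p)
    + D.normH p * Real.cosh (D.theta p) / √(1 - D.normSqGradTau p)

/-- The new current, as a vector field. -/
def jNew (p : S) : TangentSpace (𝓡 2) p :=
  (D.normH0 p * Real.cosh (D.theta0 p) / √(1 + D.normSqGradTau p)) • D.gradTau p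
    - (D.normH p * Real.cosh (D.theta p) / √(1 - D.normSqGradTau p)) • D.gradTau p
    - grad D.sigma (fun q => D.theta0 q - D.theta q) p
    - sharp D.sigma p (D.alphaH0 p) + sharp D.sigma p (D.alphaJ p)

end

end Configuration

end QuasiLocal

end

/-! The heart of the matter is a pointwise identity on the surface. With n = |∇τ|², the quantity
√(1+n) k̂ minus the physical integrand equals ρ + dτ(j) (`density_identity`). The projected surface
has metric σ + dτ⊗dτ, hence area element √(1+n) dσ (`sigmaHat_eq`), so the left side integrates to
8π times the energy. Since j is divergence free, ∫ dτ(j) = 0 on the closed surface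
(`integral_dd_eq_zero`). Only ∫ ρ is left, and ρ is a sum of two nonnegative terms because
cosh(arsinh x) = √(1+x²).

Reference side. The horizontal normal ν is also normal to X, and ⟨dν, T₀⟩ = 0, so X and its
projection have the same form ⟨dν, dX⟩; only the metric used for the trace differs, by the rank-one
term dτ⊗dτ. Inverting it gives ⟨Ĥ,ν⟩ = ⟨H₀,ν⟩ + ⟨dν(∇τ), dX(∇τ)⟩/(1+n) (`eta_mcv_proj`). The
normalized normal part of T₀ is (T₀+∇τ)/√(1+n) = −sinh θ₀ e_{H₀} + cosh θ₀ e_{J₀}, because Δτ =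
−⟨H₀,T₀⟩ (`laplacian_height`, `observer_eq`). Therefore ν = ±(cosh θ₀ e_{H₀} − sinh θ₀ e_{J₀}), with
the plus sign by outwardness at a maximum of a linear function and connectedness (`eta_ν_dirH`).
Rotating an orthonormal frame by a hyperbolic angle t adds dt to its connection form
(`conn_rotation`), which gives √(1+n) k̂ = √(1+n) |H₀| cosh θ₀ − (dθ₀ + α_{H₀})(∇τ).

Physical side. The same rotation formula and ⟨H,u⟩ = |H| cosh θ turn the physical integrand into
−√(1−n) |H| cosh θ − (dθ + α_J)(∇τ). Subtracting the two expressions gives ρ + dτ(j).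

Each value of a tensor is expressed in the preferred chart at its own base point, and this chart may
jump from point to point. Smoothness therefore needs the transformation laws to one fixed chart
(`koszul_transition`, `conn_chart`, `trace_eq`). Smoothness of the mean curvature vectors comes from
codimension two together with the given unit normal orthogonal to them (`alongAt_mcv`). -/

open scoped Manifold ContDiff
open MeasureTheory

noncomputable section

namespace QuasiLocal

open scoped Topology
open Filter

set_option linter.unusedSectionVars false

/-! ## Derivatives of vector-valued functions on a manifold -/

/-- Euclidean space of dimension `n`. -/
abbrev Euc (n : ℕ) : Type := EuclideanSpace ℝ (Fin n)

section ChartCalculus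

variable {n : ℕ} {M : Type*} [TopologicalSpace M] [ChartedSpace (EuclideanSpace ℝ (Fin n)) M]
  {E' : Type*} [NormedAddCommGroup E'] [NormedSpace ℝ E']
  {F' : Type*} [NormedAddCommGroup F'] [NormedSpace ℝ F']

variable (n) in
/-- The domain of the preferred chart at `x`. -/
abbrev src (x : M) : Set M := (chartAt (EuclideanSpace ℝ (Fin n)) x).source

variable (n) in
/-- The derivative of a vector-valued function on a manifold. -/
def dd (h : M → E') (p : M) : Euc n →L[ℝ] E' := mfderiv (𝓡 n) 𝓘(ℝ, E') h p

variable (n) in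
/-- Smoothness at a point of a vector-valued function on a manifold. -/
abbrev SmAt (h : M → E') (p : M) : Prop := ContMDiffAt (𝓡 n) 𝓘(ℝ, E') ∞ h p

variable (n) in
/-- Differentiability at a point of a vector-valued function on a manifold. -/
abbrev DfAt (h : M → E') (p : M) : Prop := MDifferentiableAt (𝓡 n) 𝓘(ℝ, E') h p

theorem SmAt.dfAt {h : M → E'} {p : M} (hh : SmAt n h p) : DfAt n h p :=
  ContMDiffAt.mdifferentiableAt hh (by simp)

/-- The model has no boundary, so the derivative within its range is an ordinary Fréchet derivative.
The calculus rules below are transported from Fréchet calculus through this lemma and its converse.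
-/
theorem DfAt.hasFDerivAt {h : M → E'} {p : M} (hh : DfAt n h p) :
    HasFDerivAt (h ∘ (extChartAt (𝓡 n) p).symm) (dd n h p) (extChartAt (𝓡 n) p p) := by
  have := hh.hasMFDerivAt.2
  rw [← hasFDerivWithinAt_univ]
  rw [modelWithCornersSelf_coe, Set.range_id] at this
  exact this

theorem dd_eq_of_hasFDerivAt {h : M → E'} {p : M} {L : Euc n →L[ℝ] E'} (hc : ContinuousAt h p)
    (hh : HasFDerivAt (h ∘ (extChartAt (𝓡 n) p).symm) L (extChartAt (𝓡 n) p p)) :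
    DfAt n h p ∧ dd n h p = L := by
  have : HasMFDerivAt (𝓡 n) 𝓘(ℝ, E') h p L := ⟨hc, by
    rw [← hasFDerivWithinAt_univ] at hh
    rw [modelWithCornersSelf_coe, Set.range_id]
    exact hh⟩
  exact ⟨this.mdifferentiableAt, this.mfderiv⟩

theorem dd_congr {h h' : M → E'} {p : M} (hh : h =ᶠ[𝓝 p] h') :
    (dd n h p : Euc n →L[ℝ] E') = dd n h' p := hh.mfderiv_eq

theorem dd_const (c : E') (p : M) : (dd n (fun _ : M => c) p : Euc n →L[ℝ] E') = 0 :=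
  mfderiv_const

theorem dd_clm_apply {A : M → E' →L[ℝ] F'} {v : M → E'} {p : M} (hA : DfAt n A p) (hv : DfAt n v p) :
    DfAt n (fun q => A q (v q)) p ∧
    ∀ w, dd n (fun q => A q (v q)) p w = dd n A p w (v p) + A p (dd n v p w) := by
  have h := hA.hasFDerivAt.clm_apply hv.hasFDerivAt
  have := dd_eq_of_hasFDerivAt (h := fun q => A q (v q)) (hA.continuousAt.clm_apply hv.continuousAt) h
  refine ⟨this.1, fun w => ?_⟩
  rw [this.2]
  simp [add_comm]

theorem dd_apply_const {A : M → E' →L[ℝ] F'} {p : M} (hA : DfAt n A p) (v : E') (w : Euc n) :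
    dd n (fun q => A q v) p w = dd n A p w v := by
  rw [(dd_clm_apply hA (v := fun _ => v) mdifferentiableAt_const).2 w, dd_const]; simp

theorem dd_clm_comp (L : E' →L[ℝ] F') {v : M → E'} {p : M} (hv : DfAt n v p) :
    DfAt n (fun q => L (v q)) p ∧ ∀ w, dd n (fun q => L (v q)) p w = L (dd n v p w) := by
  have := dd_clm_apply (A := fun _ : M => L) (p := p) mdifferentiableAt_const hv
  refine ⟨this.1, fun w => ?_⟩
  rw [this.2 w, dd_const]; simp

theorem dd_add {v v' : M → E'} {p : M} (hv : DfAt n v p) (hv' : DfAt n v' p) :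
    DfAt n (fun q => v q + v' q) p ∧ dd n (fun q => v q + v' q) p = dd n v p + dd n v' p :=
  dd_eq_of_hasFDerivAt (h := fun q => v q + v' q) (hv.continuousAt.add hv'.continuousAt)
    (hv.hasFDerivAt.add hv'.hasFDerivAt)

theorem dd_sub {v v' : M → E'} {p : M} (hv : DfAt n v p) (hv' : DfAt n v' p) :
    DfAt n (fun q => v q - v' q) p ∧ dd n (fun q => v q - v' q) p = dd n v p - dd n v' p :=
  dd_eq_of_hasFDerivAt (h := fun q => v q - v' q) (hv.continuousAt.sub hv'.continuousAt)
    (hv.hasFDerivAt.sub hv'.hasFDerivAt)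

theorem dd_smul {f : M → ℝ} {v : M → E'} {p : M} (hf : DfAt n f p) (hv : DfAt n v p) :
    DfAt n (fun q => f q • v q) p ∧
    ∀ w, dd n (fun q => f q • v q) p w = dd n f p w • v p + f p • dd n v p w := by
  have h := hf.hasFDerivAt.smul hv.hasFDerivAt
  have := dd_eq_of_hasFDerivAt (h := fun q => f q • v q) (hf.continuousAt.smul hv.continuousAt) h
  refine ⟨this.1, fun w => ?_⟩
  rw [this.2]
  simp [add_comm]

theorem dd_mul {f v : M → ℝ} {p : M} (hf : DfAt n f p) (hv : DfAt n v p) :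
    DfAt n (fun q => f q * v q) p ∧
    ∀ w, dd n (fun q => f q * v q) p w = dd n f p w * v p + f p * dd n v p w :=
  dd_smul hf hv

theorem dd_real_comp {f : M → ℝ} {φ : ℝ → ℝ} {φ' : ℝ} {p : M} (hf : DfAt n f p)
    (hφ : HasDerivAt φ φ' (f p)) :
    DfAt n (fun q => φ (f q)) p ∧ ∀ w, dd n (fun q => φ (f q)) p w = φ' * dd n f p w := by
  have hφ' : HasDerivAt φ φ' ((f ∘ (extChartAt (𝓡 n) p).symm) (extChartAt (𝓡 n) p p)) := by
    simpa using hφ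
  have h := hφ'.comp_hasFDerivAt _ hf.hasFDerivAt
  have := dd_eq_of_hasFDerivAt (h := fun q => φ (f q))
    (hφ.continuousAt.comp hf.continuousAt) h
  refine ⟨this.1, fun w => ?_⟩
  rw [this.2]; simp

theorem mem_source_iff {x y : M} :
    y ∈ (extChartAt (𝓡 n) x).source ↔ y ∈ src n x := by
  rw [extChartAt_source]

theorem source_mem_nhds {x y : M} (hy : y ∈ src n x) :
    ∀ᶠ q in 𝓝 y, q ∈ src n x :=
  (chartAt (EuclideanSpace ℝ (Fin n)) x).open_source.mem_nhds hy

theorem symm_chart {x y : M} (hy : y ∈ src n x) :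
    (extChartAt (𝓡 n) x).symm (extChartAt (𝓡 n) x y) = y :=
  (extChartAt (𝓡 n) x).left_inv (mem_source_iff.2 hy)

variable [IsManifold (𝓡 n) ∞ M]

variable (n) in
/-- The derivative at `z` of the change of coordinates from the chart at `x` to that at `y`. -/
def tcc (x y z : M) : Euc n →L[ℝ] Euc n := tangentCoordChange (𝓡 n) x y z

theorem tcc_self {x z : M} (h : z ∈ src n x) (v : Euc n) :
    tcc n x x z v = v :=
  tangentCoordChange_self (mem_source_iff.2 h)

theorem tcc_tcc {w x y z : M} (hw : z ∈ src n w)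
    (hx : z ∈ src n x)
    (hy : z ∈ src n y) (v : Euc n) :
    tcc n x y z (tcc n w x z v) = tcc n w y z v :=
  tangentCoordChange_comp ⟨⟨mem_source_iff.2 hw, mem_source_iff.2 hx⟩, mem_source_iff.2 hy⟩

theorem tcc_tcc_self {x y z : M} (hx : z ∈ src n x)
    (hy : z ∈ src n y) (v : Euc n) :
    tcc n y x z (tcc n x y z v) = v := by
  rw [tcc_tcc hx hy hx, tcc_self hx]

theorem hasFDerivAt_transition {x y z : M}
    (hx : z ∈ src n x)
    (hy : z ∈ src n y) :
    HasFDerivAt (extChartAt (𝓡 n) y ∘ (extChartAt (𝓡 n) x).symm) (tcc n x y z)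
      (extChartAt (𝓡 n) x z) := by
  have := hasFDerivWithinAt_tangentCoordChange (I := 𝓡 n) (x := x) (y := y) (z := z)
    ⟨mem_source_iff.2 hx, mem_source_iff.2 hy⟩
  simpa only [tcc, modelWithCornersSelf_coe, Set.range_id, hasFDerivWithinAt_univ] using this

theorem smAt_chart {x y : M} (hy : y ∈ src n x) :
    SmAt n (extChartAt (𝓡 n) x) y := contMDiffAt_extChartAt' hy

theorem contMDiffAt_chart_symm {x y : M}
    (hy : y ∈ src n x) :
    ContMDiffAt 𝓘(ℝ, Euc n) (𝓡 n) ∞ (extChartAt (𝓡 n) x).symm (extChartAt (𝓡 n) x y) :=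
  (contMDiffOn_extChartAt_symm x).contMDiffAt
    ((isOpen_extChartAt_target x).mem_nhds
      ((extChartAt (𝓡 n) x).map_source (mem_source_iff.2 hy)))

theorem contDiffAt_in_chart {x y : M} (hy : y ∈ src n x)
    {h : M → E'} (hh : SmAt n h y) :
    ContDiffAt ℝ ∞ (h ∘ (extChartAt (𝓡 n) x).symm) (extChartAt (𝓡 n) x y) := by
  rw [← contMDiffAt_iff_contDiffAt]
  refine ContMDiffAt.comp _ ?_ (contMDiffAt_chart_symm hy)
  rwa [symm_chart hy]

theorem smAt_comp_chart {x y : M} (hy : y ∈ src n x)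
    {h : Euc n → E'} (hh : ContDiffAt ℝ ∞ h (extChartAt (𝓡 n) x y)) :
    SmAt n (fun q => h (extChartAt (𝓡 n) x q)) y :=
  ContMDiffAt.comp y (contMDiffAt_iff_contDiffAt.2 hh) (smAt_chart hy)

theorem dd_chart {x y : M} (hy : y ∈ src n x) :
    dd n (extChartAt (𝓡 n) x) y = tcc n y x y :=
  mfderiv_chartAt_eq_tangentCoordChange hy

/-- `dd` at `y` refers to the preferred chart at `y`. Fed with the coordinate vectors of one fixed
chart, it becomes by the chain rule an ordinary partial derivative in that chart. -/
theorem dd_cvec {x y : M} (hy : y ∈ src n x)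
    {h : M → E'} (hh : DfAt n h y) (a : Euc n) :
    dd n h y (tcc n x y y a)
      = fderiv ℝ (h ∘ (extChartAt (𝓡 n) x).symm) (extChartAt (𝓡 n) x y) a := by
  have h1 := hasFDerivAt_transition hy (mem_chart_source _ y)
  have h2 := hh.hasFDerivAt
  have e1 : (extChartAt (𝓡 n) y ∘ (extChartAt (𝓡 n) x).symm) (extChartAt (𝓡 n) x y)
      = extChartAt (𝓡 n) y y := by
    rw [Function.comp_apply, symm_chart hy]
  rw [← e1] at h2
  have h3 := h2.comp _ h1
  have h4 : (h ∘ (extChartAt (𝓡 n) x).symm) =ᶠ[𝓝 (extChartAt (𝓡 n) x y)]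
      ((h ∘ (extChartAt (𝓡 n) y).symm) ∘ (extChartAt (𝓡 n) y ∘ (extChartAt (𝓡 n) x).symm)) := by
    have hc : ContinuousAt (extChartAt (𝓡 n) x).symm (extChartAt (𝓡 n) x y) :=
      (contMDiffAt_chart_symm hy).continuousAt
    have := hc.eventually (p := fun q => q ∈ src n y) (by
      rw [symm_chart hy]; exact source_mem_nhds (mem_chart_source _ y))
    filter_upwards [this] with u hu
    simp only [Function.comp_apply]
    rw [symm_chart hu]
  rw [(h3.congr_of_eventuallyEq h4).fderiv]
  rfl

/-- Order one is enough, and being C¹ at a point is an open condition. -/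
theorem SmAt.eventually_dfAt {h : M → E'} {y : M} (hh : SmAt n h y) :
    ∀ᶠ q in 𝓝 y, DfAt n h q := by
  have h1 : ContMDiffAt (𝓡 n) 𝓘(ℝ, E') 1 h y := ContMDiffAt.of_le hh (by simp)
  rw [contMDiffAt_iff_contMDiffAt_nhds (by simp)] at h1
  filter_upwards [h1] with q hq
  exact hq.mdifferentiableAt (by simp)

/-- In the fixed chart this is a partial derivative of a smooth function. Contraction with the
coordinate field matters, since the components of `dd n h q` alone may jump with the preferred chart
at `q`. -/
theorem smAt_dd_cvec {x y : M} (hy : y ∈ src n x)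
    {h : M → E'} (hh : SmAt n h y) (a : Euc n) : SmAt n (fun q => dd n h q (tcc n x q q a)) y := by
  have h1 : ContDiffAt ℝ ∞ (fun u => fderiv ℝ (h ∘ (extChartAt (𝓡 n) x).symm) u a)
      (extChartAt (𝓡 n) x y) :=
    ((contDiffAt_in_chart hy hh).fderiv_right (by simp)).clm_apply contDiffAt_const
  refine (smAt_comp_chart hy h1).congr_of_eventuallyEq ?_
  filter_upwards [hh.eventually_dfAt, source_mem_nhds hy] with q hq hq'
  exact dd_cvec hq' hq a

theorem smAt_tcc {x y z : M} (hx : z ∈ src n x)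
    (hy : z ∈ src n y) :
    SmAt n (fun q => tcc n x y q) z := by
  have h0 := contDiffAt_in_chart hx (smAt_chart hy)
  refine (smAt_comp_chart hx (h0.fderiv_right (m := ∞) (by simp))).congr_of_eventuallyEq ?_
  filter_upwards [source_mem_nhds hx, source_mem_nhds hy] with q hq hq'
  exact (hasFDerivAt_transition hq hq').fderiv.symm

/-- The second derivative of a change of coordinates is symmetric. -/
theorem dd_tcc_symm {x y : M} (hy : x ∈ src n y)
    (a b : Euc n) : dd n (fun q => tcc n x y q) x a b = dd n (fun q => tcc n x y q) x b a := by
  have hx := mem_chart_source (EuclideanSpace ℝ (Fin n)) x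
  have h0 := contDiffAt_in_chart hx (smAt_chart hy)
  have key : dd n (fun q => tcc n x y q) x
      = fderiv ℝ (fderiv ℝ (extChartAt (𝓡 n) y ∘ (extChartAt (𝓡 n) x).symm))
        (extChartAt (𝓡 n) x x) := by
    rw [← (smAt_tcc hx hy).dfAt.hasFDerivAt.fderiv]
    refine Filter.EventuallyEq.fderiv_eq ?_
    have hc : ContinuousAt (extChartAt (𝓡 n) x).symm (extChartAt (𝓡 n) x x) :=
      (contMDiffAt_chart_symm hx).continuousAt
    have e1 := hc.eventually (p := fun q => q ∈ src n x) (by rw [symm_chart hx]; exact source_mem_nhds hx)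
    have e2 := hc.eventually (p := fun q => q ∈ src n y) (by rw [symm_chart hx]; exact source_mem_nhds hy)
    filter_upwards [e1, e2, (isOpen_extChartAt_target x).mem_nhds (mem_extChartAt_target x)]
      with u h1 h2 h3
    have := (hasFDerivAt_transition h1 h2).fderiv
    rw [(extChartAt (𝓡 n) x).right_inv h3] at this
    exact this.symm
  rw [key]
  exact (h0.isSymmSndFDerivAt (by
    rw [minSmoothness_of_isRCLikeNormedField]; exact WithTop.coe_le_coe.2 le_top)) a b

end ChartCalculus

/-! ## Musical isomorphism -/

section Sharp

variable {n : ℕ} {M : Type*} [TopologicalSpace M] [ChartedSpace (EuclideanSpace ℝ (Fin n)) M]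

/-- The coordinate vectors, with their type reduced to Euclidean space. -/
def bas (n : ℕ) (i : Fin n) : Euc n := EuclideanSpace.single i (1 : ℝ)

theorem euc_eq_sum (c : Euc n) : c = ∑ i, c i • bas n i := by
  ext j
  simp [bas, Finset.sum_apply, Pi.single_apply]

/-- A metric at a point, with the types of its arguments reduced to Euclidean space. -/
def met (g : MetricField n M) (x : M) : Euc n →L[ℝ] Euc n →L[ℝ] ℝ := g x

theorem gram_apply (g : MetricField n M) (x : M) (i j : Fin n) :
    gram g x i j = met g x (bas n i) (bas n j) := rfl

/-- A kernel vector of the matrix would give a combination of the `e i` orthogonal to the spanning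
family `e`, hence to everything. -/
theorem isUnit_det_of_nondegenerate {B : Euc n →L[ℝ] Euc n →L[ℝ] ℝ}
    (hB : ∀ v, (∀ w, B v w = 0) → v = 0) {e : Fin n → Euc n} (he : LinearIndependent ℝ e) :
    IsUnit (Matrix.of fun i j => B (e i) (e j)).det := by
  rw [isUnit_iff_ne_zero]
  intro h0
  obtain ⟨c, hc, hc0⟩ := Matrix.exists_vecMul_eq_zero_iff.2 h0
  apply hc
  have hsp : Submodule.span ℝ (Set.range e) = ⊤ :=
    he.span_eq_top_of_card_eq_finrank' (by simp)
  have : ∑ i, c i • e i = 0 := by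
    apply hB
    intro w
    have hw : w ∈ Submodule.span ℝ (Set.range e) := by rw [hsp]; trivial
    induction hw using Submodule.span_induction with
    | mem x hx =>
      obtain ⟨j, rfl⟩ := hx
      have := congrFun hc0 j
      simpa [Matrix.vecMul, dotProduct] using this
    | zero => simp
    | add x y _ _ h1 h2 => rw [map_add, h1, h2, add_zero]
    | smul a x _ h1 => rw [map_smul, h1, smul_zero]
  exact funext (Fintype.linearIndependent_iff.1 he c this)

theorem linearIndependent_bas : LinearIndependent ℝ (bas n) := by
  rw [Fintype.linearIndependent_iff]
  intro c hc i
  have := congrArg (fun v : Euc n => v i) hc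
  simpa [bas, Finset.sum_apply, Pi.single_apply] using this

/-- The vector dual to a linear form, with types reduced to Euclidean space. -/
def shp (g : MetricField n M) (x : M) (b : Euc n → ℝ) : Euc n := sharp g x b

theorem sharp_eq (g : MetricField n M) (x : M) (b : Euc n → ℝ) :
    shp g x b = ∑ i, ∑ j, ((gram g x)⁻¹ i j * b (bas n j)) • bas n i := rfl

/-- By linearity it is enough to test on coordinate vectors, where the Gram matrix meets its
inverse. The form must be linear because `sharp` sees only its values on the basis. -/
theorem met_sharp {g : MetricField n M} {x : M} (hs : ∀ v w, met g x v w = met g x w v)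
    (hn : ∀ v, (∀ w, met g x v w = 0) → v = 0) (b : Euc n →ₗ[ℝ] ℝ) (c : Euc n) :
    met g x (shp g x b) c = b c := by
  have hdet : IsUnit (gram g x).det := isUnit_det_of_nondegenerate hn linearIndependent_bas
  rw [sharp_eq]
  have key : ∀ k, met g x (∑ i, ∑ j, ((gram g x)⁻¹ i j * b (bas n j)) • bas n i) (bas n k)
      = b (bas n k) := by
    intro k
    simp only [map_sum, map_smul, sum_apply, smul_apply,
      smul_eq_mul]
    rw [Finset.sum_comm]
    have : ∀ j, ∑ i, (gram g x)⁻¹ i j * b (bas n j) * met g x (bas n i) (bas n k)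
        = (gram g x * (gram g x)⁻¹) k j * b (bas n j) := by
      intro j
      rw [Matrix.mul_apply, Finset.sum_mul]
      refine Finset.sum_congr rfl fun i _ => ?_
      rw [gram_apply, hs (bas n i)]; ring
    simp only [this, Matrix.mul_nonsing_inv _ hdet, Matrix.one_apply]
    simp
  conv_lhs => rw [euc_eq_sum c]
  conv_rhs => rw [euc_eq_sum c]
  rw [map_sum (met g x _), map_sum b]
  refine Finset.sum_congr rfl fun k _ => ?_
  rw [map_smul, map_smul, key]

end Sharp

/-! ## Metrics in charts -/

section Metric

variable {n : ℕ} {M : Type*} [TopologicalSpace M] [ChartedSpace (EuclideanSpace ℝ (Fin n)) M]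
  [IsManifold (𝓡 n) ∞ M]

/-- The metric in the chart at `z`. -/
def gz (g : MetricField n M) (z q : M) : Euc n →L[ℝ] Euc n →L[ℝ] ℝ :=
  (met g q).bilinearComp (tcc n z q q) (tcc n z q q)

theorem gz_apply (g : MetricField n M) (z q : M) (a b : Euc n) :
    gz g z q a b = met g q (tcc n z q q a) (tcc n z q q b) := rfl

theorem met_eq_gz (g : MetricField n M) {z q : M} (hq : q ∈ src n z) (a b : Euc n) :
    met g q a b = gz g z q (tcc n q z q a) (tcc n q z q b) := by
  rw [gz_apply, tcc_tcc_self (mem_chart_source _ q) hq, tcc_tcc_self (mem_chart_source _ q) hq]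

theorem gz_gz (g : MetricField n M) {x z q : M} (hx : q ∈ src n x) (hz : q ∈ src n z)
    (a b : Euc n) : gz g x q a b = gz g z q (tcc n x z q a) (tcc n x z q b) := by
  rw [gz_apply, met_eq_gz g hz, tcc_tcc hx (mem_chart_source _ q) hz,
    tcc_tcc hx (mem_chart_source _ q) hz]

theorem gz_self (g : MetricField n M) (x : M) (a b : Euc n) : gz g x x a b = met g x a b := by
  rw [gz_apply, tcc_self (mem_chart_source _ x), tcc_self (mem_chart_source _ x)]

/-- Smooth nondegenerate metrics. -/
structure SmoothMetric (g : MetricField n M) : Prop where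
  symm : ∀ x v w, met g x v w = met g x w v
  nondeg : ∀ x v, (∀ w, met g x v w = 0) → v = 0
  smooth : ∀ z q, q ∈ src n z → SmAt n (gz g z) q

theorem SmoothMetric.gz_symm {g : MetricField n M} (hg : SmoothMetric g) (z q : M) (a b : Euc n) :
    gz g z q a b = gz g z q b a := hg.symm _ _ _

theorem SmoothMetric.dd_gz_symm {g : MetricField n M} (hg : SmoothMetric g) {z q : M}
    (hq : q ∈ src n z) (w a b : Euc n) : dd n (gz g z) q w a b = dd n (gz g z) q w b a := by
  have h1 := (hg.smooth z q hq).dfAt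
  have e : ∀ a b, dd n (gz g z) q w a b = dd n (fun y => gz g z y a b) q w := by
    intro a b
    have h2 := (dd_clm_apply h1 (v := fun _ => a) mdifferentiableAt_const).1
    rw [dd_apply_const h2, dd_apply_const h1]
  rw [e a b, e b a]
  congr 2
  funext y
  exact hg.gz_symm z y a b

/-- The Christoffel symbol of the first kind at `q`, in the chart at `z`. -/
def koszul (g : MetricField n M) (z q : M) (a b c : Euc n) : ℝ :=
  (dd n (gz g z) q (tcc n z q q a) b c + dd n (gz g z) q (tcc n z q q b) a c
    - dd n (gz g z) q (tcc n z q q c) a b) / 2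

theorem diff_coordMetric {g : MetricField n M} (hg : SmoothMetric g) (x : M) (a b w : Euc n) :
    diff (fun y => coordMetric g x y a b) x w = dd n (gz g x) x w a b := by
  have h1 := (hg.smooth x x (mem_chart_source _ x)).dfAt
  have h2 := (dd_clm_apply h1 (v := fun _ => a) mdifferentiableAt_const).1
  rw [← dd_apply_const h1, ← dd_apply_const h2]
  rfl

/-- The Christoffel symbol, with the types of its arguments reduced to Euclidean space. -/
def chr (g : MetricField n M) (x : M) (a b : Euc n) : Euc n := christoffel g x a b

theorem met_christoffel {g : MetricField n M} (hg : SmoothMetric g) (x : M) (a b c : Euc n) :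
    met g x (chr g x a b) c = koszul g x x a b c := by
  let L : Euc n →ₗ[ℝ] ℝ :=
    { toFun := fun c => (dd n (gz g x) x a b c + dd n (gz g x) x b a c - dd n (gz g x) x c a b) / 2
      map_add' := by intro u v; simp only [map_add, add_apply]; ring
      map_smul' := by
        intro r v
        simp only [map_smul, smul_apply, smul_eq_mul, RingHom.id_apply]; ring }
  have h := met_sharp (hg.symm x) (hg.nondeg x) L c
  have e : chr g x a b = shp g x L := by
    unfold chr christoffel shp
    congr 1
    funext c
    have h1 := diff_coordMetric hg x b c a
    have h2 := diff_coordMetric hg x a c b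
    have h3 := diff_coordMetric hg x a b c
    exact congrArg (· / 2) (congrArg₂ _ (congrArg₂ _ h1 h2) h3)
  rw [e, h]
  simp only [koszul, tcc_self (mem_chart_source (EuclideanSpace ℝ (Fin n)) x)]
  rfl

/-- The transformation law of the Christoffel symbols. -/
theorem koszul_transition {g : MetricField n M} (hg : SmoothMetric g) {x z : M}
    (hz : x ∈ src n z) (a b c : Euc n) :
    koszul g x x a b c = koszul g z x (tcc n x z x a) (tcc n x z x b) (tcc n x z x c)
      + gz g z x (dd n (fun q => tcc n x z q) x a b) (tcc n x z x c) := by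
  have hx := mem_chart_source (EuclideanSpace ℝ (Fin n)) x
  have hT := (smAt_tcc hx hz).dfAt
  have hG := (hg.smooth z x hz).dfAt
  have key : ∀ w a b, dd n (gz g x) x w a b = dd n (gz g z) x w (tcc n x z x a) (tcc n x z x b)
      + gz g z x (dd n (fun q => tcc n x z q) x w a) (tcc n x z x b)
      + gz g z x (tcc n x z x a) (dd n (fun q => tcc n x z q) x w b) := by
    intro w a b
    have h1 := (hg.smooth x x hx).dfAt
    have h2 := (dd_clm_apply h1 (v := fun _ => a) mdifferentiableAt_const).1
    rw [← dd_apply_const h1, ← dd_apply_const h2]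
    have e : (fun q => gz g x q a b) =ᶠ[𝓝 x]
        fun q => gz g z q (tcc n x z q a) (tcc n x z q b) := by
      filter_upwards [source_mem_nhds hx, source_mem_nhds hz] with q h h'
      exact gz_gz g h h' a b
    rw [dd_congr e]
    have ha := (dd_clm_apply hT (v := fun _ => a) mdifferentiableAt_const).1
    have hb := (dd_clm_apply hT (v := fun _ => b) mdifferentiableAt_const).1
    have h3 := dd_clm_apply hG ha
    have h4 := dd_clm_apply h3.1 hb
    rw [h4.2, h3.2, dd_apply_const hT, dd_apply_const hT]
    simp only [add_apply]
  simp only [koszul, tcc_self hx, tcc_tcc_self hx hz, key]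
  -- Each derivative of the metric contributes two terms with second derivatives of the transition
  -- map. By their symmetry four of the six cancel and the other two coincide, giving the
  -- inhomogeneous term.
  have s1 := dd_tcc_symm hz
  rw [s1 b a, s1 c a, s1 c b]
  rw [hg.gz_symm z x (tcc n x z x b), hg.gz_symm z x (tcc n x z x a)]
  ring

/-- The remaining derivatives of the metric cancel by symmetry. This is metric compatibility of the
Levi-Civita connection in coordinates. -/
theorem koszul_add_koszul {g : MetricField n M} (hg : SmoothMetric g) {z q : M}
    (hq : q ∈ src n z) (a b c : Euc n) :
    koszul g z q a b c + koszul g z q a c b = dd n (gz g z) q (tcc n z q q a) b c := by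
  simp only [koszul]
  rw [hg.dd_gz_symm hq _ c b]; ring

end Metric

/-! ## The connection along a map -/

section Along

variable {m n : ℕ} {S M : Type*}
  [TopologicalSpace S] [ChartedSpace (EuclideanSpace ℝ (Fin m)) S]
  [TopologicalSpace M] [ChartedSpace (EuclideanSpace ℝ (Fin n)) M]

variable (m n) in
/-- The differential of a map of manifolds. -/
def dF (F : S → M) (p : S) : Euc m →L[ℝ] Euc n := mfderiv (𝓡 m) (𝓡 n) F p

theorem dd_comp {E' : Type*} [NormedAddCommGroup E'] [NormedSpace ℝ E'] {h : M → E'} {F : S → M}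
    {p : S} (hh : DfAt n h (F p)) (hF : MDifferentiableAt (𝓡 m) (𝓡 n) F p) :
    DfAt m (fun q => h (F q)) p ∧
    ∀ w, dd m (fun q => h (F q)) p w = dd n h (F p) (dF m n F p w) := by
  refine ⟨hh.comp p hF, fun w => ?_⟩
  have := mfderiv_comp (I := 𝓡 m) (I' := 𝓡 n) (I'' := 𝓘(ℝ, E')) p hh hF
  exact congrArg (fun L : Euc m →L[ℝ] E' => L w) this

theorem SmAt.comp_map {E' : Type*} [NormedAddCommGroup E'] [NormedSpace ℝ E'] {h : M → E'}
    {F : S → M} {p : S} (hh : SmAt n h (F p)) (hF : ContMDiffAt (𝓡 m) (𝓡 n) ∞ F p) :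
    SmAt m (fun q => h (F q)) p := ContMDiffAt.comp p hh hF

variable [IsManifold (𝓡 n) ∞ M]

/-- In the fixed chart at `z` this is an ordinary derivative applied to smooth components. It serves
for the Christoffel terms of the connection along a map. -/
theorem smAt_dd_comp_map {E' : Type*} [NormedAddCommGroup E'] [NormedSpace ℝ E'] {h : M → E'}
    {F : S → M} {p : S} {z : M} (hz : F p ∈ src n z) (hh : ∀ q ∈ src n z, SmAt n h q)
    (hF : ContMDiffAt (𝓡 m) (𝓡 n) ∞ F p) {a : S → Euc n} (ha : SmAt m a p) :
    SmAt m (fun q => dd n h (F q) (tcc n z (F q) (F q) (a q))) p := by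
  have h1 : SmAt n (fun y => fderiv ℝ (h ∘ (extChartAt (𝓡 n) z).symm) (extChartAt (𝓡 n) z y))
      (F p) := smAt_comp_chart hz ((contDiffAt_in_chart hz (hh _ hz)).fderiv_right (by simp))
  refine ((h1.comp_map hF).clm_apply ha).congr_of_eventuallyEq ?_
  filter_upwards [hF.continuousAt.eventually (source_mem_nhds hz)] with q hq
  exact dd_cvec hq (hh _ hq).dfAt _

/-- The components in the chart at `z` of a vector field along `F`. -/
def compz (F : S → M) (V : S → Euc n) (z : M) (q : S) : Euc n := tcc n (F q) z (F q) (V q)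

variable (m) in
/-- Smoothness at a point of a vector field along `F`. -/
def AlongAt (F : S → M) (V : S → Euc n) (p : S) : Prop := SmAt m (compz F V (F p)) p

theorem compz_self (F : S → M) (V : S → Euc n) (p : S) : compz F V (F p) p = V p :=
  tcc_self (mem_chart_source _ _) _

variable {F : S → M} {V U : S → Euc n} {p : S}

theorem compz_congr {x z : M} (hF : ContinuousAt F p) (hx : F p ∈ src n x) (hz : F p ∈ src n z) :
    compz F V z =ᶠ[𝓝 p] fun q => tcc n x z (F q) (compz F V x q) := by
  filter_upwards [hF.eventually (source_mem_nhds hx), hF.eventually (source_mem_nhds hz)]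
    with q h h'
  exact (tcc_tcc (mem_chart_source _ _) h h' _).symm

/-- The fibre component in the trivialization of the tangent bundle at `F p` is, by definition, the
component in the chart at `F p`. -/
theorem alongAt_of_contMDiffAt
    (hV : ContMDiffAt (𝓡 m) (𝓡 n).tangent ∞ (fun q => (⟨F q, V q⟩ : TangentBundle (𝓡 n) M)) p) :
    AlongAt m F V p := by
  have := (Bundle.contMDiffAt_totalSpace.1 hV).2
  exact this

theorem AlongAt.sub (hV : AlongAt m F V p) (hU : AlongAt m F U p) :
    AlongAt m F (fun q => V q - U q) p := by
  refine (ContMDiffAt.sub hV hU).congr_of_eventuallyEq (Eventually.of_forall fun q => ?_)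
  exact map_sub _ _ _

theorem AlongAt.smul {f : S → ℝ} (hf : SmAt m f p) (hU : AlongAt m F U p) :
    AlongAt m F (fun q => f q • U q) p := by
  refine (ContMDiffAt.smul hf hU).congr_of_eventuallyEq (Eventually.of_forall fun q => ?_)
  exact map_smul _ _ _

theorem AlongAt.congr (hV : AlongAt m F V p) (h : ∀ᶠ q in 𝓝 p, U q = V q) : AlongAt m F U p := by
  refine ContMDiffAt.congr_of_eventuallyEq hV ?_
  filter_upwards [h] with q hq
  simp only [compz, hq]

variable {g : MetricField n M}

theorem AlongAt.smAt_met (hg : SmoothMetric g) (hF : ContMDiffAt (𝓡 m) (𝓡 n) ∞ F p)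
    (hV : AlongAt m F V p) (hU : AlongAt m F U p) :
    SmAt m (fun q => met g (F q) (V q) (U q)) p := by
  have h0 : SmAt n (gz g (F p)) (F p) := hg.smooth (F p) (F p) (mem_chart_source _ _)
  have h1 := h0.comp_map hF
  refine ((h1.clm_apply hV).clm_apply hU).congr_of_eventuallyEq ?_
  filter_upwards [hF.continuousAt.eventually (source_mem_nhds (n := n) (mem_chart_source _ (F p)))] with q hq
  exact met_eq_gz g hq _ _

variable [IsManifold (𝓡 m) ∞ S]

/-- The scalar `⟨∇_w V, u⟩`. -/
def conn (g : MetricField n M) (F : S → M) (V : S → Euc n) (p : S) (w : Euc m) (u : Euc n) : ℝ :=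
  met g (F p) (covDeriv g F V p w) u

theorem conn_self (hg : SmoothMetric g) (w : Euc m) (u : Euc n) :
    conn g F V p w u = met g (F p) (dd m (compz F V (F p)) p w) u
      + koszul g (F p) (F p) (dF m n F p w) (V p) u := by
  rw [← met_christoffel hg]
  have : (covDeriv g F V p w : Euc n) = dd m (compz F V (F p)) p w
    + chr g (F p) (dF m n F p w) (V p) := rfl
  rw [conn, this, map_add, add_apply]

/-- The connection in an arbitrary chart. -/
theorem conn_chart (hg : SmoothMetric g) (hF : MDifferentiableAt (𝓡 m) (𝓡 n) F p)
    (hV : DfAt m (compz F V (F p)) p) {z : M} (hz : F p ∈ src n z) (w : Euc m) (u : Euc n) :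
    conn g F V p w u = gz g z (F p) (dd m (compz F V z) p w) (tcc n (F p) z (F p) u)
      + koszul g z (F p) (tcc n (F p) z (F p) (dF m n F p w)) (compz F V z p)
        (tcc n (F p) z (F p) u) := by
  have hx := mem_chart_source (EuclideanSpace ℝ (Fin n)) (F p)
  rw [conn_self hg, koszul_transition hg hz, met_eq_gz g hz]
  have hT := (smAt_tcc hx hz).dfAt
  have h1 := dd_comp hT hF
  have h2 := (dd_clm_apply h1.1 hV).2 w
  -- Differentiating the change of components produces a second derivative of the transition map,
  -- the same term that the transformation law of the Christoffel symbol puts on the other side.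
  rw [dd_congr (compz_congr (V := V) hF.continuousAt hx hz), h2, h1.2, compz_self]
  simp only [compz, map_add, add_apply]
  ring

/-- The connection is compatible with the metric. -/
theorem dd_met (hg : SmoothMetric g) (hF : ContMDiffAt (𝓡 m) (𝓡 n) ∞ F p)
    (hV : DfAt m (compz F V (F p)) p) (hU : DfAt m (compz F U (F p)) p) (w : Euc m) :
    dd m (fun q => met g (F q) (V q) (U q)) p w = conn g F V p w (U p) + conn g F U p w (V p) := by
  have hx := mem_chart_source (EuclideanSpace ℝ (Fin n)) (F p)
  have hF' : MDifferentiableAt (𝓡 m) (𝓡 n) F p := hF.mdifferentiableAt (by simp)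
  have e : (fun q => met g (F q) (V q) (U q)) =ᶠ[𝓝 p]
      fun q => gz g (F p) (F q) (compz F V (F p) q) (compz F U (F p) q) := by
    filter_upwards [hF.continuousAt.eventually (source_mem_nhds hx)] with q hq
    exact met_eq_gz g hq _ _
  have h0 := dd_comp (hg.smooth (F p) (F p) hx).dfAt hF'
  have h1 := dd_clm_apply h0.1 hV
  rw [dd_congr e, (dd_clm_apply h1.1 hU).2, h1.2, h0.2, conn_self hg, conn_self hg, compz_self,
    compz_self]
  have h3 := koszul_add_koszul hg hx (dF m n F p w) (V p) (U p)
  rw [tcc_self hx] at h3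
  rw [add_apply, ← h3, gz_self, gz_self, hg.symm (F p) (V p)]
  ring

theorem conn_add (hV : DfAt m (compz F V (F p)) p) (hU : DfAt m (compz F U (F p)) p)
    (hg : SmoothMetric g) (w : Euc m) (u : Euc n) :
    conn g F (fun q => V q + U q) p w u = conn g F V p w u + conn g F U p w u := by
  have e : compz F (fun q => V q + U q) (F p) = fun q => compz F V (F p) q + compz F U (F p) q := by
    funext q; exact map_add _ _ _
  have hx := mem_chart_source (EuclideanSpace ℝ (Fin n)) (F p)
  rw [conn_self hg, conn_self hg, conn_self hg, e, (dd_add hV hU).2]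
  simp only [koszul, map_add, add_apply]
  ring

theorem conn_smul {f : S → ℝ} (hf : DfAt m f p) (hU : DfAt m (compz F U (F p)) p)
    (hg : SmoothMetric g) (w : Euc m) (u : Euc n) :
    conn g F (fun q => f q • U q) p w u
      = dd m f p w * met g (F p) (U p) u + f p * conn g F U p w u := by
  have e : compz F (fun q => f q • U q) (F p) = fun q => f q • compz F U (F p) q := by
    funext q; exact map_smul _ _ _
  rw [conn_self hg, conn_self hg, e, (dd_smul hf hU).2, compz_self]
  simp only [koszul, map_add, map_smul, add_apply,
    smul_apply, smul_eq_mul]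
  ring

theorem conn_add_right (w : Euc m) (u u' : Euc n) :
    conn g F V p w (u + u') = conn g F V p w u + conn g F V p w u' := map_add _ _ _

theorem conn_smul_right (w : Euc m) (r : ℝ) (u : Euc n) :
    conn g F V p w (r • u) = r * conn g F V p w u := map_smul _ _ _

theorem conn_linear (hg : SmoothMetric g) (u : Euc n) :
    IsLinearMap ℝ (fun w : Euc m => conn g F V p w u) := by
  constructor
  · intro w w'
    simp only [conn_self hg, koszul, map_add, add_apply]; ring
  · intro r w
    simp only [conn_self hg, koszul, map_smul, smul_apply, smul_eq_mul]; ring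

theorem dd_chart_comp (hF : MDifferentiableAt (𝓡 m) (𝓡 n) F p) {z : M} (hz : F p ∈ src n z)
    (w : Euc m) : dd m (fun q => extChartAt (𝓡 n) z (F q)) p w = tcc n (F p) z (F p) (dF m n F p w) := by
  rw [(dd_comp (smAt_chart hz).dfAt hF).2, dd_chart hz]

/-- Near `p` the connection is written in the single chart at `F p`, with the Christoffel symbol
expanded into derivatives of the metric. Every factor is then smooth. -/
theorem AlongAt.smAt_conn (hg : SmoothMetric g) (hF : ∀ p, ContMDiffAt (𝓡 m) (𝓡 n) ∞ F p)
    (hV : AlongAt m F V p) (hU : AlongAt m F U p) {x : S} (hx : p ∈ src m x) (a : Euc m) :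
    SmAt m (fun q => conn g F V q (tcc m x q q a) (U q)) p := by
  set z := F p
  have hz := mem_chart_source (EuclideanSpace ℝ (Fin n)) z
  have hV' : SmAt m (compz F V z) p := hV
  have e : (fun q => conn g F V q (tcc m x q q a) (U q)) =ᶠ[𝓝 p] fun q =>
      gz g z (F q) (dd m (compz F V z) q (tcc m x q q a)) (compz F U z q)
      + (dd n (gz g z) (F q) (tcc n z (F q) (F q) (dd m (fun q => extChartAt (𝓡 n) z (F q)) q
            (tcc m x q q a))) (compz F V z q) (compz F U z q)
        + dd n (gz g z) (F q) (tcc n z (F q) (F q) (compz F V z q))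
          (dd m (fun q => extChartAt (𝓡 n) z (F q)) q (tcc m x q q a)) (compz F U z q)
        - dd n (gz g z) (F q) (tcc n z (F q) (F q) (compz F U z q))
          (dd m (fun q => extChartAt (𝓡 n) z (F q)) q (tcc m x q q a)) (compz F V z q)) / 2 := by
    filter_upwards [(hF p).continuousAt.eventually (source_mem_nhds hz),
      hV'.eventually_dfAt] with q hq h1
    have hF' : MDifferentiableAt (𝓡 m) (𝓡 n) F q := (hF q).mdifferentiableAt (by simp)
    have h2 : DfAt m (compz F V (F q)) q := by
      refine MDifferentiableAt.congr_of_eventuallyEq ?_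
        (compz_congr hF'.continuousAt hq (mem_chart_source _ _))
      exact (dd_clm_apply (dd_comp (smAt_tcc hq (mem_chart_source _ _)).dfAt hF').1 h1).1
    rw [conn_chart hg hF' h2 hq, dd_chart_comp hF' hq]
    rfl
  refine ContMDiffAt.congr_of_eventuallyEq ?_ e
  have hG := hg.smooth z z hz
  have s1 : SmAt m (fun q => gz g z (F q)) p := SmAt.comp_map hG (hF p)
  have s2 : SmAt m (fun q => dd m (compz F V z) q (tcc m x q q a)) p := smAt_dd_cvec hx hV' a
  have s3 : SmAt m (fun q => dd m (fun q => extChartAt (𝓡 n) z (F q)) q (tcc m x q q a)) p :=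
    smAt_dd_cvec hx (ContMDiffAt.comp p (smAt_chart hz) (hF p)) a
  have s4 := fun {c : S → Euc n} (hc : SmAt m c p) =>
    smAt_dd_comp_map hz (hg.smooth z) (hF p) hc
  have hU' : SmAt m (compz F U z) p := hU
  exact ((s1.clm_apply s2).clm_apply hU').add ((((((s4 s3).clm_apply hV').clm_apply
    hU').add (((s4 hV').clm_apply s3).clm_apply hU')).sub
      (((s4 hU').clm_apply s3).clm_apply hV')).div_const 2)

end Along

/-! ### Smoothness of bilinear forms and of coordinate vector fields -/

section MetricCriteria

variable {n : ℕ} {M : Type*} [TopologicalSpace M] [ChartedSpace (EuclideanSpace ℝ (Fin n)) M]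
  [IsManifold (𝓡 n) ∞ M]

theorem bilin_eq_sum (B : Euc n →L[ℝ] Euc n →L[ℝ] ℝ) :
    B = ∑ i, ∑ j, B (bas n i) (bas n j) •
      (EuclideanSpace.proj i : Euc n →L[ℝ] ℝ).smulRight (EuclideanSpace.proj j : Euc n →L[ℝ] ℝ) := by
  ext v w
  conv_lhs => rw [euc_eq_sum v, euc_eq_sum w]
  simp only [map_sum, map_smul, sum_apply, smul_apply, smul_eq_mul, Finset.mul_sum,
    ContinuousLinearMap.smulRight_apply]
  rw [Finset.sum_comm]
  refine Finset.sum_congr rfl fun i _ => Finset.sum_congr rfl fun j _ => ?_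
  simp; ring

theorem smAt_bilin {B : M → Euc n →L[ℝ] Euc n →L[ℝ] ℝ} {p : M}
    (hB : ∀ i j, SmAt n (fun q => B q (bas n i) (bas n j)) p) : SmAt n B p := by
  have : SmAt n (fun q => ∑ i, ∑ j, B q (bas n i) (bas n j) •
      (EuclideanSpace.proj i : Euc n →L[ℝ] ℝ).smulRight (EuclideanSpace.proj j : Euc n →L[ℝ] ℝ)) p :=
    contMDiffAt_finsetSum fun i _ => contMDiffAt_finsetSum fun j _ =>
      (hB i j).smul contMDiffAt_const
  exact this.congr_of_eventuallyEq (Eventually.of_forall fun q => bilin_eq_sum (B q))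

/-- In the trivialization at `z` this field has the constant component `a`. -/
theorem contMDiffAt_cvec {z q : M} (hq : q ∈ src n z) (a : Euc n) :
    ContMDiffAt (𝓡 n) ((𝓡 n).prod 𝓘(ℝ, Euc n)) ∞
      (fun y => Bundle.TotalSpace.mk' (Euc n) (E := fun x : M => TangentSpace (𝓡 n) x) y
        (tcc n z y y a)) q := by
  have hs : (⟨q, tcc n z q q a⟩ : TangentBundle (𝓡 n) M) ∈
      (trivializationAt (Euc n) (TangentSpace (𝓡 n)) z).source := by
    rw [TangentBundle.trivializationAt_source]; exact hq
  refine ((trivializationAt (Euc n) (TangentSpace (𝓡 n)) z).contMDiffAt_iff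
    (f := fun y => (⟨y, tcc n z y y a⟩ : TangentBundle (𝓡 n) M)) (x₀ := q) hs).2
    ⟨contMDiffAt_id, ?_⟩
  refine (contMDiffAt_const (c := a)).congr_of_eventuallyEq ?_
  filter_upwards [source_mem_nhds hq] with y hy
  exact tcc_tcc_self hy (mem_chart_source _ y) a

end MetricCriteria

/-! ### Lorentzian metrics are smooth and nondegenerate -/

section Lorentz

variable {N : Type*} [TopologicalSpace N] [ChartedSpace (EuclideanSpace ℝ (Fin 4)) N]
  [IsManifold (𝓡 4) ∞ N]

/-- Pairing with an orthonormal family isolates each coefficient up to a nonzero sign, so the family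
is a basis and the form is nondegenerate. Smoothness in a chart is the bundle section evaluated on
coordinate fields. -/
theorem IsLorentzian.smoothMetric {g : MetricField 4 N} (hg : IsLorentzian g) :
    SmoothMetric g where
  symm := hg.symm
  nondeg := by
    intro x v hv
    obtain ⟨e, he'⟩ : ∃ e : Fin 4 → Euc 4,
      ∀ i j, met g x (e i) (e j) = if i = j then signature i else 0 := hg.lorentz x
    have hs : ∀ i, signature i ≠ 0 := by
      intro i; unfold signature; split_ifs <;> norm_num
    have hli : LinearIndependent ℝ e := by
      rw [Fintype.linearIndependent_iff]
      intro c hc i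
      have := congrArg (fun v => met g x v (e i)) hc
      simp only [map_sum, map_smul, sum_apply, smul_apply, smul_eq_mul, he', map_zero,
        zero_apply, mul_ite, mul_zero, Finset.sum_ite_eq', Finset.mem_univ, if_true] at this
      exact (mul_eq_zero.1 this).resolve_right (hs i)
    have hsp : v ∈ Submodule.span ℝ (Set.range e) := by
      rw [hli.span_eq_top_of_card_eq_finrank' (by simp)]; trivial
    obtain ⟨c, rfl⟩ := (Submodule.mem_span_range_iff_exists_fun ℝ).1 hsp
    refine Finset.sum_eq_zero fun i _ => ?_
    have := hv (e i)
    simp only [map_sum, map_smul, sum_apply, smul_apply, smul_eq_mul, he', mul_ite, mul_zero,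
      Finset.sum_ite_eq', Finset.mem_univ, if_true] at this
    rw [(mul_eq_zero.1 this).resolve_right (hs i), zero_smul]
  smooth := by
    intro z q hq
    refine smAt_bilin fun i j => ?_
    have hv := contMDiffAt_cvec hq (bas 4 i)
    have hw := contMDiffAt_cvec hq (bas 4 j)
    have : ContMDiffAt (𝓡 4) ((𝓡 4).prod 𝓘(ℝ)) ∞
        (fun m : N ↦ Bundle.TotalSpace.mk' ℝ (E := Bundle.Trivial N ℝ) m
          (g m (tcc 4 z m m (bas 4 i)) (tcc 4 z m m (bas 4 j)))) q := by
      apply ContMDiffAt.clm_bundle_apply₂ (F₁ := Euc 4) (F₂ := Euc 4) (b := fun m : N => m)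
      · exact hg.smooth.contMDiffAt
      · exact hv
      · exact hw
    simp only [Bundle.contMDiffAt_totalSpace] at this
    exact this.2

end Lorentz

/-! ## Change of chart for traces and gradients -/

section Frames

variable {n : ℕ} {M : Type*} [TopologicalSpace M] [ChartedSpace (EuclideanSpace ℝ (Fin n)) M]
  [IsManifold (𝓡 n) ∞ M]

/-- The matrix of the metric in the chart at `x`. -/
def gramAt (σ : MetricField n M) (x y : M) : Matrix (Fin n) (Fin n) ℝ :=
  Matrix.of fun i j => gz σ x y (bas n i) (bas n j)

variable (n) in
/-- The coordinate vector fields of the chart at `x`. -/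
def cv (x y : M) (i : Fin n) : Euc n := tcc n x y y (bas n i)

variable (n) in
/-- The Jacobian matrix of a change of coordinates. -/
def jac (x z y : M) : Matrix (Fin n) (Fin n) ℝ := Matrix.of fun k i => tcc n x z y (bas n i) k

theorem tcc_bas (x z y : M) (i : Fin n) : tcc n x z y (bas n i) = ∑ k, jac n x z y k i • bas n k :=
  euc_eq_sum _

theorem tcc_apply (x z y : M) (v : Euc n) (k : Fin n) :
    tcc n x z y v k = ∑ i, jac n x z y k i * v i := by
  conv_lhs => rw [euc_eq_sum v]
  simp [jac, mul_comm]

theorem jac_mul_jac {x z y : M} (hx : y ∈ src n x) (hz : y ∈ src n z) :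
    jac n z x y * jac n x z y = 1 := by
  ext i j
  have := tcc_apply z x y (tcc n x z y (bas n j)) i
  rw [tcc_tcc_self hx hz] at this
  rw [Matrix.mul_apply, Matrix.one_apply]
  have h2 : bas n j i = if i = j then 1 else 0 := by simp [bas]
  rw [← h2, this]
  rfl

theorem gramAt_self (σ : MetricField n M) (x : M) : gramAt σ x x = gram σ x := by
  ext i j
  exact gz_self σ x _ _

theorem gramAt_eq (σ : MetricField n M) {x z y : M} (hx : y ∈ src n x) (hz : y ∈ src n z) :
    gramAt σ x y = (jac n x z y).transpose * gramAt σ z y * jac n x z y := by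
  ext i j
  simp only [gramAt, Matrix.of_apply, Matrix.mul_apply, Matrix.transpose_apply]
  rw [gz_gz σ hx hz, tcc_bas, tcc_bas]
  simp only [map_sum, map_smul, sum_apply, smul_apply, smul_eq_mul, Finset.mul_sum, Finset.sum_mul]
  refine Finset.sum_congr rfl fun k _ => Finset.sum_congr rfl fun l _ => ?_
  ring

theorem isUnit_det_gramAt {σ : MetricField n M} {x y : M} (hy : y ∈ src n x)
    (hn : ∀ v, (∀ w, met σ y v w = 0) → v = 0) : IsUnit (gramAt σ x y).det := by
  refine isUnit_det_of_nondegenerate (B := gz σ x y) (fun v hv => ?_) linearIndependent_bas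
  have h0 : tcc n x y y v = 0 := hn _ fun w => by
    have := hv (tcc n y x y w)
    rwa [gz_apply, tcc_tcc_self (mem_chart_source _ y) hy] at this
  rw [← tcc_tcc_self hy (mem_chart_source _ y) v, h0, map_zero]

theorem volDensity_eq (σ : MetricField n M) (x y : M) :
    volDensity σ x y = √(gramAt σ x y).det := rfl

variable {σ : MetricField n M}

/-- The gradient components in an arbitrary chart. -/
theorem tcc_sharp (hσ : SmoothMetric σ) {x y : M} (hy : y ∈ src n x) (b : Euc n →ₗ[ℝ] ℝ)
    (i : Fin n) : tcc n y x y (shp σ y b) i = ∑ j, (gramAt σ x y)⁻¹ i j * b (cv n x y j) := by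
  have hdet := isUnit_det_gramAt hy (hσ.nondeg y)
  set s : Euc n := tcc n y x y (shp σ y b)
  have h1 : ∀ j, ∑ i, gramAt σ x y j i * s i = b (cv n x y j) := by
    intro j
    rw [← met_sharp (hσ.symm y) (hσ.nondeg y) b (cv n x y j), hσ.symm]
    have : (shp σ y b : Euc n) = tcc n x y y s :=
      (tcc_tcc_self (mem_chart_source _ y) hy _).symm
    rw [this]
    conv_rhs => rw [euc_eq_sum s]
    simp only [map_sum, map_smul, gramAt, Matrix.of_apply, gz_apply, cv, smul_eq_mul]
    exact Finset.sum_congr rfl fun i _ => mul_comm _ _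
  simp only [← h1, Finset.mul_sum]
  rw [Finset.sum_comm]
  have : ∀ k, ∑ j, (gramAt σ x y)⁻¹ i j * (gramAt σ x y j k * s k)
      = ((gramAt σ x y)⁻¹ * gramAt σ x y) i k * s k := by
    intro k
    rw [Matrix.mul_apply, Finset.sum_mul]
    exact Finset.sum_congr rfl fun j _ => (mul_assoc _ _ _).symm
  simp only [this, Matrix.nonsing_inv_mul _ hdet, Matrix.one_apply]
  simp

theorem sharp_eq_sum (hσ : SmoothMetric σ) {x y : M} (hy : y ∈ src n x) (b : Euc n →ₗ[ℝ] ℝ) :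
    (shp σ y b : Euc n) = ∑ i, (∑ j, (gramAt σ x y)⁻¹ i j * b (cv n x y j)) • cv n x y i := by
  rw [← tcc_tcc_self (mem_chart_source _ y) hy (shp σ y b), euc_eq_sum (tcc n y x y _), map_sum]
  refine Finset.sum_congr rfl fun i _ => ?_
  rw [map_smul, tcc_sharp hσ hy]; rfl

theorem cv_self (x : M) (i : Fin n) : cv n x x i = bas n i := tcc_self (mem_chart_source _ x) _

/-- The metric trace of a bilinear form does not depend on the chart. -/
theorem trace_eq {x y : M} (hy : y ∈ src n x)
    (T : Euc n →ₗ[ℝ] Euc n →ₗ[ℝ] ℝ) :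
    ∑ i, ∑ j, (gram σ y)⁻¹ i j * T (bas n i) (bas n j)
      = ∑ i, ∑ j, (gramAt σ x y)⁻¹ i j * T (cv n x y i) (cv n x y j) := by
  have hself := mem_chart_source (EuclideanSpace ℝ (Fin n)) y
  set P := jac n x y y with hP
  set Q := jac n y x y with hQ
  have hQP : Q * P = 1 := jac_mul_jac hy hself
  have hPQ : P * Q = 1 := jac_mul_jac hself hy
  set τ : Matrix (Fin n) (Fin n) ℝ := Matrix.of fun i j => T (bas n i) (bas n j) with hτ
  have e2 : ∀ i j, T (cv n x y i) (cv n x y j) = (P.transpose * τ * P) i j := by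
    intro i j
    simp only [cv, tcc_bas, map_sum, map_smul, LinearMap.sum_apply, LinearMap.smul_apply,
      smul_eq_mul, Matrix.mul_apply, Matrix.transpose_apply, Finset.mul_sum, Finset.sum_mul, hτ,
      Matrix.of_apply]
    refine Finset.sum_congr rfl fun k _ => Finset.sum_congr rfl fun l _ => ?_
    ring
  have e3 : ∀ (A B : Matrix (Fin n) (Fin n) ℝ), ∑ i, ∑ j, A i j * B i j = (A * B.transpose).trace := by
    intro A B
    simp [Matrix.trace, Matrix.mul_apply]
  -- The inverse metric transforms with the inverse Jacobian `Q`, the bilinear form with `P`; the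
  -- factors cancel under the trace by cyclicity.
  have e4 : (gramAt σ x y)⁻¹ = Q * (gram σ y)⁻¹ * Q.transpose := by
    rw [gramAt_eq σ hy hself, gramAt_self, Matrix.mul_inv_rev, Matrix.mul_inv_rev,
      Matrix.inv_eq_left_inv hQP, ← Matrix.transpose_nonsing_inv, Matrix.inv_eq_left_inv hQP,
      Matrix.mul_assoc]
  have e5 : ∑ i, ∑ j, (gram σ y)⁻¹ i j * T (bas n i) (bas n j)
      = ∑ i, ∑ j, (gram σ y)⁻¹ i j * τ i j := rfl
  simp only [e5, e2, e3, e4]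
  have hQP' : Q.transpose * P.transpose = 1 := by
    rw [← Matrix.transpose_mul, hPQ, Matrix.transpose_one]
  rw [Matrix.transpose_mul, Matrix.transpose_mul, Matrix.transpose_transpose]
  calc ((gram σ y)⁻¹ * τ.transpose).trace
      = ((P * Q) * ((gram σ y)⁻¹ * τ.transpose)).trace := by rw [hPQ, Matrix.one_mul]
    _ = (Q * ((gram σ y)⁻¹ * τ.transpose) * P).trace := by
        rw [Matrix.mul_assoc, Matrix.trace_mul_comm]
    _ = (Q * (gram σ y)⁻¹ * (Q.transpose * P.transpose) * (τ.transpose * P)).trace := by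
        rw [hQP']; simp only [Matrix.mul_one, Matrix.mul_assoc]
    _ = _ := by simp only [Matrix.mul_assoc]

end Frames

/-! ### The inverse metric of a surface is smooth -/

section Surface

variable {S : Type*} [TopologicalSpace S] [ChartedSpace (EuclideanSpace ℝ (Fin 2)) S]
  [IsManifold (𝓡 2) ∞ S]

/-- Cramer's rule: adjugate over determinant. -/
theorem smAt_inv_two {A : S → Matrix (Fin 2) (Fin 2) ℝ} {p : S}
    (hA : ∀ i j, SmAt 2 (fun q => A q i j) p) (hd : (A p).det ≠ 0) (i j : Fin 2) :
    SmAt 2 (fun q => (A q)⁻¹ i j) p := by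
  have hdet : SmAt 2 (fun q => (A q).det) p := by
    simp only [Matrix.det_fin_two]
    exact ((hA 0 0).mul (hA 1 1)).sub ((hA 0 1).mul (hA 1 0))
  have hinv : SmAt 2 (fun q => ((A q).det)⁻¹) p := by
    have h1 : ContDiffAt ℝ ∞ (fun t : ℝ => t⁻¹) (A p).det := contDiffAt_inv ℝ hd
    exact (contMDiffAt_iff_contDiffAt.2 h1).comp p hdet
  have hadj : SmAt 2 (fun q => (A q).adjugate i j) p := by
    simp only [Matrix.adjugate_fin_two]
    fin_cases i <;> fin_cases j
    · exact hA 1 1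
    · exact (hA 0 1).neg
    · exact (hA 1 0).neg
    · exact hA 0 0
  refine (hinv.mul hadj).congr_of_eventuallyEq (Eventually.of_forall fun q => ?_)
  simp [Matrix.inv_def, Ring.inverse_eq_inv']

theorem smAt_gramAt {σ : MetricField 2 S} (hσ : SmoothMetric σ) {x y : S} (hy : y ∈ src 2 x)
    (i j : Fin 2) : SmAt 2 (fun q => gramAt σ x q i j) y :=
  ((hσ.smooth x y hy).clm_apply contMDiffAt_const).clm_apply contMDiffAt_const

theorem smAt_inv_gramAt {σ : MetricField 2 S} (hσ : SmoothMetric σ) {x y : S} (hy : y ∈ src 2 x)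
    (i j : Fin 2) : SmAt 2 (fun q => (gramAt σ x q)⁻¹ i j) y :=
  smAt_inv_two (smAt_gramAt hσ hy) (isUnit_det_gramAt hy (hσ.nondeg y)).ne_zero i j

end Surface

/-! ## Mean curvature -/

section Immersed

variable {m n : ℕ} {S M : Type*}
  [TopologicalSpace S] [ChartedSpace (EuclideanSpace ℝ (Fin m)) S] [IsManifold (𝓡 m) ∞ S]
  [TopologicalSpace M] [ChartedSpace (EuclideanSpace ℝ (Fin n)) M] [IsManifold (𝓡 n) ∞ M]
  {g : MetricField n M} {F : S → M}

theorem met_induced (g : MetricField n M) (F : S → M) (p : S) (w w' : Euc m) :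
    met (induced g F) p w w' = met g (F p) (dF m n F p w) (dF m n F p w') := rfl

theorem alongAt_dF {x p : S} (hF : ∀ q, ContMDiffAt (𝓡 m) (𝓡 n) ∞ F q) (hx : p ∈ src m x)
    (a : Euc m) : AlongAt m F (fun q => dF m n F q (tcc m x q q a)) p := by
  have hz := mem_chart_source (EuclideanSpace ℝ (Fin n)) (F p)
  have h1 : SmAt m (fun q => extChartAt (𝓡 n) (F p) (F q)) p := (smAt_chart hz).comp_map (hF p)
  refine (smAt_dd_cvec hx h1 a).congr_of_eventuallyEq ?_
  filter_upwards [(hF p).continuousAt.eventually (source_mem_nhds (n := n) hz)] with q hq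
  exact (dd_chart_comp ((hF q).mdifferentiableAt (by simp)) hq _).symm

theorem smoothMetric_induced (hg : SmoothMetric g) (hF : ∀ q, ContMDiffAt (𝓡 m) (𝓡 n) ∞ F q)
    (hpos : ∀ p (w : Euc m), w ≠ 0 → 0 < met (induced g F) p w w) :
    SmoothMetric (induced (m := m) g F) where
  symm p v w := hg.symm _ _ _
  nondeg p v hv := by
    by_contra h
    exact (hpos p v h).ne' (hv v)
  smooth z q hq := by
    refine smAt_bilin fun i j => ?_
    have h := AlongAt.smAt_met hg (hF q) (alongAt_dF hF hq (bas m i)) (alongAt_dF hF hq (bas m j))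
    exact h

/-- The normal component, with types reduced to Euclidean space. -/
def nrm (g : MetricField n M) (F : S → M) (p : S) (Z : Euc n) : Euc n :=
  normalPart (m := m) g F p Z

theorem nrm_eq (Z : Euc n) (p : S) : nrm (m := m) g F p Z = Z - dF m n F p
    (shp (induced g F) p fun w => met g (F p) Z (dF m n F p w)) := rfl

/-- The linear form `⟨Z, dF ·⟩`. -/
def tform (g : MetricField n M) (F : S → M) (p : S) (Z : Euc n) : Euc m →ₗ[ℝ] ℝ :=
  (met g (F p) Z).toLinearMap ∘ₗ (dF m n F p).toLinearMap

theorem tform_apply (p : S) (Z : Euc n) (w : Euc m) :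
    tform g F p Z w = met g (F p) Z (dF m n F p w) := rfl

theorem met_nrm_tangent (hσ : SmoothMetric (induced (m := m) g F)) (p : S) (Z : Euc n)
    (w : Euc m) : met g (F p) (nrm (m := m) g F p Z) (dF m n F p w) = 0 := by
  have h := met_sharp (hσ.symm p) (hσ.nondeg p) (tform g F p Z) w
  rw [met_induced] at h
  rw [nrm_eq, map_sub, sub_apply]
  exact sub_eq_zero.2 h.symm

theorem met_nrm_of_normal (hg : SmoothMetric g) (p : S) (Z u : Euc n)
    (hu : ∀ w : Euc m, met g (F p) u (dF m n F p w) = 0) :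
    met g (F p) (nrm (m := m) g F p Z) u = met g (F p) Z u := by
  rw [nrm_eq, map_sub, sub_apply, hg.symm _ (dF m n F p _), hu, sub_zero]

theorem nrm_of_normal (p : S) (u : Euc n)
    (hu : ∀ w : Euc m, met g (F p) u (dF m n F p w) = 0) : nrm (m := m) g F p u = u := by
  rw [nrm_eq, sharp_eq]
  simp [hu]

/-- The mean curvature vector, with types reduced to Euclidean space. -/
def mcv (m : ℕ) [ChartedSpace (EuclideanSpace ℝ (Fin m)) S] [IsManifold (𝓡 m) ∞ S]
    (g : MetricField n M) (F : S → M) (p : S) : Euc n := meanCurvature (m := m) g F p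

/-- The coordinate fields of an immersion. -/
def cf (m : ℕ) [ChartedSpace (EuclideanSpace ℝ (Fin m)) S] [IsManifold (𝓡 m) ∞ S]
    (n : ℕ) [ChartedSpace (EuclideanSpace ℝ (Fin n)) M]
    (F : S → M) (p : S) (i : Fin m) (q : S) : Euc n := dF m n F q (cv m p q i)

/-- The covariant derivative, with types reduced to Euclidean space. -/
def cvd {m : ℕ} [ChartedSpace (EuclideanSpace ℝ (Fin m)) S] [IsManifold (𝓡 m) ∞ S]
    (g : MetricField n M) (F : S → M) (V : S → Euc n) (p : S) (w : Euc m) : Euc n :=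
  covDeriv g F V p w

/-- The trace of the second derivative before projecting to the normal space. -/
def trc (m : ℕ) [ChartedSpace (EuclideanSpace ℝ (Fin m)) S] [IsManifold (𝓡 m) ∞ S]
    (g : MetricField n M) (F : S → M) (p : S) : Euc n :=
  ∑ i : Fin m, ∑ j : Fin m, (gram (induced (m := m) g F) p)⁻¹ i j •
    cvd g F (cf m n F p j) p (bas m i)

theorem mcv_eq (p : S) : mcv m g F p = nrm (m := m) g F p (trc m g F p) := rfl

theorem met_trc (p : S) (u : Euc n) : met g (F p) (trc m g F p) u
    = ∑ i, ∑ j, (gram (induced (m := m) g F) p)⁻¹ i j * conn g F (cf m n F p j) p (bas m i) u := by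
  simp only [trc, map_sum, map_smul, sum_apply, smul_apply, smul_eq_mul]
  rfl

theorem met_mcv_of_normal (hg : SmoothMetric g) (p : S) (u : Euc n)
    (hu : ∀ w : Euc m, met g (F p) u (dF m n F p w) = 0) :
    met g (F p) (mcv m g F p) u
      = ∑ i, ∑ j, (gram (induced (m := m) g F) p)⁻¹ i j
        * conn g F (cf m n F p j) p (bas m i) u := by
  rw [mcv_eq, met_nrm_of_normal hg p _ u hu, met_trc]

theorem met_mcv_tangent (hσ : SmoothMetric (induced (m := m) g F)) (p : S) (w : Euc m) :
    met g (F p) (mcv m g F p) (dF m n F p w) = 0 := met_nrm_tangent hσ p _ w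

/-- The mean curvature in the direction of a normal field is minus the trace of its tangential
derivative. -/
theorem met_mcv (hg : SmoothMetric g) (hF : ∀ q, ContMDiffAt (𝓡 m) (𝓡 n) ∞ F q) {p : S}
    {ν : S → Euc n} (hν : DfAt m (compz F ν (F p)) p)
    (hn : ∀ᶠ q in 𝓝 p, ∀ w : Euc m, met g (F q) (ν q) (dF m n F q w) = 0) :
    met g (F p) (mcv m g F p) (ν p)
      = -∑ i, ∑ j, (gram (induced (m := m) g F) p)⁻¹ i j
        * conn g F ν p (bas m i) (dF m n F p (bas m j)) := by
  rw [met_mcv_of_normal hg p (ν p) hn.self_of_nhds, ← Finset.sum_neg_distrib]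
  refine Finset.sum_congr rfl fun i _ => ?_
  rw [← Finset.sum_neg_distrib]
  refine Finset.sum_congr rfl fun j _ => ?_
  have hc : AlongAt m F (cf m n F p j) p := alongAt_dF hF (mem_chart_source _ p) _
  have h := dd_met hg (hF p) hν (SmAt.dfAt hc) (bas m i)
  -- `ν` stays normal near `p`, so differentiating ⟨ν, ∂ⱼF⟩ = 0 moves the derivative from the
  -- coordinate field onto `ν`.
  have e : (fun q => met g (F q) (ν q) (cf m n F p j q)) =ᶠ[𝓝 p] fun _ => 0 := by
    filter_upwards [hn] with q hq
    exact hq _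
  rw [dd_congr e, dd_const] at h
  have e2 : cf m n F p j p = dF m n F p (bas m j) := by rw [cf, cv_self]
  rw [e2] at h
  have h' : 0 = conn g F ν p (bas m i) (dF m n F p (bas m j))
    + conn g F (cf m n F p j) p (bas m i) (ν p) := h
  rw [eq_neg_of_add_eq_zero_right h'.symm]; ring

/-- The bilinear form `⟨∇_w ν, dF w'⟩`. -/
def shape (hg : SmoothMetric g) (F : S → M) (ν : S → Euc n) (p : S) :
    Euc m →ₗ[ℝ] Euc m →ₗ[ℝ] ℝ :=
  LinearMap.mk₂ ℝ (fun w w' => conn g F ν p w (dF m n F p w'))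
    (fun w w' u => (conn_linear hg _).map_add w w') (fun r w u => (conn_linear hg _).map_smul r w)
    (fun w u u' => by rw [map_add, conn_add_right])
    (fun r w u => by rw [map_smul, conn_smul_right]; rfl)

theorem met_mcv_chart (hg : SmoothMetric g) (hF : ∀ q, ContMDiffAt (𝓡 m) (𝓡 n) ∞ F q) {x p : S}
    (hx : p ∈ src m x) {ν : S → Euc n} (hν : DfAt m (compz F ν (F p)) p)
    (hn : ∀ᶠ q in 𝓝 p, ∀ w : Euc m, met g (F q) (ν q) (dF m n F q w) = 0) :
    met g (F p) (mcv m g F p) (ν p)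
      = -∑ i, ∑ j, (gramAt (induced (m := m) g F) x p)⁻¹ i j
        * conn g F ν p (cv m x p i) (dF m n F p (cv m x p j)) := by
  rw [met_mcv hg hF hν hn]
  exact congrArg _ (trace_eq hx (shape hg F ν p))

theorem AlongAt.eventually_dfAt {p : S} {ν : S → Euc n} (hν : AlongAt m F ν p)
    (hF : ∀ q, ContMDiffAt (𝓡 m) (𝓡 n) ∞ F q) : ∀ᶠ q in 𝓝 p, DfAt m (compz F ν (F q)) q := by
  have hz := mem_chart_source (EuclideanSpace ℝ (Fin n)) (F p)
  have hν' : SmAt m (compz F ν (F p)) p := hν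
  filter_upwards [(hF p).continuousAt.eventually (source_mem_nhds hz), hν'.eventually_dfAt]
    with q hq h1
  have hF' : MDifferentiableAt (𝓡 m) (𝓡 n) F q := (hF q).mdifferentiableAt (by simp)
  refine MDifferentiableAt.congr_of_eventuallyEq ?_
    (compz_congr hF'.continuousAt hq (mem_chart_source _ _))
  exact (dd_clm_apply (dd_comp (smAt_tcc hq (mem_chart_source _ _)).dfAt hF').1 h1).1

/-- The tangential part is expanded in the coordinate fields of one fixed chart, with coefficients
built from the inverse Gram matrix. In general dimension the smoothness of that inverse is taken as
a hypothesis. -/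
theorem alongAt_nrm (hg : SmoothMetric g) (hF : ∀ q, ContMDiffAt (𝓡 m) (𝓡 n) ∞ F q)
    (hσ : SmoothMetric (induced (m := m) g F)) {p : S}
    (hinv : ∀ i j, SmAt m (fun q => (gramAt (induced (m := m) g F) p q)⁻¹ i j) p)
    {C : S → Euc n} (hC : AlongAt m F C p) :
    AlongAt m F (fun q => nrm (m := m) g F q (C q)) p := by
  have hp := mem_chart_source (EuclideanSpace ℝ (Fin m)) p
  have hcv : ∀ i, AlongAt m F (fun q => dF m n F q (cv m p q i)) p := fun i => alongAt_dF hF hp _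
  have h1 : ∀ i, SmAt m (fun q => ∑ j, (gramAt (induced (m := m) g F) p q)⁻¹ i j *
      met g (F q) (C q) (dF m n F q (cv m p q j))) p := fun i =>
    contMDiffAt_finsetSum fun j _ => (hinv i j).mul (AlongAt.smAt_met hg (hF p) hC (hcv j))
  have h2 : ∀ i, AlongAt m F (fun q => (∑ j, (gramAt (induced (m := m) g F) p q)⁻¹ i j *
      met g (F q) (C q) (dF m n F q (cv m p q j))) • dF m n F q (cv m p q i)) p :=
    fun i => AlongAt.smul (h1 i) (hcv i)
  have h3 : AlongAt m F (fun q => ∑ i, (∑ j, (gramAt (induced (m := m) g F) p q)⁻¹ i j *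
      met g (F q) (C q) (dF m n F q (cv m p q j))) • dF m n F q (cv m p q i)) p := by
    refine ContMDiffAt.congr_of_eventuallyEq (contMDiffAt_finsetSum fun i (_ : i ∈ Finset.univ) =>
      h2 i) (Eventually.of_forall fun q => ?_)
    simp only [compz, map_sum]
  refine (hC.sub h3).congr ?_
  filter_upwards [source_mem_nhds hp] with q hq
  rw [nrm_eq]
  congr 1
  have := sharp_eq_sum hσ hq (tform g F q (C q))
  have e : shp (induced (m := m) g F) q (fun w => met g (F q) (C q) (dF m n F q w))
    = shp (induced (m := m) g F) q (tform g F q (C q)) := rfl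
  rw [e, this, map_sum]
  simp only [map_smul, tform_apply]

end Immersed

/-! ### Smoothness of the mean curvature vector in codimension two -/

section CodimTwo

variable {S M : Type*}
  [TopologicalSpace S] [ChartedSpace (EuclideanSpace ℝ (Fin 2)) S] [IsManifold (𝓡 2) ∞ S]
  [TopologicalSpace M] [ChartedSpace (EuclideanSpace ℝ (Fin 4)) M] [IsManifold (𝓡 4) ∞ M]
  {g : MetricField 4 M} {F : S → M}

/-- A vector orthogonal to a spacelike plane and to two orthogonal normals vanishes. -/
theorem eq_zero_of_orthogonal {B : Euc 4 →L[ℝ] Euc 4 →L[ℝ] ℝ} (hs : ∀ v w, B v w = B w v)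
    (hn : ∀ v, (∀ w, B v w = 0) → v = 0) {L : Euc 2 →L[ℝ] Euc 4}
    (hpos : ∀ w, w ≠ 0 → 0 < B (L w) (L w)) {a b : Euc 4} (ha : ∀ w, B a (L w) = 0)
    (hb : ∀ w, B b (L w) = 0) (hab : B a b = 0) (haa : B a a ≠ 0) (hbb : B b b ≠ 0)
    {v : Euc 4} (hv : ∀ w, B v (L w) = 0) (hva : B v a = 0) (hvb : B v b = 0) : v = 0 := by
  let T : (Euc 2 × ℝ × ℝ) →ₗ[ℝ] Euc 4 :=
    { toFun := fun x => L x.1 + x.2.1 • a + x.2.2 • b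
      map_add' := by
        intro x y
        simp only [Prod.fst_add, Prod.snd_add, map_add, add_smul]; abel
      map_smul' := by
        intro r x
        simp only [Prod.smul_fst, Prod.smul_snd, map_smul, smul_eq_mul, RingHom.id_apply, smul_add,
          smul_smul] }
  have hT : ∀ x, T x = L x.1 + x.2.1 • a + x.2.2 • b := fun _ => rfl
  -- Pairing with `a`, `b` and `L w` isolates the three parts of a kernel element. Both sides have
  -- dimension four, so `T` is also onto and `v` is orthogonal to everything.
  have hinj : Function.Injective T := by
    rw [injective_iff_map_eq_zero]
    rintro ⟨w, r, s⟩ h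
    rw [hT] at h
    have h1 := congrArg (fun u => B a u) h
    have h2 := congrArg (fun u => B b u) h
    have h3 := congrArg (fun u => B (L w) u) h
    simp only [map_add, map_smul, smul_eq_mul, map_zero, ha, hb, hab, hs b a, hs (L w) a,
      hs (L w) b, mul_zero, add_zero, zero_add] at h1 h2 h3
    have hw : w = 0 := by
      by_contra hw
      exact (hpos w hw).ne' h3
    rw [hw, (mul_eq_zero.1 h1).resolve_right haa, (mul_eq_zero.1 h2).resolve_right hbb]
    rfl
  have hsurj : Function.Surjective T :=
    (LinearMap.injective_iff_surjective_of_finrank_eq_finrank (by simp)).1 hinj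
  refine hn v fun u => ?_
  obtain ⟨x, rfl⟩ := hsurj u
  rw [hT, map_add, map_add, map_smul, map_smul, hv, hva, hvb]; simp

/-- The mean curvature vector of a surface in a four-manifold is smooth if it is orthogonal to a
smooth normal field and nowhere null. -/
theorem alongAt_mcv (hg : SmoothMetric g) (hF : ∀ q, ContMDiffAt (𝓡 2) (𝓡 4) ∞ F q)
    (hpos : ∀ p (w : Euc 2), w ≠ 0 → 0 < met (induced g F) p w w)
    {e : S → Euc 4} (he : ∀ p, AlongAt 2 F e p) {ε : ℝ} (hε : ε ≠ 0)
    (hee : ∀ p, met g (F p) (e p) (e p) = ε)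
    (hen : ∀ p (w : Euc 2), met g (F p) (e p) (dF 2 4 F p w) = 0)
    (heH : ∀ p, met g (F p) (e p) (mcv 2 g F p) = 0)
    (hH : ∀ p, met g (F p) (mcv 2 g F p) (mcv 2 g F p) ≠ 0) (p : S) :
    AlongAt 2 F (mcv 2 g F) p := by
  have hσ := smoothMetric_induced hg hF hpos
  have hp := mem_chart_source (EuclideanSpace ℝ (Fin 2)) p
  have hz := mem_chart_source (EuclideanSpace ℝ (Fin 4)) (F p)
  set c := mcv 2 g F p with hc
  -- The value of H at `p` is extended with constant components in the chart at `F p`, then made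
  -- normal to the surface and orthogonal to `e`. The resulting smooth field `ν` agrees with H at
  -- `p`.
  let C : S → Euc 4 := fun q => tcc 4 (F p) (F q) (F q) c
  have hC : AlongAt 2 F C p := by
    refine (contMDiffAt_const (c := c)).congr_of_eventuallyEq ?_
    filter_upwards [(hF p).continuousAt.eventually (source_mem_nhds (n := 4) hz)] with q hq
    exact tcc_tcc_self hq (mem_chart_source _ _) c
  let ν : S → Euc 4 := fun q =>
    nrm (m := 2) g F q (C q) - (met g (F q) (C q) (e q) * ε⁻¹) • e q
  have hν : AlongAt 2 F ν p :=
    (alongAt_nrm hg hF hσ (fun i j => smAt_inv_gramAt hσ hp i j) hC).sub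
      (AlongAt.smul ((AlongAt.smAt_met hg (hF p) hC (he p)).mul contMDiffAt_const) (he p))
  have hνn : ∀ q (w : Euc 2), met g (F q) (ν q) (dF 2 4 F q w) = 0 := by
    intro q w
    simp only [ν, map_sub, map_smul, sub_apply, smul_apply, hen, met_nrm_tangent hσ, smul_zero,
      sub_zero]
  have hνe : ∀ q, met g (F q) (ν q) (e q) = 0 := by
    intro q
    simp only [ν, map_sub, map_smul, sub_apply, smul_apply, hee, smul_eq_mul,
      met_nrm_of_normal hg q (C q) (e q) (hen q)]
    field_simp; ring
  have hCp : C p = c := tcc_self hz c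
  have hνp : ν p = c := by
    simp only [ν, hCp]
    rw [nrm_of_normal p c (met_mcv_tangent hσ p), hg.symm, heH]; simp
  have hνν : SmAt 2 (fun q => met g (F q) (ν q) (ν q)) p := AlongAt.smAt_met hg (hF p) hν hν
  have hνν0 : met g (F p) (ν p) (ν p) ≠ 0 := by rw [hνp]; exact hH p
  -- Smoothness of H is not presupposed: ⟨H,ν⟩ is minus the trace of ⟨∇ν, dF⟩, which differentiates
  -- only the known field `ν`.
  have hHν : SmAt 2 (fun q => met g (F q) (mcv 2 g F q) (ν q)) p := by
    have h1 : SmAt 2 (fun q => -∑ i, ∑ j, (gramAt (induced (m := 2) g F) p q)⁻¹ i j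
        * conn g F ν q (cv 2 p q i) (dF 2 4 F q (cv 2 p q j))) p :=
      (contMDiffAt_finsetSum fun i _ => contMDiffAt_finsetSum fun j _ =>
        (smAt_inv_gramAt hσ hp i j).mul
          (AlongAt.smAt_conn hg hF hν (alongAt_dF hF hp _) hp _)).neg
    refine h1.congr_of_eventuallyEq ?_
    filter_upwards [hν.eventually_dfAt hF, source_mem_nhds hp] with q h2 h3
    exact met_mcv_chart hg hF h3 h2 (Eventually.of_forall hνn)
  have hinv : SmAt 2 (fun q => (met g (F q) (ν q) (ν q))⁻¹) p := by
    have h1 : ContDiffAt ℝ ∞ (fun t : ℝ => t⁻¹) (met g (F p) (ν p) (ν p)) := contDiffAt_inv ℝ hνν0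
    exact (contMDiffAt_iff_contDiffAt.2 h1).comp p hνν
  refine (AlongAt.smul (hHν.mul hinv) hν).congr ?_
  -- The normals orthogonal to `e` form a line. Where `ν` is not null it spans that line, so H =
  -- (⟨H,ν⟩/⟨ν,ν⟩) ν, a product of smooth factors.
  filter_upwards [hνν.continuousAt.eventually_ne hνν0] with q hq
  rw [← sub_eq_zero]
  refine eq_zero_of_orthogonal (hg.symm _) (hg.nondeg _) (L := dF 2 4 F q) (hpos q) (hen q)
    (hνn q) (by rw [hg.symm]; exact hνe q) (by rw [hee]; exact hε) hq ?_ ?_ ?_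
  · intro w
    simp [met_mcv_tangent hσ, hνn]
  · simp [hνe, hg.symm _ (mcv 2 g F q) (e q), heH]
  · simp only [map_sub, map_smul, sub_apply, smul_apply, smul_eq_mul]
    rw [Pi.mul_apply, mul_assoc, inv_mul_cancel₀ hq, mul_one, sub_self]

end CodimTwo

/-! ## Minkowski space -/

theorem tcc_model {n : ℕ} (x y z : Euc n) (v : Euc n) : tcc n x y z v = v := by
  have : tcc n x y z = ContinuousLinearMap.id ℝ (Euc n) :=
    tangentBundleCore_coordChange_model_space (I := 𝓡 n) x y z
  rw [this]; rfl

theorem eta_apply (v w : Euc 4) : eta v w = -(v 0 * w 0) + v 1 * w 1 + v 2 * w 2 + v 3 * w 3 := by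
  simp [eta, Fin.sum_univ_four, signature]

theorem eta_symm (v w : Euc 4) : eta v w = eta w v := by
  simp only [eta_apply]; ring

theorem eta_nondeg (v : Euc 4) (h : ∀ w, eta v w = 0) : v = 0 := by
  ext i
  have := h (bas 4 i)
  fin_cases i <;> simpa [eta_apply, bas] using this

theorem met_minkowski (x : Euc 4) : met minkowski x = eta := rfl

theorem gz_minkowski (z q : Euc 4) : gz minkowski z q = eta := by
  ext v w
  rw [gz_apply, tcc_model, tcc_model, met_minkowski]

theorem smoothMetric_minkowski : SmoothMetric minkowski where
  symm _ := eta_symm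
  nondeg _ := eta_nondeg
  smooth z q _ := by
    have : gz minkowski z = fun _ => eta := funext fun q => gz_minkowski z q
    rw [this]
    exact contMDiffAt_const

section MinkowskiSurface

variable {S : Type*} [TopologicalSpace S] [ChartedSpace (EuclideanSpace ℝ (Fin 2)) S]
  {X : S → Euc 4} {V : S → Euc 4}

theorem compz_minkowski (z : Euc 4) : compz X V z = V := funext fun _ => tcc_model _ _ _ _

theorem alongAt_minkowski {p : S} : AlongAt 2 X V p ↔ SmAt 2 V p := by
  rw [AlongAt, compz_minkowski]

theorem koszul_minkowski (z q a b c : Euc 4) : koszul minkowski z q a b c = 0 := by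
  have : gz minkowski z = fun _ => eta := funext fun q => gz_minkowski z q
  have h : dd 4 (gz minkowski z) q = 0 := by rw [this]; exact dd_const _ _
  simp [koszul, h]

theorem dF_minkowski (p : S) : dF 2 4 X p = dd 2 X p := rfl

variable [IsManifold (𝓡 2) ∞ S]

theorem conn_minkowski (p : S) (w : Euc 2) (u : Euc 4) :
    conn minkowski X V p w u = eta (dd 2 V p w) u := by
  rw [conn_self smoothMetric_minkowski, koszul_minkowski, compz_minkowski, add_zero]
  rfl

theorem dd_eta {V U : S → Euc 4} {p : S} (hV : DfAt 2 V p) (hU : DfAt 2 U p) :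
    DfAt 2 (fun q => eta (V q) (U q)) p ∧
    ∀ w, dd 2 (fun q => eta (V q) (U q)) p w = eta (dd 2 V p w) (U p) + eta (V p) (dd 2 U p w) := by
  have h1 := dd_clm_comp eta hV
  have h2 := dd_clm_apply h1.1 hU
  exact ⟨h2.1, fun w => by rw [h2.2, h1.2]⟩

end MinkowskiSurface

theorem SmAt.comp_real {n : ℕ} {M E' : Type*} [TopologicalSpace M]
    [ChartedSpace (EuclideanSpace ℝ (Fin n)) M] [NormedAddCommGroup E'] [NormedSpace ℝ E']
    {φ : ℝ → E'} (hφ : ContDiff ℝ ∞ φ) {f : M → ℝ} {p : M} (hf : SmAt n f p) :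
    SmAt n (fun q => φ (f q)) p :=
  (contMDiffAt_iff_contDiffAt.2 hφ.contDiffAt).comp p hf

theorem SmAt.comp_real_at {n : ℕ} {M : Type*} [TopologicalSpace M]
    [ChartedSpace (EuclideanSpace ℝ (Fin n)) M]
    {φ : ℝ → ℝ} {f : M → ℝ} {p : M} (hφ : ContDiffAt ℝ ∞ φ (f p)) (hf : SmAt n f p) :
    SmAt n (fun q => φ (f q)) p :=
  (contMDiffAt_iff_contDiffAt.2 hφ).comp p hf

/-! ## Hyperbolic rotations of a normal frame -/

section Rotation

variable {S M : Type*}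
  [TopologicalSpace S] [ChartedSpace (EuclideanSpace ℝ (Fin 2)) S] [IsManifold (𝓡 2) ∞ S]
  [TopologicalSpace M] [ChartedSpace (EuclideanSpace ℝ (Fin 4)) M] [IsManifold (𝓡 4) ∞ M]
  {g : MetricField 4 M} {F : S → M}

/-- Constancy of the inner products gives ⟨∇a,a⟩ = ⟨∇b,b⟩ = 0 and ⟨∇b,a⟩ = −⟨∇a,b⟩; what survives is
multiplied by cosh² − sinh² = 1. The formula is applied to (e_J, e_H) in the spacetime and to
(e_{H₀}, e_{J₀}) in Minkowski space. -/
theorem conn_rotation (hg : SmoothMetric g) (hF : ∀ q, ContMDiffAt (𝓡 2) (𝓡 4) ∞ F q)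
    {a b : S → Euc 4} {t : S → ℝ} {p : S} (ha : AlongAt 2 F a p) (hb : AlongAt 2 F b p)
    (ht : SmAt 2 t p) (haa : ∀ q, met g (F q) (a q) (a q) = 1)
    (hbb : ∀ q, met g (F q) (b q) (b q) = -1) (hab : ∀ q, met g (F q) (a q) (b q) = 0)
    (w : Euc 2) :
    conn g F (fun q => Real.cosh (t q) • a q - Real.sinh (t q) • b q) p w
        (-(Real.sinh (t p) • a p) + Real.cosh (t p) • b p)
      = dd 2 t p w + conn g F a p w (b p) := by
  have hcosh := dd_real_comp (SmAt.dfAt ht) (Real.hasDerivAt_cosh (t p))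
  have hsinh := dd_real_comp (SmAt.dfAt ht) (φ := fun x => -Real.sinh x)
    (Real.hasDerivAt_sinh (t p)).neg
  have hsa : AlongAt 2 F (fun q => Real.cosh (t q) • a q) p :=
    AlongAt.smul (SmAt.comp_real Real.contDiff_cosh ht) ha
  have hsb : AlongAt 2 F (fun q => (-Real.sinh (t q)) • b q) p :=
    AlongAt.smul (SmAt.comp_real Real.contDiff_sinh ht).neg hb
  have e : (fun q => Real.cosh (t q) • a q - Real.sinh (t q) • b q)
      = fun q => Real.cosh (t q) • a q + (-Real.sinh (t q)) • b q := by
    funext q; rw [neg_smul, sub_eq_add_neg]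
  have k1 : ∀ {f : S → Euc 4} {c : ℝ}, AlongAt 2 F f p → (∀ q, met g (F q) (f q) (f q) = c) →
      conn g F f p w (f p) = 0 := by
    intro f c hf hc
    have h := dd_met hg (hF p) (SmAt.dfAt hf) (SmAt.dfAt hf) w
    rw [funext hc, dd_const] at h
    have : (0 : ℝ) = conn g F f p w (f p) + conn g F f p w (f p) := h
    linarith
  have k2 : conn g F b p w (a p) = -conn g F a p w (b p) := by
    have h := dd_met hg (hF p) (SmAt.dfAt ha) (SmAt.dfAt hb) w
    rw [funext hab, dd_const] at h
    have : (0 : ℝ) = conn g F a p w (b p) + conn g F b p w (a p) := h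
    linarith
  have ea : -(Real.sinh (t p) • a p) + Real.cosh (t p) • b p
      = (-Real.sinh (t p)) • a p + Real.cosh (t p) • b p := by rw [neg_smul]
  have hba : ∀ q, met g (F q) (b q) (a q) = 0 := fun q => by rw [hg.symm, hab]
  rw [e, conn_add (SmAt.dfAt hsa) (SmAt.dfAt hsb) hg, conn_smul hcosh.1 (SmAt.dfAt ha) hg,
    conn_smul hsinh.1 (SmAt.dfAt hb) hg, hcosh.2, hsinh.2, ea]
  simp only [conn_add_right, conn_smul_right, map_add, map_smul, smul_eq_mul, haa, hbb, hab, hba,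
    k1 ha haa, k1 hb hbb, k2]
  have := Real.cosh_sq (t p)
  linear_combination (dd 2 t p w + conn g F a p w (b p)) * this

end Rotation

/-! ### The Laplacian of a surface in coordinates -/

section RiemannianSurface

variable {S : Type*} [TopologicalSpace S] [ChartedSpace (EuclideanSpace ℝ (Fin 2)) S]
  [IsManifold (𝓡 2) ∞ S] {σ : MetricField 2 S}

theorem gramAt_symm (hσ : SmoothMetric σ) (x y : S) (i j : Fin 2) :
    gramAt σ x y i j = gramAt σ x y j i := hσ.gz_symm x y (bas 2 i) (bas 2 j)

theorem bilin_two (B : Euc 2 →L[ℝ] Euc 2 →L[ℝ] ℝ) (a b : ℝ) :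
    B (a • bas 2 0 + b • bas 2 1) (a • bas 2 0 + b • bas 2 1)
      = a ^ 2 * B (bas 2 0) (bas 2 0) + a * b * (B (bas 2 0) (bas 2 1) + B (bas 2 1) (bas 2 0))
        + b ^ 2 * B (bas 2 1) (bas 2 1) := by
  simp only [map_add, map_smul, add_apply, smul_apply, smul_eq_mul]
  ring

theorem det_pos_of_pos {B : Euc 2 →L[ℝ] Euc 2 →L[ℝ] ℝ} (hs : ∀ v w, B v w = B w v)
    (hB : ∀ a, a ≠ 0 → 0 < B a a) :
    0 < B (bas 2 0) (bas 2 0) * B (bas 2 1) (bas 2 1)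
      - B (bas 2 0) (bas 2 1) * B (bas 2 1) (bas 2 0) := by
  have hne : ∀ a b : ℝ, b ≠ 0 → a • bas 2 0 + b • bas 2 1 ≠ 0 := fun a b hb h => by
    have := congrArg (fun v : Euc 2 => v 1) h
    simp [bas] at this
    exact hb this
  have h0 : 0 < B (bas 2 0) (bas 2 0) := hB _ fun h => by
    have := congrArg (fun v : Euc 2 => v 0) h
    simp [bas] at this
  -- With E, F, G the coefficients of the form, F∂₀ − E∂₁ is orthogonal to ∂₀ and has square E(EG −
  -- F²).
  have h1 := hB _ (hne (B (bas 2 0) (bas 2 1)) (-B (bas 2 0) (bas 2 0)) (by simpa using h0.ne'))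
  rw [bilin_two, hs (bas 2 1) (bas 2 0)] at h1
  rw [hs (bas 2 1) (bas 2 0)]
  generalize B (bas 2 0) (bas 2 0) = E at *
  generalize B (bas 2 0) (bas 2 1) = F at *
  generalize B (bas 2 1) (bas 2 1) = G at *
  refine (mul_pos_iff_of_pos_left h0).1 ?_
  linarith

theorem gz_pos {n : ℕ} {M : Type*} [TopologicalSpace M] [ChartedSpace (EuclideanSpace ℝ (Fin n)) M]
    [IsManifold (𝓡 n) ∞ M] {σ : MetricField n M} {x y : M}
    (hpos : ∀ w : Euc n, w ≠ 0 → 0 < met σ y w w) (hy : y ∈ src n x) (a : Euc n) (ha : a ≠ 0) :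
    0 < gz σ x y a a := by
  refine hpos _ fun h => ha ?_
  have h' : tcc n x y y a = 0 := h
  rw [← tcc_tcc_self hy (mem_chart_source _ y) a, h', map_zero]

theorem det_gramAt_pos (hσ : SmoothMetric σ) {y : S} (hpos : ∀ w : Euc 2, w ≠ 0 → 0 < met σ y w w)
    {x : S} (hy : y ∈ src 2 x) : 0 < (gramAt σ x y).det := by
  rw [Matrix.det_fin_two]
  exact det_pos_of_pos (hσ.gz_symm x y) (gz_pos hpos hy)

theorem inv_two_apply (A : Matrix (Fin 2) (Fin 2) ℝ) :
    A⁻¹ 0 0 = A.det⁻¹ * A 1 1 ∧ A⁻¹ 0 1 = -(A.det⁻¹ * A 0 1) ∧ A⁻¹ 1 0 = -(A.det⁻¹ * A 1 0) ∧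
      A⁻¹ 1 1 = A.det⁻¹ * A 0 0 := by
  simp [Matrix.inv_def, Ring.inverse_eq_inv', Matrix.adjugate_fin_two]

/-- The second derivatives of a smooth function in a chart. -/
theorem dd_dd_eq {n : ℕ} {M : Type*} [TopologicalSpace M]
    [ChartedSpace (EuclideanSpace ℝ (Fin n)) M] [IsManifold (𝓡 n) ∞ M] {E' : Type*}
    [NormedAddCommGroup E'] [NormedSpace ℝ E'] {h : M → E'} {p : M}
    (hh : SmAt n h p) (a b : Euc n) :
    dd n (fun q => dd n h q (tcc n p q q a)) p b
      = fderiv ℝ (fderiv ℝ (h ∘ (extChartAt (𝓡 n) p).symm)) (extChartAt (𝓡 n) p p) b a := by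
  have hp := mem_chart_source (EuclideanSpace ℝ (Fin n)) p
  have h0 := contDiffAt_in_chart hp hh
  have h1 : ContDiffAt ℝ ∞ (fderiv ℝ (h ∘ (extChartAt (𝓡 n) p).symm)) (extChartAt (𝓡 n) p p) :=
    h0.fderiv_right (by simp)
  rw [← (SmAt.dfAt (smAt_dd_cvec hp hh a)).hasFDerivAt.fderiv]
  have e : ((fun q => dd n h q (tcc n p q q a)) ∘ (extChartAt (𝓡 n) p).symm)
      =ᶠ[𝓝 (extChartAt (𝓡 n) p p)]
      fun u => fderiv ℝ (h ∘ (extChartAt (𝓡 n) p).symm) u a := by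
    have hc : ContinuousAt (extChartAt (𝓡 n) p).symm (extChartAt (𝓡 n) p p) :=
      (contMDiffAt_chart_symm hp).continuousAt
    have e1 := hc.eventually (p := fun q => q ∈ src n p) (by
      rw [symm_chart hp]; exact source_mem_nhds hp)
    have e2 := hc.eventually (p := fun q => DfAt n h q) (by
      rw [symm_chart hp]; exact hh.eventually_dfAt)
    filter_upwards [e1, e2, (isOpen_extChartAt_target p).mem_nhds (mem_extChartAt_target p)]
      with u h1 h2 h3
    have := dd_cvec h1 h2 a
    rwa [(extChartAt (𝓡 n) p).right_inv h3] at this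
  rw [e.fderiv_eq, fderiv_clm_apply (h1.differentiableAt (by simp)) (by fun_prop)]
  simp

/-- A smooth function has symmetric second derivatives in a chart. -/
theorem dd_dd_symm {n : ℕ} {M : Type*} [TopologicalSpace M]
    [ChartedSpace (EuclideanSpace ℝ (Fin n)) M] [IsManifold (𝓡 n) ∞ M] {E' : Type*}
    [NormedAddCommGroup E'] [NormedSpace ℝ E'] {h : M → E'} {p : M}
    (hh : SmAt n h p) (a b : Euc n) :
    dd n (fun q => dd n h q (tcc n p q q a)) p b = dd n (fun q => dd n h q (tcc n p q q b)) p a := by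
  rw [dd_dd_eq hh, dd_dd_eq hh]
  exact ((contDiffAt_in_chart (mem_chart_source _ p) hh).isSymmSndFDerivAt (by
    rw [minSmoothness_of_isRCLikeNormedField]; exact WithTop.coe_le_coe.2 le_top)) b a

/-- The gradient, with types reduced to Euclidean space. -/
def gr (σ : MetricField 2 S) (f : S → ℝ) (y : S) : Euc 2 := shp σ y (dd 2 f y)

theorem coordComponent_gr (hσ : SmoothMetric σ) {x y : S} (hy : y ∈ src 2 x) (f : S → ℝ)
    (i : Fin 2) :
    coordComponent (grad σ f) x i y = ∑ j, (gramAt σ x y)⁻¹ i j * dd 2 f y (cv 2 x y j) :=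
  tcc_sharp hσ hy (dd 2 f y).toLinearMap i

theorem met_gr (hσ : SmoothMetric σ) (f : S → ℝ) (y : S) (w : Euc 2) :
    met σ y (gr σ f y) w = dd 2 f y w :=
  met_sharp (hσ.symm y) (hσ.nondeg y) (dd 2 f y).toLinearMap w

theorem laplacian_aux {s D n₀ n₁ m₀ m₁ d₀ d₁ : ℝ} (hs : s ≠ 0) (hD : D = s ^ 2) :
    s⁻¹ * (n₀ * s⁻¹ + m₀ * (-(1 / (2 * s)) / s ^ 2 * d₀)
      + (n₁ * s⁻¹ + m₁ * (-(1 / (2 * s)) / s ^ 2 * d₁)))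
      = (n₀ + n₁) / D - (m₀ * d₀ + m₁ * d₁) / (2 * D ^ 2) := by
  subst hD
  field_simp
  ring

/-- The Laplacian in the chart at `p`, in terms of the first and second partial derivatives of `f`
and the first derivatives of the metric. -/
theorem laplacian_eq (hσ : SmoothMetric σ) (hpos : ∀ y (w : Euc 2), w ≠ 0 → 0 < met σ y w w)
    {f : S → ℝ} {p : S} (hf : SmAt 2 f p) (A : Fin 2 → Fin 2 → ℝ) (dA : Fin 2 → Fin 2 → Fin 2 → ℝ)
    (t : Fin 2 → ℝ) (dt : Fin 2 → Fin 2 → ℝ) (hA : ∀ i j, gramAt σ p p i j = A i j)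
    (hdA : ∀ i j k, dd 2 (fun q => gramAt σ p q i j) p (bas 2 k) = dA k i j)
    (ht : ∀ j, dd 2 f p (bas 2 j) = t j)
    (hdt : ∀ j k, dd 2 (fun q => dd 2 f q (cv 2 p q j)) p (bas 2 k) = dt k j) :
    laplacian σ f p =
      ((dA 0 1 1 * t 0 + A 1 1 * dt 0 0 - (dA 0 0 1 * t 1 + A 0 1 * dt 0 1))
        + (dA 1 0 0 * t 1 + A 0 0 * dt 1 1 - (dA 1 0 1 * t 0 + A 0 1 * dt 1 0)))
          / (A 0 0 * A 1 1 - A 0 1 * A 0 1)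
      - ((A 1 1 * t 0 - A 0 1 * t 1)
          * (dA 0 0 0 * A 1 1 + A 0 0 * dA 0 1 1 - (dA 0 0 1 * A 0 1 + A 0 1 * dA 0 0 1))
        + (A 0 0 * t 1 - A 0 1 * t 0)
          * (dA 1 0 0 * A 1 1 + A 0 0 * dA 1 1 1 - (dA 1 0 1 * A 0 1 + A 0 1 * dA 1 0 1)))
        / (2 * (A 0 0 * A 1 1 - A 0 1 * A 0 1) ^ 2) := by
  have hp := mem_chart_source (EuclideanSpace ℝ (Fin 2)) p
  have hsym : ∀ q, gramAt σ p q 1 0 = gramAt σ p q 0 1 := fun q => gramAt_symm hσ p q 1 0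
  have hdet : ∀ q, (gramAt σ p q).det
      = gramAt σ p q 0 0 * gramAt σ p q 1 1 - gramAt σ p q 0 1 * gramAt σ p q 0 1 := fun q => by
    rw [Matrix.det_fin_two, hsym]
  have hD0 : 0 < A 0 0 * A 1 1 - A 0 1 * A 0 1 := by
    have := det_gramAt_pos hσ (hpos p) hp
    rwa [hdet, hA, hA, hA] at this
  have hG : ∀ i j, DfAt 2 (fun q => gramAt σ p q i j) p := fun i j => (smAt_gramAt hσ hp i j).dfAt
  have hT : ∀ j, DfAt 2 (fun q => dd 2 f q (cv 2 p q j)) p := fun j =>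
    SmAt.dfAt (smAt_dd_cvec hp hf _)
  have m1 := dd_mul (hG 0 0) (hG 1 1)
  have m2 := dd_mul (hG 0 1) (hG 0 1)
  have mD := dd_sub m1.1 m2.1
  have hφ : HasDerivAt (fun x => (√x)⁻¹)
      (-(1 / (2 * √(A 0 0 * A 1 1 - A 0 1 * A 0 1))) / √(A 0 0 * A 1 1 - A 0 1 * A 0 1) ^ 2)
      (A 0 0 * A 1 1 - A 0 1 * A 0 1) :=
    (Real.hasDerivAt_sqrt hD0.ne').fun_inv (Real.sqrt_pos.2 hD0).ne'
  have mS := dd_real_comp (φ := fun x => (√x)⁻¹) mD.1 (by simpa only [hA] using hφ)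
  have n0 := dd_sub (dd_mul (hG 1 1) (hT 0)).1 (dd_mul (hG 0 1) (hT 1)).1
  have n1 := dd_sub (dd_mul (hG 0 0) (hT 1)).1 (dd_mul (hG 0 1) (hT 0)).1
  have r0 := dd_mul n0.1 mS.1
  have r1 := dd_mul n1.1 mS.1
  have ev : ∀ᶠ q in 𝓝 p, q ∈ src 2 p := source_mem_nhds hp
  -- In dimension two √det · σ⁻¹ is the adjugate divided by √det, so the only non-polynomial factor
  -- to differentiate is 1/√det.
  have c0 : (fun y => volDensity σ p y * coordComponent (grad σ f) p 0 y) =ᶠ[𝓝 p] fun q =>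
      (gramAt σ p q 1 1 * dd 2 f q (cv 2 p q 0) - gramAt σ p q 0 1 * dd 2 f q (cv 2 p q 1))
      * (√(gramAt σ p q 0 0 * gramAt σ p q 1 1 - gramAt σ p q 0 1 * gramAt σ p q 0 1))⁻¹ := by
    filter_upwards [ev] with q hq
    have hd := det_gramAt_pos hσ (hpos q) hq
    obtain ⟨i1, i2, i3, i4⟩ := inv_two_apply (gramAt σ p q)
    rw [coordComponent_gr hσ hq, Fin.sum_univ_two, i1, i2, volDensity_eq, ← hdet]
    have hs := Real.sq_sqrt hd.le
    have hs0 := (Real.sqrt_pos.2 hd).ne'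
    field_simp
    rw [hs]; ring
  have c1 : (fun y => volDensity σ p y * coordComponent (grad σ f) p 1 y) =ᶠ[𝓝 p] fun q =>
      (gramAt σ p q 0 0 * dd 2 f q (cv 2 p q 1) - gramAt σ p q 0 1 * dd 2 f q (cv 2 p q 0))
      * (√(gramAt σ p q 0 0 * gramAt σ p q 1 1 - gramAt σ p q 0 1 * gramAt σ p q 0 1))⁻¹ := by
    filter_upwards [ev] with q hq
    have hd := det_gramAt_pos hσ (hpos q) hq
    obtain ⟨i1, i2, i3, i4⟩ := inv_two_apply (gramAt σ p q)
    rw [coordComponent_gr hσ hq, Fin.sum_univ_two, i3, i4, volDensity_eq, ← hdet, hsym]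
    have hs := Real.sq_sqrt hd.le
    have hs0 := (Real.sqrt_pos.2 hd).ne'
    field_simp
    rw [hs]; ring
  have hlap : laplacian σ f p = (volDensity σ p p)⁻¹ * ∑ i, dd 2 (fun y => volDensity σ p y *
      coordComponent (grad σ f) p i y) p (bas 2 i) := rfl
  rw [hlap, Fin.sum_univ_two, dd_congr c0, dd_congr c1, r0.2, r1.2, n0.2, n1.2, mS.2, mS.2, mD.2]
  simp only [sub_apply, m1.2, m2.2, (dd_mul (hG 1 1) (hT 0)).2, (dd_mul (hG 0 1) (hT 1)).2,
    (dd_mul (hG 0 0) (hT 1)).2, (dd_mul (hG 0 1) (hT 0)).2, hdA, hdt, hA, volDensity_eq, hdet,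
    cv_self, ht]
  rw [laplacian_aux (Real.sqrt_pos.2 hD0).ne' (Real.sq_sqrt hD0.le).symm]

end RiemannianSurface

/-! ### Height functions and the mean curvature vector in Minkowski space -/

section SpacelikeSurface

variable {S : Type*} [TopologicalSpace S] [ChartedSpace (EuclideanSpace ℝ (Fin 2)) S]
  [IsManifold (𝓡 2) ∞ S] {X : S → Euc 4}

/-- The Laplacian of the coordinate functions of a spacelike surface in Minkowski space is given by
the mean curvature vector. -/
theorem laplacian_height (hX : ∀ q : S, SmAt 2 X q)
    (hpos : ∀ y (w : Euc 2), w ≠ 0 → 0 < met (induced (m := 2) minkowski X) y w w) (T : Euc 4) (p : S) :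
    laplacian (induced (m := 2) minkowski X) (fun q => -eta (X q) T) p
      = -eta (mcv 2 minkowski X p) T := by
  have hF : ∀ q, ContMDiffAt (𝓡 2) (𝓡 4) ∞ X q := hX
  have hp := mem_chart_source (EuclideanSpace ℝ (Fin 2)) p
  set σ : MetricField 2 S := induced (m := 2) minkowski X with hσdef
  have hσ : SmoothMetric σ := smoothMetric_induced smoothMetric_minkowski hF hpos
  let Y : Fin 2 → S → Euc 4 := fun i q => dd 2 X q (cv 2 p q i)
  have hY : ∀ i, DfAt 2 (Y i) p := fun i => SmAt.dfAt (smAt_dd_cvec hp (hX p) _)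
  let Z : Fin 2 → Fin 2 → Euc 4 := fun k i => dd 2 (Y i) p (bas 2 k)
  have hZ : Z 1 0 = Z 0 1 := dd_dd_symm (hX p) _ _
  have hYp : ∀ i, Y i p = dd 2 X p (bas 2 i) := fun i => by simp only [Y, cv_self]
  have hf : ∀ q : S, SmAt 2 (fun q => -eta (X q) T) q := by
    intro q
    have h1 : SmAt 2 (fun q => eta (X q)) q := contMDiffAt_const.clm_apply (hX q)
    exact (h1.clm_apply contMDiffAt_const).neg
  have hdf : ∀ (q : S) (w : Euc 2), dd 2 (fun q => -eta (X q) T) q w = -eta (dd 2 X q w) T := by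
    intro q w
    have h1 := dd_eta (hX q).dfAt (U := fun _ => T) mdifferentiableAt_const
    have h2 := dd_real_comp h1.1 (φ := fun x => -x) (hasDerivAt_neg _)
    rw [h2.2, h1.2, dd_const]; simp
  have hdA : ∀ i j k, dd 2 (fun q => gramAt σ p q i j) p (bas 2 k)
      = eta (Z k i) (Y j p) + eta (Y i p) (Z k j) := fun i j k => (dd_eta (hY i) (hY j)).2 _
  have hdt : ∀ j k, dd 2 (fun q => dd 2 (fun q => -eta (X q) T) q (cv 2 p q j)) p (bas 2 k)
      = -eta (Z k j) T := by
    intro j k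
    simp only [hdf]
    have h1 := dd_eta (hY j) (U := fun _ => T) mdifferentiableAt_const
    have h2 := dd_real_comp h1.1 (φ := fun x => -x) (hasDerivAt_neg _)
    have h3 : (fun q => -eta (dd 2 X q (cv 2 p q j)) T) = fun q => -eta (Y j q) T := rfl
    rw [h3, h2.2, h1.2, dd_const]; simp [Z]
  rw [laplacian_eq hσ hpos (hf p) (fun i j => eta (Y i p) (Y j p))
    (fun k i j => eta (Z k i) (Y j p) + eta (Y i p) (Z k j)) (fun j => -eta (Y j p) T)
    (fun k j => -eta (Z k j) T) (fun i j => rfl) hdA (fun j => by rw [hdf, hYp]) hdt]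
  have hD0 : eta (Y 0 p) (Y 0 p) * eta (Y 1 p) (Y 1 p) - eta (Y 0 p) (Y 1 p) * eta (Y 0 p) (Y 1 p)
      ≠ 0 := by
    have := (det_gramAt_pos hσ (hpos p) hp).ne'
    rw [Matrix.det_fin_two] at this
    have e : gramAt σ p p 1 0 = gramAt σ p p 0 1 := gramAt_symm hσ p p 1 0
    rw [e] at this
    exact this
  have hgram : gram σ p = gramAt σ p p := (gramAt_self σ p).symm
  have htrc : ∀ u, eta (trc 2 minkowski X p) u
      = ∑ i, ∑ j, (gramAt σ p p)⁻¹ i j * eta (Z i j) u := by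
    intro u
    have := met_trc (m := 2) (g := minkowski) (F := X) p u
    simp only [conn_minkowski] at this
    rw [← hgram]
    exact this
  obtain ⟨i1, i2, i3, i4⟩ := inv_two_apply (gramAt σ p p)
  have hdet : (gramAt σ p p).det = eta (Y 0 p) (Y 0 p) * eta (Y 1 p) (Y 1 p)
      - eta (Y 0 p) (Y 1 p) * eta (Y 1 p) (Y 0 p) := Matrix.det_fin_two _
  have hA : ∀ i j, gramAt σ p p i j = eta (Y i p) (Y j p) := fun i j => rfl
  -- H is the trace of the second derivatives minus its tangential part. The tangential part
  -- accounts for the first-order terms of the Laplacian, so after substitution the claim is an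
  -- identity of rational functions of the scalar products.
  have e1 : mcv 2 minkowski X p = trc 2 minkowski X p - ∑ i, ∑ j, ((gramAt σ p p)⁻¹ i j *
      eta (trc 2 minkowski X p) (Y j p)) • Y i p := by
    rw [mcv_eq, nrm_eq]
    congr 1
    rw [sharp_eq, map_sum]
    refine Finset.sum_congr rfl fun i _ => ?_
    rw [map_sum]
    refine Finset.sum_congr rfl fun j _ => ?_
    rw [map_smul, ← hgram, hYp, hYp]
    rfl
  rw [e1]
  simp only [Fin.sum_univ_two, map_sub, map_add, map_smul, sub_apply, add_apply, smul_apply,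
    smul_eq_mul, htrc, i1, i2, i3, i4, hdet, hA, hZ]
  have s1 : eta (Y 1 p) (Y 0 p) = eta (Y 0 p) (Y 1 p) := eta_symm _ _
  have s2 : ∀ i k l, eta (Y i p) (Z k l) = eta (Z k l) (Y i p) := fun _ _ _ => eta_symm _ _
  simp only [s1, s2]
  generalize eta (Y 0 p) (Y 0 p) = E at *
  generalize eta (Y 0 p) (Y 1 p) = F at *
  generalize eta (Y 1 p) (Y 1 p) = G at *
  generalize eta (Y 0 p) T = t0
  generalize eta (Y 1 p) T = t1
  have hD : E * G - F * F ≠ 0 := hD0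
  field_simp
  ring

end SpacelikeSurface

/-! ## The Riemannian measure -/

section Measure

variable {n : ℕ} {M : Type*} [TopologicalSpace M] [ChartedSpace (EuclideanSpace ℝ (Fin n)) M]
  [IsManifold (𝓡 n) ∞ M] [MeasurableSpace M] [BorelSpace M]

variable (n) in
/-- The chart at `x`, as a map to Euclidean space. -/
abbrev ch (x : M) : PartialEquiv M (Euc n) := extChartAt (𝓡 n) x

theorem measurableSet_src (x : M) : MeasurableSet (src n x) :=
  (chartAt (EuclideanSpace ℝ (Fin n)) x).open_source.measurableSet

theorem measurableSet_target (x : M) : MeasurableSet (ch n x).target :=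
  (isOpen_extChartAt_target x).measurableSet

/-- The inverse chart is controlled only on its target, where it is continuous; hence measurability
almost everywhere, for measures that ignore the complement of the target. -/
theorem aemeasurable_symm (x : M) {μ : Measure (Euc n)} (hμ : μ ≪ volume.restrict (ch n x).target) :
    AEMeasurable (ch n x).symm μ := by
  have h : AEMeasurable (ch n x).symm (volume.restrict (ch n x).target) :=
    (continuousOn_extChartAt_symm x).aemeasurable (measurableSet_target x)
  exact h.mono_ac hμ

theorem image_chart_eq {x : M} {A : Set M} (hA : A ⊆ src n x) :
    (ch n x) '' A = (ch n x).symm ⁻¹' A ∩ (ch n x).target := by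
  rw [(ch n x).image_eq_target_inter_inv_preimage (by rwa [extChartAt_source]), Set.inter_comm]

theorem measurableSet_image_chart {x : M} {A : Set M} (hA : A ⊆ src n x) (hm : MeasurableSet A) :
    MeasurableSet ((ch n x) '' A) := by
  rw [image_chart_eq hA]
  have h := (continuousOn_iff_continuous_domRestrict.1 (continuousOn_extChartAt_symm (I := 𝓡 n) x)).measurable hm
  have h2 := (measurableSet_target (n := n) x).subtype_image h
  convert h2 using 1
  ext u
  simp only [Set.mem_inter_iff, Set.mem_preimage, Set.mem_image, Set.domRestrict_apply,
    Subtype.exists, exists_and_left, exists_prop, exists_eq_right_right]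

theorem chartMeasure_apply (σ : MetricField n M) (x : M) {A : Set M} (hm : MeasurableSet A) :
    chartMeasure σ x A = ∫⁻ u in (ch n x).symm ⁻¹' A ∩ (ch n x).target,
      ENNReal.ofReal (volDensity σ x ((ch n x).symm u)) := by
  rw [chartMeasure, Measure.map_apply_of_aemeasurable
    (aemeasurable_symm x (withDensity_absolutelyContinuous _ _)) hm, withDensity_apply',
    Measure.restrict_restrict' (measurableSet_target x)]

theorem chartMeasure_apply_of_subset (σ : MetricField n M) {x : M} {A : Set M}
    (hA : A ⊆ src n x) (hm : MeasurableSet A) :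
    chartMeasure σ x A = ∫⁻ u in (ch n x) '' A,
      ENNReal.ofReal (volDensity σ x ((ch n x).symm u)) := by
  rw [chartMeasure_apply σ x hm, image_chart_eq hA]

theorem chartMeasure_compl (σ : MetricField n M) (x : M) :
    chartMeasure σ x (src n x)ᶜ = 0 := by
  rw [chartMeasure_apply σ x (measurableSet_src x).compl]
  have : (ch n x).symm ⁻¹' (src n x)ᶜ ∩ (ch n x).target = ∅ := by
    rw [Set.eq_empty_iff_forall_notMem]
    rintro u ⟨h1, h2⟩
    have := (ch n x).map_target h2
    rw [extChartAt_source] at this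
    exact h1 this
  rw [this]; simp

theorem tcc_det (x z y : M) : (tcc n x z y).det = (jac n x z y).det := by
  have : (jac n x z y) = LinearMap.toMatrix (EuclideanSpace.basisFun (Fin n) ℝ).toBasis
      (EuclideanSpace.basisFun (Fin n) ℝ).toBasis (tcc n x z y).toLinearMap := by
    ext i j
    simp [jac, LinearMap.toMatrix_apply, bas]
  rw [this, LinearMap.det_toMatrix]

/-- The Gram determinant acquires the square of the Jacobian determinant, and the root leaves its
absolute value: exactly the factor in the change of variables formula. -/
theorem volDensity_change (σ : MetricField n M) {x z y : M} (hx : y ∈ src n x) (hz : y ∈ src n z) :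
    volDensity σ x y = |(jac n x z y).det| * volDensity σ z y := by
  rw [volDensity_eq, volDensity_eq, gramAt_eq σ hx hz, Matrix.det_mul, Matrix.det_mul,
    Matrix.det_transpose]
  have : (jac n x z y).det * (gramAt σ z y).det * (jac n x z y).det
      = (jac n x z y).det ^ 2 * (gramAt σ z y).det := by ring
  rw [this, Real.sqrt_mul (sq_nonneg _), Real.sqrt_sq_eq_abs]

/-- The chart measures agree on overlaps. -/
theorem chartMeasure_overlap (σ : MetricField n M) {x z : M} {A : Set M} (hx : A ⊆ src n x)
    (hz : A ⊆ src n z) (hm : MeasurableSet A) : chartMeasure σ x A = chartMeasure σ z A := by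
  rw [chartMeasure_apply_of_subset σ hx hm, chartMeasure_apply_of_subset σ hz hm]
  have himg : (ch n z) '' A = (ch n z ∘ (ch n x).symm) '' ((ch n x) '' A) := by
    rw [← Set.image_comp]
    refine Set.image_congr fun q hq => ?_
    simp only [Function.comp_apply]
    rw [symm_chart (hx hq)]
  rw [himg, lintegral_image_eq_lintegral_abs_det_fderiv_mul volume
    (measurableSet_image_chart hx hm) (f' := fun u => tcc n x z ((ch n x).symm u))]
  · refine setLIntegral_congr_fun (measurableSet_image_chart hx hm) ?_
    rintro _ ⟨q, hq, rfl⟩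
    simp only [Function.comp_apply]
    rw [symm_chart (hx hq), symm_chart (hz hq), volDensity_change σ (hx hq) (hz hq), tcc_det,
      ENNReal.ofReal_mul (abs_nonneg _)]
  · rintro _ ⟨q, hq, rfl⟩
    rw [symm_chart (hx hq)]
    exact (hasFDerivAt_transition (hx hq) (hz hq)).hasFDerivWithinAt
  · rintro _ ⟨q, hq, rfl⟩ _ ⟨q', hq', rfl⟩ h
    simp only [Function.comp_apply] at h
    rw [symm_chart (hx hq), symm_chart (hx hq')] at h
    rw [← symm_chart (hz hq), ← symm_chart (hz hq'), h]

/-- The Riemannian measure restricts to the chart measure on the domain of each chart. -/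
theorem riemannianMeasure_restrict (σ : MetricField n M) (x : M) :
    (riemannianMeasure σ).restrict (src n x) = chartMeasure σ x := by
  refine le_antisymm ?_ ?_
  -- Each chart measure is bounded by splitting a set along the chart domain: inside it agrees with
  -- the measure of the chart at `x` on the overlap, and outside the supremum itself is a bound. The
  -- bound then passes to the supremum.
  · have h : riemannianMeasure σ ≤
        chartMeasure σ x + (riemannianMeasure σ).restrict (src n x)ᶜ := by
      refine iSup_le fun z => Measure.le_iff.2 fun A hA => ?_
      have h1 : chartMeasure σ z (A ∩ src n x) ≤ chartMeasure σ x A := by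
        have e : chartMeasure σ z (A ∩ src n x)
            = chartMeasure σ z (A ∩ src n x ∩ src n z) := by
          refine le_antisymm ?_ (measure_mono Set.inter_subset_left)
          refine (measure_mono (t := (A ∩ src n x ∩ src n z) ∪ (src n z)ᶜ) ?_).trans
            ((measure_union_le _ _).trans ?_)
          · intro q hq
            by_cases h : q ∈ src n z
            · exact Or.inl ⟨hq, h⟩
            · exact Or.inr h
          · rw [chartMeasure_compl, add_zero]
        rw [e, chartMeasure_overlap σ (x := z) (z := x) Set.inter_subset_right
          (Set.inter_subset_left.trans Set.inter_subset_right)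
          ((hA.inter (measurableSet_src x)).inter (measurableSet_src z))]
        exact measure_mono (Set.inter_subset_left.trans Set.inter_subset_left)
      have h2 : chartMeasure σ z (A \ src n x) ≤ (riemannianMeasure σ).restrict (src n x)ᶜ A := by
        rw [Measure.restrict_apply hA]
        exact (le_iSup (chartMeasure σ) z) _
      rw [← measure_inter_add_sdiff A (measurableSet_src (n := n) x)]
      exact add_le_add h1 h2
    calc (riemannianMeasure σ).restrict (src n x)
        ≤ (chartMeasure σ x + (riemannianMeasure σ).restrict (src n x)ᶜ).restrict (src n x) :=
          Measure.restrict_mono_measure h _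
      _ = (chartMeasure σ x).restrict (src n x) := by
          rw [Measure.restrict_add, Measure.restrict_restrict (measurableSet_src x)]
          simp
      _ ≤ chartMeasure σ x := Measure.restrict_le_self
  · have h : (chartMeasure σ x).restrict (src n x) = chartMeasure σ x :=
      Measure.restrict_eq_self_of_ae_mem (by
        exact mem_ae_iff.2 (chartMeasure_compl σ x))
    rw [← h]
    exact Measure.restrict_mono_measure (le_iSup (chartMeasure σ) x) _

end Measure

/-! ### Finiteness, densities and integrals in charts on a surface -/

section SurfaceMeasure

variable {S : Type*} [TopologicalSpace S] [ChartedSpace (EuclideanSpace ℝ (Fin 2)) S]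
  [IsManifold (𝓡 2) ∞ S] [MeasurableSpace S] [BorelSpace S] {σ : MetricField 2 S}

theorem smAt_volDensity (hσ : SmoothMetric σ) (hpos : ∀ y (w : Euc 2), w ≠ 0 → 0 < met σ y w w)
    {x y : S} (hy : y ∈ src 2 x) : SmAt 2 (fun q => volDensity σ x q) y := by
  have h1 : SmAt 2 (fun q => (gramAt σ x q).det) y := by
    simp only [Matrix.det_fin_two]
    exact ((smAt_gramAt hσ hy 0 0).mul (smAt_gramAt hσ hy 1 1)).sub
      ((smAt_gramAt hσ hy 0 1).mul (smAt_gramAt hσ hy 1 0))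
  exact SmAt.comp_real_at (Real.contDiffAt_sqrt (det_gramAt_pos hσ (hpos y) hy).ne') h1

theorem continuousOn_in_chart {E' : Type*} [TopologicalSpace E'] {x : S} {f : S → E'}
    (hf : ∀ y ∈ src 2 x, ContinuousAt f y) :
    ContinuousOn (fun u => f ((ch 2 x).symm u)) (ch 2 x).target := by
  intro u hu
  have hy : (ch 2 x).symm u ∈ src 2 x := by
    have := (ch 2 x).map_target hu
    rwa [extChartAt_source] at this
  exact ContinuousAt.comp_continuousWithinAt (hf _ hy) (continuousOn_extChartAt_symm x u hu)

/-- On a compact surface local finiteness suffices. Around each point a chart ball is taken whose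
closed ball lies in the chart target; there the volume density is continuous, hence integrable. -/
theorem isFiniteMeasure_riemannianMeasure [CompactSpace S] (hσ : SmoothMetric σ)
    (hpos : ∀ y (w : Euc 2), w ≠ 0 → 0 < met σ y w w) :
    IsFiniteMeasure (riemannianMeasure σ) := by
  refine ⟨isCompact_univ.measure_lt_top_of_nhdsWithin fun x _ => ?_⟩
  rw [nhdsWithin_univ]
  have hx := mem_chart_source (EuclideanSpace ℝ (Fin 2)) x
  obtain ⟨r, hr, hball⟩ := Metric.nhds_basis_closedBall.mem_iff.1
    ((isOpen_extChartAt_target (I := 𝓡 2) x).mem_nhds (mem_extChartAt_target x))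
  let U : Set S := src 2 x ∩ (ch 2 x) ⁻¹' Metric.ball (ch 2 x x) r
  have hUo : IsOpen U := by
    have := (continuousOn_extChartAt (I := 𝓡 2) x).isOpen_inter_preimage
      (isOpen_extChartAt_source x) (Metric.isOpen_ball (x := ch 2 x x) (ε := r))
    rwa [extChartAt_source] at this
  refine ⟨U, hUo.mem_nhds ⟨hx, Metric.mem_ball_self hr⟩, ?_⟩
  have e : riemannianMeasure σ U = chartMeasure σ x U := by
    rw [← riemannianMeasure_restrict σ x, Measure.restrict_apply hUo.measurableSet,
      Set.inter_eq_left.2 Set.inter_subset_left]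
  rw [e, chartMeasure_apply_of_subset σ Set.inter_subset_left hUo.measurableSet]
  have hc : ContinuousOn (fun u => volDensity σ x ((ch 2 x).symm u))
      (Metric.closedBall (ch 2 x x) r) :=
    (continuousOn_in_chart fun y hy => (smAt_volDensity hσ hpos hy).continuousAt).mono hball
  have hi : IntegrableOn (fun u => volDensity σ x ((ch 2 x).symm u))
      (Metric.closedBall (ch 2 x x) r) volume :=
    hc.integrableOn_compact (isCompact_closedBall _ _)
  refine lt_of_le_of_lt (lintegral_mono_set ?_) hi.lintegral_lt_top
  rintro _ ⟨q, ⟨_, hq⟩, rfl⟩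
  exact Metric.ball_subset_closedBall hq

theorem aemeasurable_volDensity (hσ : SmoothMetric σ)
    (hpos : ∀ y (w : Euc 2), w ≠ 0 → 0 < met σ y w w) (x : S) :
    AEMeasurable (fun u => volDensity σ x ((ch 2 x).symm u))
      (volume.restrict (ch 2 x).target) :=
  (continuousOn_in_chart fun _ hy => (smAt_volDensity hσ hpos hy).continuousAt).aemeasurable
    (measurableSet_target x)

theorem lintegral_chartMeasure (hσ : SmoothMetric σ)
    (hpos : ∀ y (w : Euc 2), w ≠ 0 → 0 < met σ y w w) (x : S) {k : S → ENNReal}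
    (hk : Measurable k) :
    ∫⁻ y, k y ∂chartMeasure σ x = ∫⁻ u in (ch 2 x).target,
      ENNReal.ofReal (volDensity σ x ((ch 2 x).symm u)) * k ((ch 2 x).symm u) := by
  have hm := aemeasurable_symm (n := 2) x (withDensity_absolutelyContinuous
    (volume.restrict (ch 2 x).target)
    fun u => ENNReal.ofReal (volDensity σ x ((ch 2 x).symm u)))
  have hkm : AEMeasurable (fun u => k ((ch 2 x).symm u)) _ := hk.comp_aemeasurable hm
  rw [chartMeasure, lintegral_map' hk.aemeasurable hm,
    lintegral_withDensity_eq_lintegral_mul₀' (aemeasurable_volDensity hσ hpos x).ennreal_ofReal hkm]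
  rfl

theorem integral_chartMeasure (hσ : SmoothMetric σ)
    (hpos : ∀ y (w : Euc 2), w ≠ 0 → 0 < met σ y w w) (x : S) {k : S → ℝ}
    (hk : Measurable k) :
    ∫ y, k y ∂chartMeasure σ x = ∫ u in (ch 2 x).target,
      volDensity σ x ((ch 2 x).symm u) * k ((ch 2 x).symm u) := by
  have hm := aemeasurable_symm (n := 2) x (withDensity_absolutelyContinuous
    (volume.restrict (ch 2 x).target)
    fun u => ENNReal.ofReal (volDensity σ x ((ch 2 x).symm u)))
  rw [chartMeasure, integral_map hm hk.aestronglyMeasurable,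
    integral_withDensity_eq_integral_toReal_smul₀
      (aemeasurable_volDensity hσ hpos x).ennreal_ofReal (by simp)]
  refine integral_congr_ae (Eventually.of_forall fun u => ?_)
  have h0 : 0 ≤ volDensity σ x ((ch 2 x).symm u) := Real.sqrt_nonneg _
  simp only [smul_eq_mul]
  exact congrArg (· * _) (ENNReal.toReal_ofReal h0)

/-- If the volume densities of two metrics differ by a factor, then so do their measures. -/
theorem riemannianMeasure_withDensity {σ' : MetricField 2 S} (hσ : SmoothMetric σ)
    (hpos : ∀ y (w : Euc 2), w ≠ 0 → 0 < met σ y w w) (hσ' : SmoothMetric σ')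
    (hpos' : ∀ y (w : Euc 2), w ≠ 0 → 0 < met σ' y w w) {c : S → ℝ} (hc : Continuous c)
    (hc0 : ∀ y, 0 < c y)
    (h : ∀ x y, y ∈ src 2 x → volDensity σ' x y = c y * volDensity σ x y) :
    riemannianMeasure σ' = (riemannianMeasure σ).withDensity fun y => ENNReal.ofReal (c y) := by
  set f : S → ENNReal := fun y => ENNReal.ofReal (c y) with hf
  have hfm : Measurable f := hc.measurable.ennreal_ofReal
  have hf0 : ∀ y, f y ≠ 0 := fun y => (ENNReal.ofReal_pos.2 (hc0 y)).ne'
  have hft : ∀ y, f y ≠ ⊤ := fun y => ENNReal.ofReal_ne_top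
  have hmono : ∀ {μ ν : Measure S} (k : S → ENNReal), μ ≤ ν → μ.withDensity k ≤ ν.withDensity k := by
    intro μ ν k hμν
    refine Measure.le_iff.2 fun A hA => ?_
    rw [withDensity_apply _ hA, withDensity_apply _ hA]
    exact lintegral_mono' (Measure.restrict_mono_measure hμν A) le_rfl
  have h1 : ∀ x, chartMeasure σ' x = (chartMeasure σ x).withDensity f := by
    intro x
    ext A hA
    rw [withDensity_apply _ hA, ← lintegral_indicator hA, ← lintegral_indicator_one hA,
      lintegral_chartMeasure hσ hpos x (hfm.indicator hA),
      lintegral_chartMeasure hσ' hpos' x (measurable_one.indicator hA)]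
    refine setLIntegral_congr_fun (measurableSet_target x) fun u hu => ?_
    have hy : (ch 2 x).symm u ∈ src 2 x := by
      have := (ch 2 x).map_target hu
      rwa [extChartAt_source] at this
    by_cases hA' : (ch 2 x).symm u ∈ A
    · simp only [Set.indicator_of_mem hA', Pi.one_apply, mul_one, hf]
      rw [h x _ hy, mul_comm, ENNReal.ofReal_mul' (hc0 _).le]
    · simp only [Set.indicator_of_notMem hA', mul_zero]
  have h2 : ∀ μ : Measure S, (μ.withDensity f).withDensity (fun y => (f y)⁻¹) = μ := fun μ =>
    withDensity_inv_same hfm (Eventually.of_forall hf0) (Eventually.of_forall hft)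
  have h3 : ∀ μ : Measure S, (μ.withDensity (fun y => (f y)⁻¹)).withDensity f = μ := by
    intro μ
    have := withDensity_inv_same (μ := μ) hfm.inv
      (Eventually.of_forall fun y => ENNReal.inv_ne_zero.2 (hft y))
      (Eventually.of_forall fun y => ENNReal.inv_ne_top.2 (hf0 y))
    simp only [Pi.inv_apply, inv_inv] at this
    exact this
  -- Multiplication by a density is monotone, and here it is invertible. So it passes through the
  -- supremum that defines the measure: `f` gives one inequality and its inverse the other.
  refine le_antisymm (iSup_le fun x => ?_) ?_
  · rw [h1 x]
    exact hmono f (le_iSup (chartMeasure σ) x)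
  · rw [← h3 (riemannianMeasure σ')]
    refine hmono f (iSup_le fun x => ?_)
    rw [← h2 (chartMeasure σ x), ← h1 x]
    exact hmono _ (le_iSup (chartMeasure σ') x)

/-- The integral of a function supported in the domain of a chart. -/
theorem integral_riemannianMeasure_of_support (hσ : SmoothMetric σ)
    (hpos : ∀ y (w : Euc 2), w ≠ 0 → 0 < met σ y w w) {x : S} {k : S → ℝ} (hk : Measurable k)
    (hk0 : ∀ y, y ∉ src 2 x → k y = 0) :
    ∫ y, k y ∂riemannianMeasure σ = ∫ u in (ch 2 x).target,
      volDensity σ x ((ch 2 x).symm u) * k ((ch 2 x).symm u) := by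
  rw [← setIntegral_eq_integral_of_forall_compl_eq_zero hk0, riemannianMeasure_restrict,
    integral_chartMeasure hσ hpos x hk]

end SurfaceMeasure

/-! ## The divergence theorem on a closed surface -/

section Piola

variable {S : Type*} [TopologicalSpace S] [ChartedSpace (EuclideanSpace ℝ (Fin 2)) S]
  [IsManifold (𝓡 2) ∞ S] [MeasurableSpace S] [BorelSpace S] {σ : MetricField 2 S} {V : S → Euc 2}

/-- The component of a vector field in the chart at `x`. -/
def vc (V : S → Euc 2) (x q : S) (i : Fin 2) : ℝ := tcc 2 q x q (V q) i

/-- The components of the vector density `√(det σ) V` in the chart at `x`. -/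
def vdens (σ : MetricField 2 S) (V : S → Euc 2) (x : S) (i : Fin 2) (q : S) : ℝ :=
  volDensity σ x q * vc V x q i

/-- A vector field with smooth components. -/
def SmoothField (V : S → Euc 2) : Prop :=
  ∀ x, ∀ y ∈ src 2 x, ∀ i, SmAt 2 (fun q => vc V x q i) y

theorem field_eq_sum {x y : S} (hy : y ∈ src 2 x) (V : S → Euc 2) :
    V y = ∑ i, vc V x y i • cv 2 x y i := by
  rw [← tcc_tcc_self (mem_chart_source _ y) hy (V y), euc_eq_sum (tcc 2 y x y (V y)), map_sum]
  refine Finset.sum_congr rfl fun i _ => ?_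
  rw [map_smul]; rfl

theorem smAt_vdens (hσ : SmoothMetric σ)
    (hpos : ∀ y (w : Euc 2), w ≠ 0 → 0 < met σ y w w) (hV : SmoothField V) {x y : S}
    (hy : y ∈ src 2 x) (i : Fin 2) : SmAt 2 (vdens σ V x i) y :=
  (smAt_volDensity hσ hpos hy).mul (hV x y hy i)

/-- The partial derivatives of the Jacobian matrix are symmetric. -/
theorem dd_jac_symm {x y : S} (hy : y ∈ src 2 x) (k i j : Fin 2) :
    dd 2 (fun q => jac 2 x y q k i) y (cv 2 x y j)
      = dd 2 (fun q => jac 2 x y q k j) y (cv 2 x y i) := by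
  have hs := mem_chart_source (EuclideanSpace ℝ (Fin 2)) y
  have h0 := contDiffAt_in_chart hy (smAt_chart hs)
  have h1 : ContDiffAt ℝ ∞ (fderiv ℝ (extChartAt (𝓡 2) y ∘ (extChartAt (𝓡 2) x).symm))
      (extChartAt (𝓡 2) x y) := h0.fderiv_right (by simp)
  have key : ∀ i j, dd 2 (fun q => jac 2 x y q k i) y (cv 2 x y j)
      = fderiv ℝ (fderiv ℝ (extChartAt (𝓡 2) y ∘ (extChartAt (𝓡 2) x).symm))
        (extChartAt (𝓡 2) x y) (bas 2 j) (bas 2 i) k := by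
    intro i j
    have hd : DfAt 2 (fun q => jac 2 x y q k i) y := by
      have h2 : SmAt 2 (fun q => tcc 2 x y q (bas 2 i)) y :=
        (smAt_tcc hy hs).clm_apply contMDiffAt_const
      exact (dd_clm_comp (EuclideanSpace.proj k : Euc 2 →L[ℝ] ℝ) h2.dfAt).1
    rw [cv, dd_cvec hy hd]
    have e : ((fun q => jac 2 x y q k i) ∘ (extChartAt (𝓡 2) x).symm)
        =ᶠ[𝓝 (extChartAt (𝓡 2) x y)] fun u => (EuclideanSpace.proj k : Euc 2 →L[ℝ] ℝ)
          (fderiv ℝ (extChartAt (𝓡 2) y ∘ (extChartAt (𝓡 2) x).symm) u (bas 2 i)) := by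
      have hc : ContinuousAt (extChartAt (𝓡 2) x).symm (extChartAt (𝓡 2) x y) :=
        (contMDiffAt_chart_symm hy).continuousAt
      have e1 := hc.eventually (p := fun q => q ∈ src 2 x ∧ q ∈ src 2 y) (by
        rw [symm_chart hy]; exact (source_mem_nhds hy).and (source_mem_nhds hs))
      filter_upwards [e1, (isOpen_extChartAt_target x).mem_nhds
        ((extChartAt (𝓡 2) x).map_source (mem_source_iff.2 hy))] with u h1 h2
      have h3 := hasFDerivAt_transition h1.1 h1.2
      rw [(extChartAt (𝓡 2) x).right_inv h2] at h3
      rw [h3.fderiv]; rfl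
    have hdu := h1.differentiableAt (by simp)
    have h4 : HasFDerivAt (fun u => (EuclideanSpace.proj k : Euc 2 →L[ℝ] ℝ)
          (fderiv ℝ (extChartAt (𝓡 2) y ∘ (extChartAt (𝓡 2) x).symm) u (bas 2 i))) _
          (extChartAt (𝓡 2) x y) :=
      ((EuclideanSpace.proj k : Euc 2 →L[ℝ] ℝ).hasFDerivAt).comp _
        (hdu.hasFDerivAt.clm_apply (hasFDerivAt_const (bas 2 i) _))
    rw [e.fderiv_eq, h4.fderiv]
    simp
  rw [key, key]
  exact congrArg (fun v : Euc 2 => v k) ((h0.isSymmSndFDerivAt (by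
    rw [minSmoothness_of_isRCLikeNormedField]; exact WithTop.coe_le_coe.2 le_top)) _ _)

/-- Cramer's rule for the change of components. With the determinant kept on the left, only
polynomial expressions in the Jacobian entries have to be differentiated. -/
theorem vc_change {x y q : S} (hx : q ∈ src 2 x) (hy : q ∈ src 2 y) :
    (jac 2 x y q).det * vc V x q 0
        = jac 2 x y q 1 1 * vc V y q 0 - jac 2 x y q 0 1 * vc V y q 1 ∧
    (jac 2 x y q).det * vc V x q 1
        = jac 2 x y q 0 0 * vc V y q 1 - jac 2 x y q 1 0 * vc V y q 0 := by
  have h : ∀ k, vc V y q k = ∑ i, jac 2 x y q k i * vc V x q i := by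
    intro k
    have h1 := tcc_apply x y q (tcc 2 q x q (V q)) k
    rwa [tcc_tcc (mem_chart_source _ q) hx hy] at h1
  rw [Matrix.det_fin_two, h 0, h 1, Fin.sum_univ_two, Fin.sum_univ_two]
  constructor <;> ring

/-- The vanishing of the divergence does not depend on the chart. -/
theorem sum_dd_vdens (hσ : SmoothMetric σ)
    (hpos : ∀ y (w : Euc 2), w ≠ 0 → 0 < met σ y w w) (hV : SmoothField V)
    (hdiv : ∀ y, divergence σ V y = 0) {x y : S} (hy : y ∈ src 2 x) :
    ∑ i, dd 2 (vdens σ V x i) y (cv 2 x y i) = 0 := by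
  have hs := mem_chart_source (EuclideanSpace ℝ (Fin 2)) y
  have h0 : dd 2 (vdens σ V y 0) y (bas 2 0) + dd 2 (vdens σ V y 1) y (bas 2 1) = 0 := by
    have h1 : (volDensity σ y y)⁻¹ * ∑ i, dd 2 (vdens σ V y i) y (bas 2 i) = 0 := hdiv y
    have h2 : volDensity σ y y ≠ 0 := by
      rw [volDensity_eq]; exact (Real.sqrt_pos.2 (det_gramAt_pos hσ (hpos y) hs)).ne'
    rw [← Fin.sum_univ_two (f := fun i => dd 2 (vdens σ V y i) y (bas 2 i))]
    exact (mul_eq_zero.1 h1).resolve_left (inv_ne_zero h2)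
  have hB : ∀ k i, DfAt 2 (fun q => jac 2 x y q k i) y := by
    intro k i
    have h2 : SmAt 2 (fun q => tcc 2 x y q (bas 2 i)) y :=
      (smAt_tcc hy hs).clm_apply contMDiffAt_const
    exact (dd_clm_comp (EuclideanSpace.proj k : Euc 2 →L[ℝ] ℝ) h2.dfAt).1
  have hP : ∀ i, DfAt 2 (vdens σ V y i) y := fun i => (smAt_vdens hσ hpos hV hs i).dfAt
  have hdet0 : (jac 2 x y y).det ≠ 0 := by
    have := congrArg Matrix.det (jac_mul_jac hy hs)
    rw [Matrix.det_mul, Matrix.det_one] at this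
    exact right_ne_zero_of_mul_eq_one this
  have hcont : ContinuousAt (fun q => (jac 2 x y q).det) y := by
    simp only [Matrix.det_fin_two]
    exact (((hB 0 0).continuousAt.mul (hB 1 1).continuousAt).sub
      ((hB 0 1).continuousAt.mul (hB 1 0).continuousAt))
  -- The sign of the Jacobian determinant is locally constant, so its absolute value may be
  -- differentiated as `s` times the determinant.
  obtain ⟨s, hsgn⟩ : ∃ s : ℝ, ∀ᶠ q in 𝓝 y, |(jac 2 x y q).det| = s * (jac 2 x y q).det := by
    rcases hdet0.lt_or_gt with h | h
    · refine ⟨-1, ?_⟩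
      filter_upwards [hcont.eventually (gt_mem_nhds h)] with q hq
      rw [abs_of_neg hq]; ring
    · refine ⟨1, ?_⟩
      filter_upwards [hcont.eventually (lt_mem_nhds h)] with q hq
      rw [abs_of_pos hq]; ring
  have e0 : vdens σ V x 0 =ᶠ[𝓝 y] fun q =>
      s * (jac 2 x y q 1 1 * vdens σ V y 0 q - jac 2 x y q 0 1 * vdens σ V y 1 q) := by
    filter_upwards [hsgn, source_mem_nhds hy, source_mem_nhds hs] with q h1 h2 h3
    have := (vc_change (V := V) h2 h3).1
    simp only [vdens]
    rw [volDensity_change σ h2 h3, h1]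
    linear_combination s * volDensity σ y q * this
  have e1 : vdens σ V x 1 =ᶠ[𝓝 y] fun q =>
      s * (jac 2 x y q 0 0 * vdens σ V y 1 q - jac 2 x y q 1 0 * vdens σ V y 0 q) := by
    filter_upwards [hsgn, source_mem_nhds hy, source_mem_nhds hs] with q h1 h2 h3
    have := (vc_change (V := V) h2 h3).2
    simp only [vdens]
    rw [volDensity_change σ h2 h3, h1]
    linear_combination s * volDensity σ y q * this
  have m := fun k i j => dd_mul (hB k i) (hP j)
  have n0 := dd_sub (m 1 1 0).1 (m 0 1 1).1
  have n1 := dd_sub (m 0 0 1).1 (m 1 0 0).1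
  have r0 := dd_real_comp n0.1 (φ := fun t => s * t) ((hasDerivAt_id _).const_mul s)
  have r1 := dd_real_comp n1.1 (φ := fun t => s * t) ((hasDerivAt_id _).const_mul s)
  rw [Fin.sum_univ_two, dd_congr e0, dd_congr e1, r0.2, r1.2, n0.2, n1.2]
  simp only [sub_apply, (m _ _ _).2, mul_one]
  have c : ∀ i, cv 2 x y i = jac 2 x y y 0 i • bas 2 0 + jac 2 x y y 1 i • bas 2 1 := by
    intro i; rw [cv, tcc_bas, Fin.sum_univ_two]
  have s0 := dd_jac_symm hy 0 0 1
  have s1 := dd_jac_symm hy 1 0 1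
  have lin : ∀ (L : Euc 2 →L[ℝ] ℝ) i, L (cv 2 x y i)
      = jac 2 x y y 0 i * L (bas 2 0) + jac 2 x y y 1 i * L (bas 2 1) := by
    intro L i; rw [c i]; simp
  rw [lin (dd 2 (vdens σ V y 0) y), lin (dd 2 (vdens σ V y 1) y), lin (dd 2 (vdens σ V y 0) y),
    lin (dd 2 (vdens σ V y 1) y)]
  -- This is the Piola identity: the derivatives of the cofactors cancel by the symmetries `s0` and
  -- `s1`, and the divergence of the density changes only by the factor `s` times the determinant.
  linear_combination s * (jac 2 x y y 0 0 * jac 2 x y y 1 1 - jac 2 x y y 0 1 * jac 2 x y y 1 0) * h0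
    + s * vdens σ V y 1 y * s0 - s * vdens σ V y 0 y * s1

theorem smAt_dd_field {f : S → ℝ} {y : S} (hf : SmAt 2 f y) (hV : SmoothField V) :
    SmAt 2 (fun q => dd 2 f q (V q)) y := by
  have hs := mem_chart_source (EuclideanSpace ℝ (Fin 2)) y
  have h : SmAt 2 (fun q => ∑ i, vc V y q i * dd 2 f q (cv 2 y q i)) y :=
    contMDiffAt_finsetSum fun i _ => (hV y y hs i).mul (smAt_dd_cvec hs hf _)
  refine h.congr_of_eventuallyEq ?_
  filter_upwards [source_mem_nhds hs] with q hq
  conv_lhs => rw [field_eq_sum hq V]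
  simp

end Piola

section Divergence

variable {S : Type*} [TopologicalSpace S] [ChartedSpace (EuclideanSpace ℝ (Fin 2)) S]
  [IsManifold (𝓡 2) ∞ S] [MeasurableSpace S] [BorelSpace S] {σ : MetricField 2 S} {V : S → Euc 2}

/-- A function with compact support in the domain of a chart has integrals of partial derivatives
equal to zero. -/
theorem integral_fderiv_chart {x : S} {k : S → ℝ} {K : Set S} (hK : IsCompact K)
    (hKx : K ⊆ src 2 x) (hk0 : ∀ y, y ∉ K → k y = 0) (hk : ∀ y ∈ src 2 x, SmAt 2 k y) (a : Euc 2) :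
    IntegrableOn (fun u => fderiv ℝ (k ∘ (ch 2 x).symm) u a) (ch 2 x).target volume ∧
    ∫ u in (ch 2 x).target, fderiv ℝ (k ∘ (ch 2 x).symm) u a = 0 := by
  -- Extension by zero to the whole plane is smooth, since the support is a compact subset of the
  -- chart target.
  set G : Euc 2 → ℝ := (ch 2 x).target.indicator (k ∘ (ch 2 x).symm) with hG
  have hcont : ContinuousOn (ch 2 x) K := (continuousOn_extChartAt x).mono fun y hy => by
    rw [extChartAt_source]; exact hKx hy
  have hK' : IsCompact ((ch 2 x) '' K) := hK.image_of_continuousOn hcont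
  have hG0 : ∀ u, u ∉ (ch 2 x) '' K → G u = 0 := by
    intro u hu
    by_cases ht : u ∈ (ch 2 x).target
    · rw [hG, Set.indicator_of_mem ht]
      refine hk0 _ fun h => hu ⟨_, h, (ch 2 x).right_inv ht⟩
    · rw [hG, Set.indicator_of_notMem ht]
  have hev : ∀ u ∈ (ch 2 x).target, G =ᶠ[𝓝 u] k ∘ (ch 2 x).symm := by
    intro u hu
    filter_upwards [(isOpen_extChartAt_target x).mem_nhds hu] with w hw
    rw [hG, Set.indicator_of_mem hw]
  have hsm : ContDiff ℝ ∞ G := by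
    rw [contDiff_iff_contDiffAt]
    intro u
    by_cases ht : u ∈ (ch 2 x).target
    · have hy : (ch 2 x).symm u ∈ src 2 x := mem_source_iff.1 ((ch 2 x).map_target ht)
      have := contDiffAt_in_chart hy (hk _ hy)
      rw [(ch 2 x).right_inv ht] at this
      exact this.congr_of_eventuallyEq (hev u ht)
    · have hu : u ∉ (ch 2 x) '' K := by
        rintro ⟨y, hy, rfl⟩
        exact ht ((ch 2 x).map_source (mem_source_iff.2 (hKx hy)))
      refine (contDiffAt_const (c := (0 : ℝ))).congr_of_eventuallyEq ?_
      filter_upwards [hK'.isClosed.isOpen_compl.mem_nhds hu] with w hw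
      exact hG0 w hw
  have hcs : HasCompactSupport G := HasCompactSupport.intro hK' hG0
  have hd : Continuous fun u => fderiv ℝ G u a :=
    (hsm.continuous_fderiv (by simp)).clm_apply continuous_const
  have hcd : HasCompactSupport fun u => fderiv ℝ G u a := hcs.fderiv_apply ℝ a
  have hint : Integrable (fun u => fderiv ℝ G u a) := hd.integrable_of_hasCompactSupport hcd
  have hzero : ∫ u, fderiv ℝ G u a = 0 := by
    -- Integration by parts against the constant 1.
    have := integral_mul_fderiv_eq_neg_fderiv_mul_of_integrable (μ := (volume : Measure (Euc 2)))
      (f := fun _ => (1 : ℝ)) (g := G) (v := a) (by simp) (by simpa using hint)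
      (by simpa using hsm.continuous.integrable_of_hasCompactSupport hcs) (by simp)
      fun u _ => hsm.contDiffAt.differentiableAt (by simp)
    simpa using this
  have hon : Set.EqOn (fun u => fderiv ℝ G u a) (fun u => fderiv ℝ (k ∘ (ch 2 x).symm) u a)
      (ch 2 x).target := fun u hu => by
    simp only [(hev u hu).fderiv_eq]
  have hmt := measurableSet_target (n := 2) x
  refine ⟨hint.integrableOn.congr_fun hon hmt, ?_⟩
  rw [← setIntegral_congr_fun hmt hon, ← hzero]
  refine setIntegral_eq_integral_of_forall_compl_eq_zero fun u hu => ?_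
  have hu' : u ∉ (ch 2 x) '' K := by
    rintro ⟨y, hy, rfl⟩
    exact hu ((ch 2 x).map_source (mem_source_iff.2 (hKx hy)))
  have : G =ᶠ[𝓝 u] fun _ => (0 : ℝ) := by
    filter_upwards [hK'.isClosed.isOpen_compl.mem_nhds hu'] with w hw
    exact hG0 w hw
  rw [this.fderiv_eq]; simp

/-- In the chart, √σ df(V) = ∂ᵢ(f √σ Vⁱ) − f ∂ᵢ(√σ Vⁱ). The last term vanishes because V is
divergence free, and the others are partial derivatives of functions with compact support. -/
theorem integral_dd_of_subset [T2Space S] [CompactSpace S] (hσ : SmoothMetric σ)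
    (hpos : ∀ y (w : Euc 2), w ≠ 0 → 0 < met σ y w w) (hV : SmoothField V)
    (hdiv : ∀ y, divergence σ V y = 0) {f : S → ℝ} (hf : ∀ y, SmAt 2 f y) {x : S}
    (hfx : tsupport f ⊆ src 2 x) :
    ∫ y, dd 2 f y (V y) ∂riemannianMeasure σ = 0 := by
  have hcont : Continuous fun y => dd 2 f y (V y) :=
    continuous_iff_continuousAt.2 fun y => (smAt_dd_field (hf y) hV).continuousAt
  have hoff : ∀ y, y ∉ tsupport f → f =ᶠ[𝓝 y] fun _ => 0 := fun y hy => by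
    filter_upwards [(isClosed_tsupport f).isOpen_compl.mem_nhds hy] with q hq
    exact image_eq_zero_of_notMem_tsupport hq
  rw [integral_riemannianMeasure_of_support hσ hpos hcont.measurable (x := x) fun y hy => by
    rw [dd_congr (hoff y fun h => hy (hfx h)), dd_const]; rfl]
  have hA := fun i => integral_fderiv_chart (x := x) (k := fun q => f q * vdens σ V x i q)
    (isClosed_tsupport f).isCompact hfx
    (fun y hy => by rw [image_eq_zero_of_notMem_tsupport hy, zero_mul])
    (fun y hy => (hf y).mul (smAt_vdens hσ hpos hV hy i)) (bas 2 i)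
  have e : ∫ u in (ch 2 x).target, volDensity σ x ((ch 2 x).symm u) *
      dd 2 f ((ch 2 x).symm u) (V ((ch 2 x).symm u)) = ∫ u in (ch 2 x).target,
        ∑ i, fderiv ℝ ((fun q => f q * vdens σ V x i q) ∘ (ch 2 x).symm) u (bas 2 i) := by
    refine setIntegral_congr_fun (measurableSet_target (n := 2) x) fun u hu => ?_
    have hy : (ch 2 x).symm u ∈ src 2 x := mem_source_iff.1 ((ch 2 x).map_target hu)
    set y := (ch 2 x).symm u with hyu
    have hux : ch 2 x y = u := (ch 2 x).right_inv hu
    have hm := fun i => dd_mul (hf y).dfAt (smAt_vdens hσ hpos hV hy i).dfAt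
    have h1 : ∀ i, fderiv ℝ ((fun q => f q * vdens σ V x i q) ∘ (ch 2 x).symm) u (bas 2 i)
        = dd 2 f y (cv 2 x y i) * vdens σ V x i y + f y * dd 2 (vdens σ V x i) y (cv 2 x y i) := by
      intro i
      rw [← (hm i).2, cv, dd_cvec hy (hm i).1, hux]
    simp only [h1, Finset.sum_add_distrib, ← Finset.mul_sum, sum_dd_vdens hσ hpos hV hdiv hy,
      mul_zero, add_zero]
    conv_lhs => rw [field_eq_sum hy V]
    simp only [map_sum, map_smul, smul_eq_mul, Finset.mul_sum, vdens]
    exact Finset.sum_congr rfl fun i _ => by ring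
  rw [e, integral_finsetSum _ fun i _ => (hA i).1]
  exact Finset.sum_eq_zero fun i _ => (hA i).2

/-- The divergence theorem: the gradient of a function is orthogonal to divergence-free vector
fields. -/
theorem integral_dd_eq_zero [T2Space S] [CompactSpace S] (hσ : SmoothMetric σ)
    (hpos : ∀ y (w : Euc 2), w ≠ 0 → 0 < met σ y w w) (hV : SmoothField V)
    (hdiv : ∀ y, divergence σ V y = 0) {f : S → ℝ} (hf : ∀ y, SmAt 2 f y) :
    ∫ y, dd 2 f y (V y) ∂riemannianMeasure σ = 0 := by
  have := isFiniteMeasure_riemannianMeasure hσ hpos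
  obtain ⟨ρ, hρ⟩ := SmoothPartitionOfUnity.exists_isSubordinate_chartAt_source (𝓡 2) S
  have hρs : ∀ i y, SmAt 2 (ρ i) y := fun i y => (ρ i).contMDiff.contMDiffAt
  -- By compactness only finitely many members of the partition are nonzero, so `f` is a finite sum
  -- of functions, each supported in one chart.
  have hfin : {i | (Function.support (ρ i)).Nonempty}.Finite :=
    ρ.locallyFinite.finite_nonempty_of_compact
  set s := hfin.toFinset with hs
  have hsum : ∀ y, ∑ i ∈ s, ρ i y = 1 := by
    intro y
    rw [← ρ.sum_eq_one (Set.mem_univ y)]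
    refine (finsum_eq_sum_of_support_subset _ fun i hi => ?_).symm
    simp only [hs, Set.Finite.coe_toFinset, Set.mem_ofPred_eq]
    exact ⟨y, hi⟩
  have hprod : ∀ i y, SmAt 2 (fun q => ρ i q * f q) y := fun i y => (hρs i y).mul (hf y)
  have hdd : ∀ y, dd 2 f y (V y) = ∑ i ∈ s, dd 2 (fun q => ρ i q * f q) y (V y) := by
    intro y
    have h1 : ∀ t : Finset S, DfAt 2 (fun q => ∑ i ∈ t, ρ i q * f q) y ∧
        dd 2 (fun q => ∑ i ∈ t, ρ i q * f q) y (V y)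
          = ∑ i ∈ t, dd 2 (fun q => ρ i q * f q) y (V y) := by
      classical
      intro t
      induction t using Finset.induction_on with
      | empty => simpa using ⟨mdifferentiableAt_const, by rw [dd_const]; rfl⟩
      | insert a t ha ih =>
        have h2 := dd_add (hprod a y).dfAt ih.1
        simp only [Finset.sum_insert ha]
        refine ⟨h2.1, ?_⟩
        rw [h2.2, add_apply, ih.2]
    rw [← (h1 s).2]
    congr 2
    ext q
    rw [← Finset.sum_mul, hsum, one_mul]
  simp only [hdd]
  rw [integral_finsetSum]
  · refine Finset.sum_eq_zero fun i _ => integral_dd_of_subset hσ hpos hV hdiv (hprod i) (x := i) ?_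
    exact (closure_mono (Function.support_mul_subset_left _ _)).trans (hρ i)
  · intro i _
    have hc : Continuous fun y => dd 2 (fun q => ρ i q * f q) y (V y) :=
      continuous_iff_continuousAt.2 fun y => (smAt_dd_field (hprod i y) hV).continuousAt
    exact hc.integrable_of_hasCompactSupport (HasCompactSupport.of_compactSpace _)

end Divergence

/-! ## Smooth one-forms -/

section Forms

variable {S : Type*} [TopologicalSpace S] [ChartedSpace (EuclideanSpace ℝ (Fin 2)) S]
  [IsManifold (𝓡 2) ∞ S] [MeasurableSpace S] [BorelSpace S] {σ : MetricField 2 S}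

/-- A one-form with smooth components. -/
def SmoothForm (β : S → Euc 2 →ₗ[ℝ] ℝ) : Prop :=
  ∀ x, ∀ y ∈ src 2 x, ∀ i, SmAt 2 (fun q => β q (cv 2 x q i)) y

/-- The differential of a function, as a one-form. -/
def dform (f : S → ℝ) (q : S) : Euc 2 →ₗ[ℝ] ℝ := (dd 2 f q).toLinearMap

theorem smoothForm_dform {f : S → ℝ} (hf : ∀ q, SmAt 2 f q) : SmoothForm (dform f) :=
  fun _ y hy i => smAt_dd_cvec hy (hf y) (bas 2 i)

theorem SmoothForm.add {β γ : S → Euc 2 →ₗ[ℝ] ℝ} (hβ : SmoothForm β) (hγ : SmoothForm γ) :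
    SmoothForm fun q => β q + γ q := fun x y hy i => (hβ x y hy i).add (hγ x y hy i)

theorem SmoothForm.sub {β γ : S → Euc 2 →ₗ[ℝ] ℝ} (hβ : SmoothForm β) (hγ : SmoothForm γ) :
    SmoothForm fun q => β q - γ q := fun x y hy i => (hβ x y hy i).sub (hγ x y hy i)

theorem SmoothForm.smul {f : S → ℝ} {β : S → Euc 2 →ₗ[ℝ] ℝ} (hf : ∀ q, SmAt 2 f q)
    (hβ : SmoothForm β) : SmoothForm fun q => f q • β q :=
  fun x y hy i => (hf y).mul (hβ x y hy i)

theorem SmoothForm.smAt_apply {β : S → Euc 2 →ₗ[ℝ] ℝ} (hβ : SmoothForm β) {V : S → Euc 2}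
    (hV : SmoothField V) (y : S) : SmAt 2 (fun q => β q (V q)) y := by
  have hs := mem_chart_source (EuclideanSpace ℝ (Fin 2)) y
  have h : SmAt 2 (fun q => ∑ i, vc V y q i * β q (cv 2 y q i)) y :=
    contMDiffAt_finsetSum fun i _ => (hV y y hs i).mul (hβ y y hs i)
  refine h.congr_of_eventuallyEq ?_
  filter_upwards [source_mem_nhds hs] with q hq
  conv_lhs => rw [field_eq_sum hq V]
  simp

theorem SmoothForm.smoothField_shp {β : S → Euc 2 →ₗ[ℝ] ℝ} (hσ : SmoothMetric σ)
    (hβ : SmoothForm β) : SmoothField fun q => shp σ q (β q) := by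
  intro x y hy i
  have h : SmAt 2 (fun q => ∑ j, (gramAt σ x q)⁻¹ i j * β q (cv 2 x q j)) y :=
    contMDiffAt_finsetSum fun j _ => (smAt_inv_gramAt hσ hy i j).mul (hβ x y hy j)
  refine h.congr_of_eventuallyEq ?_
  filter_upwards [source_mem_nhds hy] with q hq
  exact tcc_sharp hσ hq (β q) i

theorem smoothField_gr (hσ : SmoothMetric σ) {f : S → ℝ} (hf : ∀ q, SmAt 2 f q) :
    SmoothField (gr σ f) := (smoothForm_dform hf).smoothField_shp hσ

variable {M : Type*} [TopologicalSpace M] [ChartedSpace (EuclideanSpace ℝ (Fin 4)) M]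
  [IsManifold (𝓡 4) ∞ M] {g : MetricField 4 M} {F : S → M}

/-- The connection form `⟨∇ a, b⟩`. -/
def cform (hg : SmoothMetric g) (F : S → M) (a b : S → Euc 4) (q : S) : Euc 2 →ₗ[ℝ] ℝ :=
  IsLinearMap.mk' _ (conn_linear (F := F) (V := a) (p := q) hg (b q))

theorem smoothForm_cform (hg : SmoothMetric g) (hF : ∀ q, ContMDiffAt (𝓡 2) (𝓡 4) ∞ F q)
    {a b : S → Euc 4} (ha : ∀ q, AlongAt 2 F a q) (hb : ∀ q, AlongAt 2 F b q) :
    SmoothForm (cform hg F a b) :=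
  fun _ y hy i => AlongAt.smAt_conn hg hF (ha y) (hb y) hy (bas 2 i)

end Forms

/-! ## Lorentzian linear algebra -/

/-- Cauchy–Schwarz for the spatial parts, whose squared lengths are a₀² − 1 and b₀² − 1, shows that
the spatial product is smaller than a₀b₀. -/
theorem eta_neg_of_future {a b : Euc 4} (ha : eta a a = -1) (hb : eta b b = -1) (ha0 : 0 < a 0)
    (hb0 : 0 < b 0) : eta a b < 0 := by
  rw [eta_apply] at *
  have h1 : (a 1 * b 1 + a 2 * b 2 + a 3 * b 3) ^ 2
      ≤ (a 1 ^ 2 + a 2 ^ 2 + a 3 ^ 2) * (b 1 ^ 2 + b 2 ^ 2 + b 3 ^ 2) := by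
    nlinarith [sq_nonneg (a 1 * b 2 - a 2 * b 1), sq_nonneg (a 1 * b 3 - a 3 * b 1),
      sq_nonneg (a 2 * b 3 - a 3 * b 2)]
  have h2 : (a 1 * b 1 + a 2 * b 2 + a 3 * b 3) ^ 2 < (a 0 * b 0) ^ 2 := by
    refine h1.trans_lt ?_
    have e1 : a 1 ^ 2 + a 2 ^ 2 + a 3 ^ 2 = a 0 ^ 2 - 1 := by linarith
    have e2 : b 1 ^ 2 + b 2 ^ 2 + b 3 ^ 2 = b 0 ^ 2 - 1 := by linarith
    rw [e1, e2]
    nlinarith [sq_nonneg (a 1), sq_nonneg (a 2), sq_nonneg (a 3), sq_nonneg (b 1),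
      sq_nonneg (b 2), sq_nonneg (b 3)]
  have := abs_lt_of_sq_lt_sq h2 (mul_pos ha0 hb0).le
  linarith [(abs_lt.1 this).2]

/-- A nonpositive quadratic form has nonpositive trace with respect to a positive one. -/
theorem trace_nonpos {a b c h k l : ℝ} (ha : 0 < a) (hd : 0 < a * c - b * b)
    (hq : ∀ x y : ℝ, x * x * h + 2 * x * y * k + y * y * l ≤ 0) :
    (a * c - b * b)⁻¹ * (c * h - 2 * b * k + a * l) ≤ 0 := by
  refine mul_nonpos_of_nonneg_of_nonpos (inv_nonneg.2 hd.le) ?_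
  have h1 := hq 1 0
  -- For the positive form, (b, −a) is orthogonal to (1, 0); testing on this orthogonal pair is
  -- enough to control the trace.
  have h2 := hq b (-a)
  refine nonpos_of_mul_nonpos_right (a := a) ?_ ha
  have : a * (c * h - 2 * b * k + a * l)
      = (a * c - b * b) * h + (b * b * h + 2 * b * (-a) * k + -a * -a * l) := by ring
  rw [this]
  have : (a * c - b * b) * h ≤ 0 := mul_nonpos_of_nonneg_of_nonpos hd.le (by linarith)
  linarith

/-- The second derivative is nonpositive at a maximum. -/
theorem deriv_deriv_nonpos_of_isLocalMax {f : ℝ → ℝ} {a : ℝ} (hm : IsLocalMax f a)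
    (hc : ContinuousAt f a) : deriv (deriv f) a ≤ 0 := by
  by_contra! h
  -- A positive second derivative would make the maximum a minimum as well, so `f` would be locally
  -- constant and its second derivative zero.
  have hmin := isLocalMin_of_deriv_deriv_pos h hm.deriv_eq_zero hc
  have he : f =ᶠ[𝓝 a] fun _ => f a := by
    filter_upwards [hm, hmin] with x h1 h2
    exact le_antisymm h1 h2
  have h2 : deriv f =ᶠ[𝓝 a] fun _ => 0 := by
    filter_upwards [he.deriv] with x hx
    rw [hx, deriv_const]
  rw [h2.deriv_eq, deriv_const] at h
  exact lt_irrefl _ h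

/-! ### First and second derivative tests on a surface -/

section Maximum

variable {S : Type*} [TopologicalSpace S] [ChartedSpace (EuclideanSpace ℝ (Fin 2)) S]
  [IsManifold (𝓡 2) ∞ S]

/-- Restriction to the line t ↦ u + t a reduces this to one variable. -/
theorem fderiv_fderiv_nonpos_of_isLocalMax {E : Type*} [NormedAddCommGroup E] [NormedSpace ℝ E]
    {f : E → ℝ} {u : E} (hm : IsLocalMax f u) (hf : ContDiffAt ℝ ∞ f u) (a : E) :
    fderiv ℝ (fderiv ℝ f) u a a ≤ 0 := by
  have hl : ∀ t : ℝ, HasDerivAt (fun t : ℝ => u + t • a) a t := fun t => by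
    simpa using ((hasDerivAt_id t).smul_const a).const_add u
  have h0 : u + (0 : ℝ) • a = u := by simp
  have hl0 : Tendsto (fun t : ℝ => u + t • a) (𝓝 0) (𝓝 u) := by
    have := (hl 0).continuousAt.tendsto
    rwa [h0] at this
  have hdf : ∀ᶠ w in 𝓝 u, DifferentiableAt ℝ f w := by
    have h1 : ContDiffAt ℝ 1 f u := hf.of_le (by simp)
    filter_upwards [h1.eventually (by simp)] with w hw
    exact hw.differentiableAt (by simp)
  have hm' : IsLocalMax (fun t : ℝ => f (u + t • a)) 0 := by
    filter_upwards [hl0.eventually hm] with t ht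
    rw [h0]; exact ht
  have hd1 : deriv (fun t : ℝ => f (u + t • a)) =ᶠ[𝓝 0] fun t => fderiv ℝ f (u + t • a) a := by
    filter_upwards [hl0.eventually hdf] with t ht
    exact (ht.hasFDerivAt.comp_hasDerivAt t (hl t)).deriv
  have h1 : HasFDerivAt (fderiv ℝ f) (fderiv ℝ (fderiv ℝ f) u) u :=
    ((hf.fderiv_right (m := ∞) (by simp)).differentiableAt (by simp)).hasFDerivAt
  have h2 : HasFDerivAt (fun w => fderiv ℝ f w a)
      ((ContinuousLinearMap.apply ℝ ℝ a).comp (fderiv ℝ (fderiv ℝ f) u)) u :=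
    (ContinuousLinearMap.apply ℝ ℝ a).hasFDerivAt.comp u h1
  have hd2 : HasDerivAt (fun t : ℝ => fderiv ℝ f (u + t • a) a)
      (fderiv ℝ (fderiv ℝ f) u a a) 0 := h2.comp_hasDerivAt_of_eq 0 (hl 0) h0.symm
  have hc : ContinuousAt (fun t : ℝ => f (u + t • a)) 0 := by
    change Tendsto _ _ (𝓝 (f (u + (0 : ℝ) • a)))
    rw [h0]
    exact hf.continuousAt.tendsto.comp hl0
  have h3 := deriv_deriv_nonpos_of_isLocalMax hm' hc
  rwa [hd1.deriv_eq, hd2.deriv] at h3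

theorem dd_eq_zero_of_isMax {f : S → ℝ} {p : S} (hf : SmAt 2 f p) (hm : ∀ q, f q ≤ f p)
    (w : Euc 2) : dd 2 f p w = 0 := by
  have h1 : IsLocalMax (f ∘ (ch 2 p).symm) (ch 2 p p) := Eventually.of_forall fun u => by
    simp only [Function.comp_apply]
    rw [symm_chart (mem_chart_source _ p)]
    exact hm _
  rw [← hf.dfAt.hasFDerivAt.fderiv, h1.fderiv_eq_zero]; rfl

theorem hessian_nonpos_of_isMax {f : S → ℝ} {p : S} (hf : SmAt 2 f p) (hm : ∀ q, f q ≤ f p)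
    (a : Euc 2) : dd 2 (fun q => dd 2 f q (tcc 2 p q q a)) p a ≤ 0 := by
  have hp := mem_chart_source (EuclideanSpace ℝ (Fin 2)) p
  have h0 := contDiffAt_in_chart hp hf
  have h1 : IsLocalMax (f ∘ (ch 2 p).symm) (ch 2 p p) := Eventually.of_forall fun u => by
    simp only [Function.comp_apply]
    rw [symm_chart hp]
    exact hm _
  rw [dd_dd_eq hf]
  exact fderiv_fderiv_nonpos_of_isLocalMax h1 h0 a

end Maximum

/-! ## The reference surface -/

section Reference

variable {S : Type*} [TopologicalSpace S] [ChartedSpace (EuclideanSpace ℝ (Fin 2)) S]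
  [IsManifold (𝓡 2) ∞ S] [MeasurableSpace S] [BorelSpace S]

/-- The metric induced from Minkowski space. -/
abbrev imet (X : S → Euc 4) : MetricField 2 S := induced (m := 2) minkowski X

/-- The time function. -/
abbrev hgt (X : S → Euc 4) (T : Euc 4) (q : S) : ℝ := -eta (X q) T

/-- The gradient of the time function. -/
abbrev ghgt (X : S → Euc 4) (T : Euc 4) (q : S) : Euc 2 := gr (imet X) (hgt X T) q

/-- The norm squared of the gradient of the time function. -/
abbrev nsq (X : S → Euc 4) (T : Euc 4) (q : S) : ℝ := met (imet X) q (ghgt X T q) (ghgt X T q)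

/-- The length of the mean curvature vector. -/
abbrev lenH (X : S → Euc 4) (q : S) : ℝ :=
  √|eta (mcv 2 minkowski X q) (mcv 2 minkowski X q)|

/-- The direction opposite to the mean curvature vector. -/
def dirH (X : S → Euc 4) (q : S) : Euc 4 := -((lenH X q)⁻¹ • mcv 2 minkowski X q)

/-- The hyperbolic angle between the direction of the mean curvature vector and the observer. -/
abbrev angle (X : S → Euc 4) (T : Euc 4) (q : S) : ℝ :=
  Real.arsinh (-laplacian (imet X) (hgt X T) q / (lenH X q * √(1 + nsq X T q)))

/-- The projection to the orthogonal complement of the observer. -/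
abbrev proj (X : S → Euc 4) (T : Euc 4) (q : S) : Euc 4 := X q + eta (X q) T • T

/-- A spacelike surface in Minkowski space with spacelike mean curvature vector, an observer `T`,
the future-pointing unit normal `e` orthogonal to the mean curvature vector, and the outward unit
normal `ν` of the projection to the orthogonal complement of `T`. -/
structure Reference (X : S → Euc 4) (T : Euc 4) (e ν : S → Euc 4) : Prop where
  smooth_X : ∀ q, SmAt 2 X q
  pos : ∀ p (w : Euc 2), w ≠ 0 → 0 < met (imet X) p w w
  unit_T : eta T T = -1
  future_T : 0 < T 0
  spacelike_H : ∀ p, 0 < eta (mcv 2 minkowski X p) (mcv 2 minkowski X p)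
  smooth_e : ∀ q, SmAt 2 e q
  normal_e : ∀ p w, eta (e p) (dd 2 X p w) = 0
  unit_e : ∀ p, eta (e p) (e p) = -1
  orth_e : ∀ p, eta (e p) (mcv 2 minkowski X p) = 0
  future_e : ∀ p, 0 < e p 0
  smooth_ν : ∀ q, SmAt 2 ν q
  horizontal_ν : ∀ p, eta (ν p) T = 0
  normal_ν : ∀ p w, eta (ν p) (dd 2 X p w) = 0
  unit_ν : ∀ p, eta (ν p) (ν p) = 1
  outward_ν : ∀ p a, eta a T = 0 → (∀ q, eta (X q) a ≤ eta (X p) a) → 0 ≤ eta (ν p) a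

namespace Reference

variable {X : S → Euc 4} {T : Euc 4} {e ν : S → Euc 4} (R : Reference X T e ν)
include R

theorem smooth_map (q : S) : ContMDiffAt (𝓡 2) (𝓡 4) ∞ X q := R.smooth_X q

theorem smoothMetric : SmoothMetric (imet X) :=
  smoothMetric_induced smoothMetric_minkowski R.smooth_map R.pos

theorem smAt_hgt (q : S) : SmAt 2 (hgt X T) q := by
  have h1 : SmAt 2 (fun q => eta (X q)) q := contMDiffAt_const.clm_apply (R.smooth_X q)
  exact (h1.clm_apply contMDiffAt_const).neg

theorem dd_hgt (q : S) (w : Euc 2) : dd 2 (hgt X T) q w = -eta (dd 2 X q w) T := by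
  have h1 := dd_eta (R.smooth_X q).dfAt (U := fun _ => T) mdifferentiableAt_const
  have h2 := dd_real_comp h1.1 (φ := fun x => -x) (hasDerivAt_neg _)
  rw [h2.2, h1.2, dd_const]; simp

theorem met_ghgt (q : S) (w : Euc 2) : met (imet X) q (ghgt X T q) w = -eta (dd 2 X q w) T := by
  rw [met_gr R.smoothMetric, R.dd_hgt]

theorem nsq_eq (q : S) : nsq X T q = -eta (dd 2 X q (ghgt X T q)) T := R.met_ghgt q _

theorem nsq_nonneg (q : S) : 0 ≤ nsq X T q := by
  by_cases h : ghgt X T q = 0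
  · rw [nsq, h]; simp
  · exact (R.pos q _ h).le

/-- |∇τ|² = dτ(∇τ), the derivative of a smooth function along a smooth field. -/
theorem smAt_nsq (q : S) : SmAt 2 (nsq X T) q :=
  (smAt_dd_field (R.smAt_hgt q) (smoothField_gr R.smoothMetric R.smAt_hgt)).congr_of_eventuallyEq
    (Eventually.of_forall fun y => met_gr R.smoothMetric (hgt X T) y _)

theorem smAt_H (q : S) : SmAt 2 (mcv 2 minkowski X) q :=
  alongAt_minkowski.1 (alongAt_mcv smoothMetric_minkowski R.smooth_map R.pos
    (fun p => alongAt_minkowski.2 (R.smooth_e p)) (by norm_num : (-1 : ℝ) ≠ 0) R.unit_e R.normal_e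
    R.orth_e (fun p => (R.spacelike_H p).ne') q)

theorem smAt_eta_HH (q : S) :
    SmAt 2 (fun q => eta (mcv 2 minkowski X q) (mcv 2 minkowski X q)) q :=
  (contMDiffAt_const.clm_apply (R.smAt_H q)).clm_apply (R.smAt_H q)

theorem lenH_pos (q : S) : 0 < lenH X q := Real.sqrt_pos.2 (abs_pos.2 (R.spacelike_H q).ne')

theorem lenH_sq (q : S) :
    lenH X q ^ 2 = eta (mcv 2 minkowski X q) (mcv 2 minkowski X q) := by
  rw [lenH, Real.sq_sqrt (abs_nonneg _), abs_of_pos (R.spacelike_H q)]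

theorem smAt_lenH (q : S) : SmAt 2 (lenH X) q := by
  have h : lenH X = fun q => √(eta (mcv 2 minkowski X q) (mcv 2 minkowski X q)) := by
    funext y
    rw [lenH, abs_of_pos (R.spacelike_H y)]
  rw [h]
  exact SmAt.comp_real_at (φ := Real.sqrt) (Real.contDiffAt_sqrt (R.spacelike_H q).ne')
    (R.smAt_eta_HH q)

theorem smAt_inv_lenH (q : S) : SmAt 2 (fun q => (lenH X q)⁻¹) q :=
  SmAt.comp_real_at (φ := fun t => t⁻¹) (contDiffAt_inv ℝ (R.lenH_pos q).ne') (R.smAt_lenH q)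

theorem smAt_dirH (q : S) : SmAt 2 (dirH X) q := ((R.smAt_inv_lenH q).smul (R.smAt_H q)).neg

/-- The definition evaluates the Laplacian at each point in a different chart. Smoothness is
inherited instead from the mean curvature vector, through Δτ = −⟨H₀,T⟩. -/
theorem smAt_laplacian (q : S) : SmAt 2 (laplacian (imet X) (hgt X T)) q := by
  have h : SmAt 2 (fun q => -eta (mcv 2 minkowski X q) T) q :=
    ((contMDiffAt_const.clm_apply (R.smAt_H q)).clm_apply contMDiffAt_const).neg
  exact h.congr_of_eventuallyEq
    (Eventually.of_forall fun y => laplacian_height R.smooth_X R.pos T y)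

theorem one_add_nsq_pos (q : S) : 0 < 1 + nsq X T q := by linarith [R.nsq_nonneg q]

theorem smAt_sqrt (q : S) : SmAt 2 (fun q => √(1 + nsq X T q)) q :=
  SmAt.comp_real_at (φ := Real.sqrt) (Real.contDiffAt_sqrt (R.one_add_nsq_pos q).ne')
    (contMDiffAt_const.add (R.smAt_nsq q))

theorem sqrt_pos (q : S) : 0 < √(1 + nsq X T q) := Real.sqrt_pos.2 (R.one_add_nsq_pos q)

theorem smAt_inv_sqrt (q : S) : SmAt 2 (fun q => (√(1 + nsq X T q))⁻¹) q :=
  SmAt.comp_real_at (φ := fun t => t⁻¹) (contDiffAt_inv ℝ (R.sqrt_pos q).ne') (R.smAt_sqrt q)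

theorem smAt_angle (q : S) : SmAt 2 (angle X T) q := by
  have h : SmAt 2 (fun q => -laplacian (imet X) (hgt X T) q *
      ((lenH X q)⁻¹ * (√(1 + nsq X T q))⁻¹)) q :=
    (R.smAt_laplacian q).neg.mul ((R.smAt_inv_lenH q).mul (R.smAt_inv_sqrt q))
  refine (SmAt.comp_real Real.contDiff_arsinh h).congr_of_eventuallyEq
    (Eventually.of_forall fun y => ?_)
  simp only [angle]
  rw [div_eq_mul_inv, mul_inv]

theorem smooth_cosh (q : S) : SmAt 2 (fun q => Real.cosh (angle X T q)) q :=
  SmAt.comp_real Real.contDiff_cosh (R.smAt_angle q)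

/-- The component of the mean curvature vector in the direction of the observer. -/
theorem sinh_angle (q : S) :
    lenH X q * √(1 + nsq X T q) * Real.sinh (angle X T q) = eta (mcv 2 minkowski X q) T := by
  rw [angle, Real.sinh_arsinh, laplacian_height R.smooth_X R.pos, neg_neg]
  have h1 := (R.lenH_pos q).ne'
  have h2 := (R.sqrt_pos q).ne'
  field_simp

theorem eta_dirH (q : S) (u : Euc 4) :
    eta (dirH X q) u = -((lenH X q)⁻¹ * eta (mcv 2 minkowski X q) u) := by
  simp [dirH]

theorem eta_H (q : S) (u : Euc 4) :
    eta (mcv 2 minkowski X q) u = -(lenH X q * eta (dirH X q) u) := by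
  rw [R.eta_dirH]
  have h1 := (R.lenH_pos q).ne'
  field_simp

theorem dirH_unit (q : S) : eta (dirH X q) (dirH X q) = 1 := by
  rw [R.eta_dirH, eta_symm, R.eta_dirH, ← R.lenH_sq]
  have h1 := (R.lenH_pos q).ne'
  field_simp

theorem dirH_normal (q : S) (w : Euc 2) : eta (dirH X q) (dd 2 X q w) = 0 := by
  rw [R.eta_dirH]
  have := met_mcv_tangent R.smoothMetric q w
  have h : eta (mcv 2 minkowski X q) (dd 2 X q w) = 0 := this
  rw [h]; simp

theorem dirH_e (q : S) : eta (dirH X q) (e q) = 0 := by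
  rw [R.eta_dirH, eta_symm, R.orth_e]; simp

/-- Two normal vectors with the same components in a normal frame agree. -/
theorem ext_normal {q : S} {a b u v : Euc 4} (ha : ∀ w, eta a (dd 2 X q w) = 0)
    (hb : ∀ w, eta b (dd 2 X q w) = 0) (hab : eta a b = 0) (haa : eta a a ≠ 0) (hbb : eta b b ≠ 0)
    (hu : ∀ w, eta u (dd 2 X q w) = 0) (hv : ∀ w, eta v (dd 2 X q w) = 0)
    (h1 : eta u a = eta v a) (h2 : eta u b = eta v b) : u = v := by
  rw [← sub_eq_zero]
  refine eq_zero_of_orthogonal eta_symm eta_nondeg (L := dd 2 X q) (R.pos q) ha hb hab haa hbb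
    (fun w => ?_) ?_ ?_
  · simp [hu, hv]
  · simp [h1]
  · simp [h2]

/-- The unit normal in the direction of the observer. -/
theorem observer_eq (q : S) :
    (√(1 + nsq X T q))⁻¹ • (T + dd 2 X q (ghgt X T q))
      = -(Real.sinh (angle X T q) • dirH X q) + Real.cosh (angle X T q) • e q := by
  have hw := R.sqrt_pos q
  have hw2 : √(1 + nsq X T q) ^ 2 = 1 + nsq X T q := Real.sq_sqrt (R.one_add_nsq_pos q).le
  set ϖ := √(1 + nsq X T q) with hϖ
  set u : Euc 4 := ϖ⁻¹ • (T + dd 2 X q (ghgt X T q)) with hu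
  have hXX : ∀ w, eta (dd 2 X q (ghgt X T q)) (dd 2 X q w) = -eta (dd 2 X q w) T := R.met_ghgt q
  -- ⟨T, dX w⟩ = −dτ(w), so adding dX(∇τ) removes exactly the tangential part of T.
  have hut : ∀ w, eta u (dd 2 X q w) = 0 := by
    intro w
    simp only [hu, map_smul, map_add, smul_apply, add_apply, hXX, eta_symm T]
    simp
  have huu : eta u u = -1 := by
    have h1 : eta u u = ϖ⁻¹ * eta u T := by
      have h2 : eta u u = eta u (ϖ⁻¹ • (T + dd 2 X q (ghgt X T q))) := congrArg (eta u) hu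
      rw [h2, map_smul, map_add, hut, add_zero, smul_eq_mul]
    rw [h1, hu]
    simp only [map_smul, map_add, smul_apply, add_apply, smul_eq_mul, R.unit_T]
    have := R.nsq_eq q
    have h3 : eta (dd 2 X q (ghgt X T q)) T = -nsq X T q := by linarith
    rw [h3]
    field_simp
    rw [hw2]; ring
  have huH : eta u (dirH X q) = -Real.sinh (angle X T q) := by
    rw [eta_symm, R.eta_dirH, hu]
    have h1 : eta (mcv 2 minkowski X q) (dd 2 X q (ghgt X T q)) = 0 :=
      met_mcv_tangent R.smoothMetric q _
    simp only [map_smul, map_add, smul_eq_mul, h1, add_zero]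
    rw [← R.sinh_angle, ← hϖ]
    have := (R.lenH_pos q).ne'
    field_simp
  -- The coefficient of `e` is known up to sign from ⟨u,u⟩ = −1; the sign is fixed because T and `e`
  -- are both future-pointing.
  have hue : eta u (e q) < 0 := by
    rw [hu]
    simp only [map_smul, map_add, smul_apply, add_apply, smul_eq_mul,
      eta_symm (dd 2 X q _) (e q), R.normal_e, add_zero]
    exact mul_neg_of_pos_of_neg (inv_pos.2 hw)
      (eta_neg_of_future R.unit_T (R.unit_e q) R.future_T (R.future_e q))
  set c := eta u (e q) with hc
  have hdd := R.dirH_unit q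
  have hde := R.dirH_e q
  have hed : eta (e q) (dirH X q) = 0 := by rw [eta_symm]; exact hde
  have hee := R.unit_e q
  have hform : u = -(Real.sinh (angle X T q) • dirH X q) + (-c) • e q := by
    refine R.ext_normal (R.dirH_normal q) (R.normal_e q) hde (by rw [hdd]; norm_num)
      (by rw [hee]; norm_num) hut (fun w => ?_) ?_ ?_
    · simp [R.dirH_normal q, R.normal_e q]
    · simp only [map_add, map_neg, map_smul, add_apply, neg_apply, smul_apply, smul_eq_mul, hdd,
        hed, huH]
      ring
    · simp only [map_add, map_neg, map_smul, add_apply, neg_apply, smul_apply, smul_eq_mul, hde,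
        hee]
      rw [← hc]; ring
  have hc2 : c ^ 2 = Real.cosh (angle X T q) ^ 2 := by
    have h1 : eta u u = eta u (-(Real.sinh (angle X T q) • dirH X q) + (-c) • e q) :=
      congrArg (eta u) hform
    simp only [map_add, map_neg, map_smul, smul_eq_mul, huu, huH] at h1
    rw [← hc] at h1
    rw [Real.cosh_sq]
    linarith
  have hc3 : -c = Real.cosh (angle X T q) := by
    have h2 : (-c) ^ 2 = Real.cosh (angle X T q) ^ 2 := by rw [neg_sq, hc2]
    exact (pow_left_inj₀ (by linarith) (Real.cosh_pos _).le two_ne_zero).1 h2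
  rw [hform, hc3]

/-- Differentiate ⟨ν,T⟩ = 0, with T constant. -/
theorem eta_ν_T (q : S) (w : Euc 2) : eta (dd 2 ν q w) T = 0 := by
  have h1 := (dd_eta (R.smooth_ν q).dfAt (U := fun _ => T) mdifferentiableAt_const).2 w
  rw [funext R.horizontal_ν, dd_const, dd_const] at h1
  simpa using h1.symm

/-- The outward normal, up to a sign. -/
theorem eta_ν_e (q : S) :
    Real.sinh (angle X T q) * eta (ν q) (dirH X q) = Real.cosh (angle X T q) * eta (ν q) (e q) := by
  have h := congrArg (eta (ν q)) (R.observer_eq q)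
  simp only [map_add, map_neg, map_smul, smul_eq_mul, R.horizontal_ν, R.normal_ν] at h
  linarith

/-- Let a and b be the products of ν with e_{H₀} and e_{J₀}. Unit length gives a² − b² = 1, and
orthogonality to the observer gives sinh θ₀ · a = cosh θ₀ · b. This leaves the sign of a open;
`eta_ν_dirH` decides it. -/
theorem eta_ν_dirH_sq (q : S) :
    eta (ν q) (dirH X q) ^ 2 = Real.cosh (angle X T q) ^ 2 := by
  have hdd := R.dirH_unit q
  have hde := R.dirH_e q
  have hed : eta (e q) (dirH X q) = 0 := by rw [eta_symm]; exact hde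
  have hee := R.unit_e q
  have hform : ν q = eta (ν q) (dirH X q) • dirH X q + (-eta (ν q) (e q)) • e q := by
    refine R.ext_normal (R.dirH_normal q) (R.normal_e q) hde (by rw [hdd]; norm_num)
      (by rw [hee]; norm_num) (R.normal_ν q) (fun w => ?_) ?_ ?_
    · simp [R.dirH_normal q, R.normal_e q]
    · simp only [map_add, map_smul, add_apply, smul_apply, smul_eq_mul, hdd, hed]
      ring
    · simp only [map_add, map_smul, add_apply, smul_apply, smul_eq_mul, hde, hee]
      ring
  have h1 : eta (ν q) (ν q) = eta (ν q) (eta (ν q) (dirH X q) • dirH X q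
    + (-eta (ν q) (e q)) • e q) := congrArg (eta (ν q)) hform
  simp only [map_add, map_smul, smul_eq_mul, R.unit_ν] at h1
  have h2 := R.eta_ν_e q
  have h3 := Real.cosh_sq (angle X T q)
  set s := Real.sinh (angle X T q)
  set c := Real.cosh (angle X T q)
  set a := eta (ν q) (dirH X q)
  set b := eta (ν q) (e q)
  have h4 : c ^ 2 * b ^ 2 = s ^ 2 * a ^ 2 := by
    rw [← mul_pow, ← mul_pow, h2]
  nlinarith

end Reference

end Reference

/-! ### Mean curvature of the projected surface -/

section ReferenceCurvature

variable {S : Type*} [TopologicalSpace S] [ChartedSpace (EuclideanSpace ℝ (Fin 2)) S]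
  [IsManifold (𝓡 2) ∞ S] [MeasurableSpace S] [BorelSpace S]

/-- The determinant of a rank-one perturbation. -/
theorem rank_one_det {E F G : ℝ} (x y : ℝ) (hd : E * G - F * F ≠ 0) :
    (E + x * x) * (G + y * y) - (F + x * y) * (F + x * y)
      = (E * G - F * F) * (1 + (E * G - F * F)⁻¹ * (G * x * x - 2 * F * x * y + E * y * y)) := by
  linear_combination -(G * x * x - 2 * F * x * y + E * y * y) * mul_inv_cancel₀ hd

/-- The inverse of a rank-one perturbation, contracted with a bilinear form. -/
theorem rank_one_inverse {E F G x y h00 h01 h10 h11 : ℝ} (hd : E * G - F * F ≠ 0)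
    (hn : 1 + (E * G - F * F)⁻¹ * (G * x * x - 2 * F * x * y + E * y * y) ≠ 0) :
    ((E + x * x) * (G + y * y) - (F + x * y) * (F + x * y))⁻¹ *
        ((G + y * y) * h00 - (F + x * y) * h01 - (F + x * y) * h10 + (E + x * x) * h11)
      = (E * G - F * F)⁻¹ * (G * h00 - F * h01 - F * h10 + E * h11)
        - (((E * G - F * F)⁻¹ * (G * x - F * y)) ^ 2 * h00
          + (E * G - F * F)⁻¹ * (G * x - F * y) * ((E * G - F * F)⁻¹ * (E * y - F * x)) * (h01 + h10)
          + ((E * G - F * F)⁻¹ * (E * y - F * x)) ^ 2 * h11)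
          / (1 + (E * G - F * F)⁻¹ * (G * x * x - 2 * F * x * y + E * y * y)) := by
  rw [rank_one_det x y hd, div_eq_mul_inv, mul_inv]
  have e2 := inv_mul_cancel₀ hd
  generalize (E * G - F * F)⁻¹ = P at *
  have e1 := inv_mul_cancel₀ hn
  generalize (1 + P * (G * x * x - 2 * F * x * y + E * y * y))⁻¹ = R at *
  linear_combination P * (G * h00 - F * h01 - F * h10 + E * h11) * e1
    - P * R * (y * y * h00 - x * y * (h01 + h10) + x * x * h11) * e2

namespace Reference

variable {X : S → Euc 4} {T : Euc 4} {e ν : S → Euc 4} (R : Reference X T e ν)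
include R

theorem eta_HH_ν (q : S) :
    eta (mcv 2 minkowski X q) (ν q) = -(lenH X q * eta (ν q) (dirH X q)) := by
  rw [R.eta_H, eta_symm]

/-- The square is cosh² > 0. Nonvanishing lets a sign known at one point spread over the connected
surface. -/
theorem eta_ν_dirH_ne (q : S) : eta (ν q) (dirH X q) ≠ 0 := fun h => by
  have := R.eta_ν_dirH_sq q
  rw [h] at this
  have h1 := Real.cosh_pos (angle X T q)
  nlinarith

/-- At a maximum of a linear function in the direction `a`, the mean curvature vector does not point
in the direction `a`. -/
theorem eta_H_nonpos_of_isMax {p : S} {a : Euc 4} (hm : ∀ q, eta (X q) a ≤ eta (X p) a) :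
    (∀ w, eta a (dd 2 X p w) = 0) ∧ eta (mcv 2 minkowski X p) a ≤ 0 := by
  have hp := mem_chart_source (EuclideanSpace ℝ (Fin 2)) p
  have hf : ∀ q, SmAt 2 (fun q => eta (X q) a) q := fun q =>
    (contMDiffAt_const.clm_apply (R.smooth_X q)).clm_apply contMDiffAt_const
  have hdf : ∀ (q : S) (w : Euc 2), dd 2 (fun q => eta (X q) a) q w = eta (dd 2 X q w) a := by
    intro q w
    rw [(dd_eta (R.smooth_X q).dfAt (U := fun _ => a) mdifferentiableAt_const).2, dd_const]; simp
  have hn : ∀ w, eta a (dd 2 X p w) = 0 := fun w => by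
    rw [eta_symm, ← hdf]; exact dd_eq_zero_of_isMax (hf p) hm w
  refine ⟨hn, ?_⟩
  have hY : ∀ c : Euc 2, DfAt 2 (fun q => dd 2 X q (tcc 2 p q q c)) p := fun c =>
    SmAt.dfAt (smAt_dd_cvec hp (R.smooth_X p) c)
  have hH : ∀ c b, dd 2 (fun q => dd 2 (fun q => eta (X q) a) q (tcc 2 p q q c)) p b
      = eta (dd 2 (fun q => dd 2 X q (tcc 2 p q q c)) p b) a := by
    intro c b
    simp only [hdf]
    rw [(dd_eta (hY c) (U := fun _ => a) mdifferentiableAt_const).2, dd_const]; simp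
  have hsymm : eta (dd 2 (fun q => dd 2 X q (tcc 2 p q q (bas 2 0))) p (bas 2 1)) a
      = eta (dd 2 (fun q => dd 2 X q (tcc 2 p q q (bas 2 1))) p (bas 2 0)) a := by
    rw [dd_dd_symm (R.smooth_X p)]
  have hq : ∀ x y : ℝ,
      x * x * eta (dd 2 (fun q => dd 2 X q (tcc 2 p q q (bas 2 0))) p (bas 2 0)) a
      + 2 * x * y * eta (dd 2 (fun q => dd 2 X q (tcc 2 p q q (bas 2 1))) p (bas 2 0)) a
      + y * y * eta (dd 2 (fun q => dd 2 X q (tcc 2 p q q (bas 2 1))) p (bas 2 1)) a ≤ 0 := by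
    intro x y
    have h := hessian_nonpos_of_isMax (hf p) hm (x • bas 2 0 + y • bas 2 1)
    rw [dd_dd_eq (hf p)] at h
    simp only [map_add, map_smul, add_apply, smul_apply, smul_eq_mul, ← dd_dd_eq (hf p), hH] at h
    rw [hsymm] at h
    linarith
  -- `a` is normal at `p`, so ⟨H₀,a⟩ is the metric trace of the second derivatives of the height
  -- ⟨X,a⟩, a nonpositive form at the maximum.
  have htr : eta (mcv 2 minkowski X p) a = ∑ i, ∑ j, (gramAt (imet X) p p)⁻¹ i j *
      eta (dd 2 (fun q => dd 2 X q (tcc 2 p q q (bas 2 j))) p (bas 2 i)) a := by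
    have h := met_mcv_of_normal (m := 2) (F := X) smoothMetric_minkowski p a hn
    simp only [conn_minkowski] at h
    rw [gramAt_self]
    exact h
  have hdet := det_gramAt_pos R.smoothMetric (R.pos p) hp
  obtain ⟨i1, i2, i3, i4⟩ := inv_two_apply (gramAt (imet X) p p)
  have hs := gramAt_symm R.smoothMetric p p 1 0
  have h00 : 0 < gramAt (imet X) p p 0 0 := by
    refine gz_pos (R.pos p) hp (bas 2 0) fun h => ?_
    have := congrArg (fun v : Euc 2 => v 0) h
    simp [bas] at this
  rw [htr]
  simp only [Fin.sum_univ_two, i1, i2, i3, i4]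
  rw [hs, hsymm]
  rw [Matrix.det_fin_two, hs] at hdet ⊢
  have := trace_nonpos h00 hdet hq
  refine le_of_eq_of_le ?_ this
  ring

/-- The sign of the outward normal. -/
theorem eta_ν_dirH [CompactSpace S] [ConnectedSpace S] (q : S) :
    eta (ν q) (dirH X q) = Real.cosh (angle X T q) := by
  have hcont : Continuous fun q => eta (ν q) (dirH X q) := continuous_iff_continuousAt.2 fun y =>
    SmAt.dfAt (n := 2) ((contMDiffAt_const.clm_apply (R.smooth_ν y)).clm_apply
      (R.smAt_dirH y)) |>.continuousAt
  have hXc : Continuous X := continuous_iff_continuousAt.2 fun y => (R.smooth_X y).continuousAt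
  -- The sign is decided at a point `p` where the height in the direction ν(q) is largest.
  obtain ⟨p, -, hp⟩ := isCompact_univ.exists_isMaxOn (⟨q, trivial⟩ : (Set.univ : Set S).Nonempty)
    (f := fun y => eta (X y) (ν q)) (by fun_prop)
  have hm : ∀ y, eta (X y) (ν q) ≤ eta (X p) (ν q) := fun y => hp (Set.mem_univ y)
  obtain ⟨h1, h2⟩ := R.eta_H_nonpos_of_isMax hm
  have hout := R.outward_ν p (ν q) (R.horizontal_ν q) hm
  -- ν(q) is normal to X at `p`, because `p` is critical for the height, and it is orthogonal to T.
  -- The normal plane at `p` is spanned by ν(p) and the normal part of T, so ν(q) = ±ν(p).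
  -- Outwardness excludes the minus sign.
  have hsq : eta (ν p) (ν q) ^ 2 = 1 ∧ ν q = eta (ν p) (ν q) • ν p := by
    have hobs : ∀ u, (∀ w, eta u (dd 2 X p w) = 0) → eta u T = 0 →
        eta u ((√(1 + nsq X T p))⁻¹ • (T + dd 2 X p (ghgt X T p))) = 0 := by
      intro u hu hT
      simp [hu, hT]
    have hob2 : eta ((√(1 + nsq X T p))⁻¹ • (T + dd 2 X p (ghgt X T p)))
        ((√(1 + nsq X T p))⁻¹ • (T + dd 2 X p (ghgt X T p))) = -1 := by
      rw [R.observer_eq]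
      have a1 := R.dirH_unit p
      have a2 := R.dirH_e p
      have a3 : eta (e p) (dirH X p) = 0 := by rw [eta_symm]; exact a2
      simp only [map_add, map_neg, map_smul, add_apply, neg_apply, smul_apply, smul_eq_mul, a1, a2,
        a3, R.unit_e]
      have := Real.cosh_sq (angle X T p)
      linear_combination -this
    have hobn : ∀ w, eta ((√(1 + nsq X T p))⁻¹ • (T + dd 2 X p (ghgt X T p))) (dd 2 X p w) = 0 := by
      intro w
      rw [R.observer_eq]
      simp [R.dirH_normal p, R.normal_e p]
    have h3 : ν q = eta (ν p) (ν q) • ν p := by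
      refine R.ext_normal (R.normal_ν p) hobn (hobs _ (R.normal_ν p) (R.horizontal_ν p))
        (by rw [R.unit_ν]; norm_num) (by rw [hob2]; norm_num) h1 (fun w => ?_) ?_ ?_
      · simp [R.normal_ν p]
      · simp [R.unit_ν p, eta_symm (ν q) (ν p)]
      · rw [hobs _ h1 (R.horizontal_ν q), map_smul eta, smul_apply,
          hobs _ (R.normal_ν p) (R.horizontal_ν p), smul_zero]
    refine ⟨?_, h3⟩
    have h4 : eta (ν q) (ν q) = eta (ν q) (eta (ν p) (ν q) • ν p) := congrArg (eta (ν q)) h3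
    rw [R.unit_ν, map_smul, smul_eq_mul, eta_symm (ν q) (ν p)] at h4
    rw [sq]; exact h4.symm
  have hνq : ν q = ν p := by
    have : eta (ν p) (ν q) = 1 := by
      rcases mul_self_eq_one_iff.1 ((sq _).symm.trans hsq.1) with h | h
      · exact h
      · linarith
    rw [hsq.2, this, one_smul]
  -- At the maximum ⟨H₀,ν⟩ ≤ 0, while e_{H₀} points opposite to H₀.
  have hpp : 0 < eta (ν p) (dirH X p) := by
    rw [hνq, R.eta_HH_ν] at h2
    have h5 : 0 ≤ lenH X p * eta (ν p) (dirH X p) := by linarith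
    exact lt_of_le_of_ne (nonneg_of_mul_nonneg_right h5 (R.lenH_pos p)) (R.eta_ν_dirH_ne p).symm
  have hqq : 0 < eta (ν q) (dirH X q) := by
    -- Otherwise the intermediate value theorem on the connected surface would produce a zero.
    by_contra! h
    obtain ⟨z, hz⟩ := mem_range_of_exists_le_of_exists_ge hcont ⟨q, h⟩ ⟨p, hpp.le⟩
    exact R.eta_ν_dirH_ne z hz
  exact (pow_left_inj₀ hqq.le (Real.cosh_pos _).le two_ne_zero).1 (R.eta_ν_dirH_sq q)

theorem ν_eq [CompactSpace S] [ConnectedSpace S] (q : S) :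
    ν q = Real.cosh (angle X T q) • dirH X q - Real.sinh (angle X T q) • e q := by
  have h := R.eta_ν_dirH q
  have h2 := R.eta_ν_e q
  rw [h] at h2
  have h3 : eta (ν q) (e q) = Real.sinh (angle X T q) :=
    (mul_left_cancel₀ (Real.cosh_pos _).ne' (by linarith : Real.cosh (angle X T q) *
      eta (ν q) (e q) = Real.cosh (angle X T q) * Real.sinh (angle X T q)))
  have hde := R.dirH_e q
  have hed : eta (e q) (dirH X q) = 0 := by rw [eta_symm]; exact hde
  refine R.ext_normal (R.dirH_normal q) (R.normal_e q) hde (by rw [R.dirH_unit]; norm_num)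
    (by rw [R.unit_e]; norm_num) (R.normal_ν q) (fun w => ?_) ?_ ?_
  · simp [R.dirH_normal q, R.normal_e q]
  · simp [R.dirH_unit q, hed, h]
  · simp [R.unit_e q, hde, h3]

theorem dd_proj (q : S) : DfAt 2 (proj X T) q ∧
    ∀ w, dd 2 (proj X T) q w = dd 2 X q w + eta (dd 2 X q w) T • T := by
  have h1 := dd_eta (R.smooth_X q).dfAt (U := fun _ => T) mdifferentiableAt_const
  have h2 := dd_smul h1.1 (v := fun _ => T) mdifferentiableAt_const
  have h3 := dd_add (R.smooth_X q).dfAt h2.1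
  refine ⟨h3.1, fun w => ?_⟩
  have h4 : dd 2 (proj X T) q w = _ := congrArg (fun L : Euc 2 →L[ℝ] Euc 4 => L w) h3.2
  rw [h4, add_apply, h2.2, h1.2, dd_const]
  simp

theorem smAt_proj (q : S) : SmAt 2 (proj X T) q := by
  have h1 : SmAt 2 (fun q => eta (X q) T) q :=
    (contMDiffAt_const.clm_apply (R.smooth_X q)).clm_apply contMDiffAt_const
  have h2 : SmAt 2 (fun q => eta (X q) T • T) q :=
    ContMDiffAt.smul (g := fun _ => T) h1 contMDiffAt_const
  exact (R.smooth_X q).add h2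

/-- The two cross terms give twice the product of the heights, and ⟨T,T⟩ = −1 takes one copy back:
the metric becomes σ + dτ⊗dτ. -/
theorem met_proj (q : S) (w w' : Euc 2) :
    met (imet (proj X T)) q w w' = met (imet X) q w w'
      + eta (dd 2 X q w) T * eta (dd 2 X q w') T := by
  have h1 : met (imet (proj X T)) q w w' = eta (dd 2 (proj X T) q w) (dd 2 (proj X T) q w') := rfl
  have h2 : met (imet X) q w w' = eta (dd 2 X q w) (dd 2 X q w') := rfl
  rw [h1, h2, (R.dd_proj q).2, (R.dd_proj q).2]
  simp only [map_add, map_smul, add_apply, smul_apply, smul_eq_mul, R.unit_T,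
    eta_symm T (dd 2 X q w')]
  ring

theorem pos_proj (q : S) (w : Euc 2) (hw : w ≠ 0) : 0 < met (imet (proj X T)) q w w := by
  rw [R.met_proj]
  have := R.pos q w hw
  nlinarith [sq_nonneg (eta (dd 2 X q w) T)]

theorem smoothMetric_proj : SmoothMetric (imet (proj X T)) :=
  smoothMetric_induced smoothMetric_minkowski R.smAt_proj R.pos_proj

/-- The components of the gradient. -/
theorem ghgt_eq {x q : S} (hq : q ∈ src 2 x) :
    ghgt X T q = ∑ i, (∑ j, (gramAt (imet X) x q)⁻¹ i j * dd 2 (hgt X T) q (cv 2 x q j))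
      • cv 2 x q i :=
  sharp_eq_sum R.smoothMetric hq (dform (hgt X T) q)

theorem gramAt_proj (x q : S) (i j : Fin 2) : gramAt (imet (proj X T)) x q i j
    = gramAt (imet X) x q i j + dd 2 (hgt X T) q (cv 2 x q i) * dd 2 (hgt X T) q (cv 2 x q j) := by
  have h := R.met_proj q (cv 2 x q i) (cv 2 x q j)
  rw [R.dd_hgt, R.dd_hgt, neg_mul_neg]
  exact h

theorem nsq_eq_chart {x q : S} (hq : q ∈ src 2 x) :
    nsq X T q = (gramAt (imet X) x q 0 0 * gramAt (imet X) x q 1 1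
        - gramAt (imet X) x q 0 1 * gramAt (imet X) x q 0 1)⁻¹ *
      (gramAt (imet X) x q 1 1 * dd 2 (hgt X T) q (cv 2 x q 0) * dd 2 (hgt X T) q (cv 2 x q 0)
        - 2 * gramAt (imet X) x q 0 1 * dd 2 (hgt X T) q (cv 2 x q 0) * dd 2 (hgt X T) q (cv 2 x q 1)
        + gramAt (imet X) x q 0 0 * dd 2 (hgt X T) q (cv 2 x q 1)
          * dd 2 (hgt X T) q (cv 2 x q 1)) := by
  have h0 : nsq X T q = dd 2 (hgt X T) q (ghgt X T q) := met_gr R.smoothMetric _ q _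
  obtain ⟨i1, i2, i3, i4⟩ := inv_two_apply (gramAt (imet X) x q)
  have hs := gramAt_symm R.smoothMetric x q 1 0
  rw [h0, R.ghgt_eq hq]
  simp only [Fin.sum_univ_two, map_add, map_smul, smul_eq_mul, i1, i2, i3, i4]
  rw [hs, Matrix.det_fin_two, hs]
  ring

theorem volDensity_proj {x q : S} (hq : q ∈ src 2 x) :
    volDensity (imet (proj X T)) x q = √(1 + nsq X T q) * volDensity (imet X) x q := by
  have hdet := det_gramAt_pos R.smoothMetric (R.pos q) hq
  have hs := gramAt_symm R.smoothMetric x q 1 0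
  rw [volDensity_eq, volDensity_eq, ← Real.sqrt_mul (R.one_add_nsq_pos q).le, R.nsq_eq_chart hq]
  congr 1
  simp only [Matrix.det_fin_two, R.gramAt_proj]
  rw [Matrix.det_fin_two, hs] at hdet
  rw [hs]
  linear_combination rank_one_det (dd 2 (hgt X T) q (cv 2 x q 0)) (dd 2 (hgt X T) q (cv 2 x q 1))
    hdet.ne'

/-- The mean curvature of the projection. -/
theorem eta_mcv_proj (q : S) : eta (mcv 2 minkowski (proj X T) q) (ν q)
    = eta (mcv 2 minkowski X q) (ν q)
      + eta (dd 2 ν q (ghgt X T q)) (dd 2 X q (ghgt X T q)) / (1 + nsq X T q) := by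
  have hq := mem_chart_source (EuclideanSpace ℝ (Fin 2)) q
  have hν : ∀ Y : S → Euc 4, DfAt 2 (compz Y ν (Y q)) q := fun Y => by
    rw [compz_minkowski]; exact (R.smooth_ν q).dfAt
  -- `ν` is normal to both surfaces and ⟨dν,T⟩ = 0, so ⟨dν, dX⟩ serves for both; the two mean
  -- curvatures differ only in the inverse metric used for the trace.
  have h1 := met_mcv_chart (F := X) smoothMetric_minkowski R.smooth_map hq (hν X)
    (Eventually.of_forall fun y => R.normal_ν y)
  have h2 := met_mcv_chart (F := proj X T) smoothMetric_minkowski R.smAt_proj hq (hν (proj X T))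
    (Eventually.of_forall fun y w => by
      have : eta (ν y) (dd 2 (proj X T) y w) = 0 := by
        rw [(R.dd_proj y).2]; simp [R.normal_ν y, R.horizontal_ν y]
      exact this)
  simp only [conn_minkowski, met_minkowski, dF_minkowski, (R.dd_proj q).2, map_add, map_smul,
    R.eta_ν_T, smul_zero, add_zero] at h1 h2
  rw [h1, h2]
  set h : Fin 2 → Fin 2 → ℝ := fun i j => eta (dd 2 ν q (cv 2 q q i)) (dd 2 X q (cv 2 q q j)) with hh
  have hG : eta (dd 2 ν q (ghgt X T q)) (dd 2 X q (ghgt X T q))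
      = ∑ i, ∑ k, (∑ j, (gramAt (imet X) q q)⁻¹ i j * dd 2 (hgt X T) q (cv 2 q q j))
        * (∑ j, (gramAt (imet X) q q)⁻¹ k j * dd 2 (hgt X T) q (cv 2 q q j)) * h i k := by
    rw [R.ghgt_eq hq]
    generalize (fun i => ∑ j, (gramAt (imet X) q q)⁻¹ i j * dd 2 (hgt X T) q (cv 2 q q j)) = c
    simp only [map_smul, smul_apply, smul_eq_mul, hh, Fin.sum_univ_two, map_add, add_apply]
    ring
  rw [hG]
  change -∑ i, ∑ j, (gramAt (imet (proj X T)) q q)⁻¹ i j * h i j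
    = -∑ i, ∑ j, (gramAt (imet X) q q)⁻¹ i j * h i j + _
  have hs := gramAt_symm R.smoothMetric q q 1 0
  have hdet := det_gramAt_pos R.smoothMetric (R.pos q) hq
  obtain ⟨i1, i2, i3, i4⟩ := inv_two_apply (gramAt (imet X) q q)
  obtain ⟨j1, j2, j3, j4⟩ := inv_two_apply (gramAt (imet (proj X T)) q q)
  have hn := (R.one_add_nsq_pos q).ne'
  rw [R.nsq_eq_chart hq] at hn ⊢
  simp only [Fin.sum_univ_two, i1, i2, i3, i4, j1, j2, j3, j4]
  rw [Matrix.det_fin_two, hs] at hdet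
  simp only [Matrix.det_fin_two, R.gramAt_proj, hs]
  -- The correction is `h` evaluated on the gradient, divided by 1 + |∇τ|², by the Sherman–Morrison
  -- formula.
  have key := rank_one_inverse (h00 := h 0 0) (h01 := h 0 1) (h10 := h 1 0) (h11 := h 1 1)
    hdet.ne' hn
  generalize gramAt (imet X) q q 0 0 = E at *
  generalize gramAt (imet X) q q 0 1 = F at *
  generalize gramAt (imet X) q q 1 1 = G at *
  generalize dd 2 (hgt X T) q (cv 2 q q 0) = x at *
  generalize dd 2 (hgt X T) q (cv 2 q q 1) = y at *
  rw [mul_comm y x]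
  linear_combination -key

/-- As ⟨dν,T⟩ = 0, the vector dX(∇τ) may be replaced by T + dX(∇τ), a multiple of the rotated
partner of ν; then `conn_rotation` applies. -/
theorem eta_dd_ν [CompactSpace S] [ConnectedSpace S] (q : S) (w : Euc 2) :
    eta (dd 2 ν q w) (dd 2 X q (ghgt X T q)) = √(1 + nsq X T q) *
      (dd 2 (angle X T) q w + cform smoothMetric_minkowski X (dirH X) e q w) := by
  have h := conn_rotation (F := X) (a := dirH X) (b := e) smoothMetric_minkowski R.smooth_map
    (alongAt_minkowski.2 (R.smAt_dirH q)) (alongAt_minkowski.2 (R.smooth_e q)) (R.smAt_angle q)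
    R.dirH_unit R.unit_e R.dirH_e w
  rw [← funext R.ν_eq, ← R.observer_eq, conn_minkowski] at h
  have h2 : dd 2 (angle X T) q w + cform smoothMetric_minkowski X (dirH X) e q w
      = eta (dd 2 ν q w) ((√(1 + nsq X T q))⁻¹ • (T + dd 2 X q (ghgt X T q))) := h.symm
  rw [h2, map_smul, map_add, R.eta_ν_T, zero_add, smul_eq_mul, mul_inv_cancel_left₀ (R.sqrt_pos q).ne']

/-- The mean curvature of the projection in terms of the canonical frame. -/
theorem sqrt_mul_curvature [CompactSpace S] [ConnectedSpace S] (q : S) :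
    √(1 + nsq X T q) * -eta (mcv 2 minkowski (proj X T) q) (ν q)
      = (1 + nsq X T q) * (lenH X q * Real.cosh (angle X T q) / √(1 + nsq X T q))
        - (dd 2 (angle X T) q (ghgt X T q)
          + cform smoothMetric_minkowski X (dirH X) e q (ghgt X T q)) := by
  rw [R.eta_mcv_proj, R.eta_dd_ν, R.eta_HH_ν, R.eta_ν_dirH]
  have hw := R.sqrt_pos q
  have hw2 : √(1 + nsq X T q) ^ 2 = 1 + nsq X T q := Real.sq_sqrt (R.one_add_nsq_pos q).le
  rw [← hw2]
  generalize √(1 + nsq X T q) = s at *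
  have hs : √(s ^ 2) = s := Real.sqrt_sq hw.le
  rw [hs]
  field_simp
  ring

end Reference

end ReferenceCurvature

/-! ## The energy identity -/

namespace Configuration.Admissible

variable {N S : Type*} [TopologicalSpace N] [ChartedSpace (EuclideanSpace ℝ (Fin 4)) N]
  [IsManifold (𝓡 4) ∞ N] [TopologicalSpace S] [ChartedSpace (EuclideanSpace ℝ (Fin 2)) S]
  [IsManifold (𝓡 2) ∞ S] [MeasurableSpace S] [BorelSpace S]
  {D : Configuration N S}

theorem Xhat_eq : D.Xhat = proj D.X D.T0 := rfl

theorem H0_eq (q : S) : D.H0 q = mcv 2 minkowski D.X q := by rfl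

theorem normH0_eq : D.normH0 = lenH D.X := by
  funext q
  rw [Configuration.normH0, H0_eq]

theorem eH0_eq : D.eH0 = dirH D.X := by
  funext q
  rw [Configuration.eH0, normH0_eq, H0_eq, dirH]

variable (D) in
/-- The current, with types reduced to Euclidean space. -/
def current (q : S) : Euc 2 := D.jNew q

variable (D) in
/-- The mean curvature vector, with types reduced to Euclidean space. -/
def vecH (q : S) : Euc 4 := D.H q

variable (D) in
/-- The vector `e_H`, with types reduced to Euclidean space. -/
def vecEH (q : S) : Euc 4 := D.eH q

variable (D) in
/-- The vector `e_J`, with types reduced to Euclidean space. -/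
def vecEJ (q : S) : Euc 4 := D.eJ q

variable (D) in
/-- The connection form `α_{H₀}`. -/
def formH0 : S → Euc 2 →ₗ[ℝ] ℝ := cform smoothMetric_minkowski D.X (dirH D.X) D.eJ0

theorem alphaH0_eq (q : S) : D.alphaH0 q = formH0 D q := by
  funext w
  have h : D.alphaH0 q w = conn minkowski D.X D.eH0 q w (D.eJ0 q) := rfl
  rw [h, eH0_eq]; rfl

theorem vecEH_eq (q : S) : vecEH D q = -((D.normH q)⁻¹ • vecH D q) := rfl

theorem normH_eq (q : S) : D.normH q = √|met D.g (D.F q) (vecH D q) (vecH D q)| := rfl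

variable (hD : D.Admissible)
include hD

theorem sigma_eq : D.sigma = imet D.X := by
  funext p
  refine ContinuousLinearMap.ext fun w => ContinuousLinearMap.ext fun w' => ?_
  exact (hD.isometric p w w').symm

theorem pos (p : S) (w : Euc 2) (hw : w ≠ 0) : 0 < met D.sigma p w w := hD.spacelike p w hw

theorem smooth (q : S) : ContMDiffAt (𝓡 2) (𝓡 4) ∞ D.F q := hD.smooth_F.contMDiffAt

/-- The projection moves X by multiples of T₀ only, so for horizontal vectors the normality and
outwardness conditions on the projected surface are the same conditions on X. -/
theorem reference : Reference D.X D.T0 D.eJ0 D.nu where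
  smooth_X _ := hD.smooth_X.contMDiffAt
  pos p w hw := by rw [← hD.sigma_eq]; exact hD.pos p w hw
  unit_T := hD.unit_T0
  future_T := hD.future_T0
  spacelike_H := hD.spacelike_H0
  smooth_e _ := hD.smooth_eJ0.contMDiffAt
  normal_e := hD.normal_eJ0
  unit_e := hD.unit_eJ0
  orth_e := hD.orth_eJ0
  future_e := hD.future_eJ0
  smooth_ν _ := hD.smooth_nu.contMDiffAt
  horizontal_ν := hD.horizontal_nu
  normal_ν p w := by
    have h := hD.normal_nu p w
    have h1 : DfAt 2 D.X p := (hD.smooth_X p).mdifferentiableAt (by simp)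
    have h2 := dd_eta h1 (U := fun _ => D.T0) mdifferentiableAt_const
    have h3 := dd_smul h2.1 (v := fun _ => D.T0) mdifferentiableAt_const
    have h4 : dd 2 D.Xhat p w = _ :=
      congrArg (fun L : Euc 2 →L[ℝ] Euc 4 => L w) (dd_add h1 h3.1).2
    have h5 : eta (D.nu p) (dd 2 D.Xhat p w) = 0 := h
    rw [h4, add_apply, h3.2, dd_const] at h5
    simpa [hD.horizontal_nu p] using h5
  unit_ν := hD.unit_nu
  outward_ν p a ha hm := hD.outward_nu p a ha fun q => by
    simp only [Configuration.Xhat, map_add, map_smul, add_apply, smul_apply, eta_symm D.T0, ha,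
      smul_zero, add_zero]
    exact hm q

theorem smoothMetric_g : SmoothMetric D.g := hD.lorentzian.smoothMetric

theorem smoothMetric_sigma : SmoothMetric D.sigma :=
  smoothMetric_induced hD.smoothMetric_g hD.smooth hD.pos

theorem gradTau_eq : D.gradTau = ghgt D.X D.T0 := by
  funext p
  have h : D.gradTau p = gr D.sigma (hgt D.X D.T0) p := rfl
  rw [h, hD.sigma_eq]

theorem normSqGradTau_eq : D.normSqGradTau = nsq D.X D.T0 := by
  funext p
  have h : D.normSqGradTau p = met D.sigma p (D.gradTau p) (D.gradTau p) := rfl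
  rw [h, hD.gradTau_eq, hD.sigma_eq]

theorem lapTau_eq : D.lapTau = laplacian (imet D.X) (hgt D.X D.T0) := by
  funext p
  have h : D.lapTau p = laplacian D.sigma (hgt D.X D.T0) p := rfl
  rw [h, hD.sigma_eq]

theorem theta0_eq : D.theta0 = angle D.X D.T0 := by
  funext p
  rw [Configuration.theta0, hD.lapTau_eq, hD.normSqGradTau_eq, normH0_eq]

theorem kHat_eq (p : S) : D.kHat p = -eta (mcv 2 minkowski (proj D.X D.T0) p) (D.nu p) := by
  have h : D.kHat p = -eta (mcv 2 minkowski D.Xhat p) (D.nu p) := rfl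
  rw [h, Xhat_eq]

theorem smAt_nsq (q : S) : SmAt 2 D.normSqGradTau q := by
  rw [hD.normSqGradTau_eq]; exact hD.reference.smAt_nsq q

theorem nsq_nonneg (q : S) : 0 ≤ D.normSqGradTau q := by
  rw [hD.normSqGradTau_eq]; exact hD.reference.nsq_nonneg q

theorem normH0_pos (q : S) : 0 < D.normH0 q := by
  rw [normH0_eq]; exact hD.reference.lenH_pos q

theorem vecH_neg (q : S) : met D.g (D.F q) (vecH D q) (vecH D q) < 0 := hD.timelike_H q

theorem normH_pos (q : S) : 0 < D.normH q := by
  rw [normH_eq]; exact Real.sqrt_pos.2 (abs_pos.2 (hD.vecH_neg q).ne)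

theorem met_HH (q : S) : met D.g (D.F q) (vecH D q) (vecH D q) = -D.normH q ^ 2 := by
  rw [normH_eq, Real.sq_sqrt (abs_nonneg _), abs_of_neg (hD.vecH_neg q), neg_neg]

theorem alongAt_eJ (q : S) : AlongAt 2 D.F (vecEJ D) q := alongAt_of_contMDiffAt (hD.smooth_eJ q)

theorem unit_vecEJ (q : S) : met D.g (D.F q) (vecEJ D q) (vecEJ D q) = 1 := hD.unit_eJ q

theorem met_EJ_H (q : S) : met D.g (D.F q) (vecEJ D q) (vecH D q) = 0 := hD.orth_eJ q

theorem alongAt_H (q : S) : AlongAt 2 D.F (vecH D) q :=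
  alongAt_mcv hD.smoothMetric_g hD.smooth hD.pos hD.alongAt_eJ one_ne_zero hD.unit_vecEJ
    hD.normal_eJ hD.met_EJ_H (fun p => (hD.vecH_neg p).ne) q

theorem smAt_normH (q : S) : SmAt 2 D.normH q := by
  have h1 : SmAt 2 (fun q => -met D.g (D.F q) (vecH D q) (vecH D q)) q :=
    (AlongAt.smAt_met hD.smoothMetric_g (hD.smooth q) (hD.alongAt_H q) (hD.alongAt_H q)).neg
  have h : D.normH = fun q => √(-met D.g (D.F q) (vecH D q) (vecH D q)) := by
    funext y
    rw [normH_eq, abs_of_neg (hD.vecH_neg y)]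
  rw [h]
  exact SmAt.comp_real_at (φ := Real.sqrt)
    (Real.contDiffAt_sqrt (neg_pos.2 (hD.vecH_neg q)).ne') h1

theorem smAt_inv_normH (q : S) : SmAt 2 (fun q => (D.normH q)⁻¹) q :=
  SmAt.comp_real_at (φ := fun t => t⁻¹) (contDiffAt_inv ℝ (hD.normH_pos q).ne') (hD.smAt_normH q)

theorem one_sub_nsq_pos (q : S) : 0 < 1 - D.normSqGradTau q := sub_pos.2 (hD.gradTau_lt q)

theorem smAt_sqrt (q : S) : SmAt 2 (fun q => √(1 - D.normSqGradTau q)) q :=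
  SmAt.comp_real_at (φ := Real.sqrt) (Real.contDiffAt_sqrt (hD.one_sub_nsq_pos q).ne')
    (contMDiffAt_const.sub (hD.smAt_nsq q))

theorem sqrt_pos (q : S) : 0 < √(1 - D.normSqGradTau q) := Real.sqrt_pos.2 (hD.one_sub_nsq_pos q)

theorem smAt_inv_sqrt (q : S) : SmAt 2 (fun q => (√(1 - D.normSqGradTau q))⁻¹) q :=
  SmAt.comp_real_at (φ := fun t => t⁻¹) (contDiffAt_inv ℝ (hD.sqrt_pos q).ne') (hD.smAt_sqrt q)

theorem smAt_theta (q : S) : SmAt 2 D.theta q := by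
  have hl : SmAt 2 D.lapTau q := by
    rw [hD.lapTau_eq]; exact hD.reference.smAt_laplacian q
  have h : SmAt 2 (fun q => D.lapTau q * ((D.normH q)⁻¹ * (√(1 - D.normSqGradTau q))⁻¹)) q :=
    hl.mul ((hD.smAt_inv_normH q).mul (hD.smAt_inv_sqrt q))
  refine (SmAt.comp_real Real.contDiff_arsinh h).congr_of_eventuallyEq
    (Eventually.of_forall fun y => ?_)
  simp only [Configuration.theta]
  rw [div_eq_mul_inv, mul_inv]

theorem smAt_theta0 (q : S) : SmAt 2 D.theta0 q := by
  rw [hD.theta0_eq]; exact hD.reference.smAt_angle q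

/-- The coefficient `|H| cosh θ / √(1 - |∇τ|²)`. -/
theorem smAt_coeff (q : S) :
    SmAt 2 (fun q => D.normH q * Real.cosh (D.theta q) / √(1 - D.normSqGradTau q)) q := by
  simp only [div_eq_mul_inv]
  exact ((hD.smAt_normH q).mul (SmAt.comp_real Real.contDiff_cosh (hD.smAt_theta q))).mul
    (hD.smAt_inv_sqrt q)

/-- The coefficient `|H₀| cosh θ₀ / √(1 + |∇τ|²)`. -/
theorem smAt_coeff0 (q : S) :
    SmAt 2 (fun q => D.normH0 q * Real.cosh (D.theta0 q) / √(1 + D.normSqGradTau q)) q := by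
  simp only [div_eq_mul_inv, hD.normSqGradTau_eq, hD.theta0_eq, normH0_eq]
  exact ((hD.reference.smAt_lenH q).mul (hD.reference.smooth_cosh q)).mul
    (hD.reference.smAt_inv_sqrt q)

theorem alongAt_eH (q : S) : AlongAt 2 D.F (vecEH D) q := by
  have h : SmAt 2 (fun q => -(D.normH q)⁻¹) q := (hD.smAt_inv_normH q).neg
  refine (AlongAt.smul h (hD.alongAt_H q)).congr (Eventually.of_forall fun y => ?_)
  rw [vecEH_eq, neg_smul]

theorem met_eH (q : S) (u : Euc 4) :
    met D.g (D.F q) (vecEH D q) u = -((D.normH q)⁻¹ * met D.g (D.F q) (vecH D q) u) := by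
  rw [vecEH_eq, map_neg, map_smul, neg_apply, smul_apply, smul_eq_mul]

theorem met_H_eH (q : S) : met D.g (D.F q) (vecH D q) (vecEH D q) = D.normH q := by
  rw [hD.smoothMetric_g.symm, hD.met_eH, hD.met_HH]
  have := (hD.normH_pos q).ne'
  field_simp

theorem unit_eH (q : S) : met D.g (D.F q) (vecEH D q) (vecEH D q) = -1 := by
  rw [hD.met_eH, hD.met_H_eH, inv_mul_cancel₀ (hD.normH_pos q).ne']

theorem orth_eJ_eH (q : S) : met D.g (D.F q) (vecEJ D q) (vecEH D q) = 0 := by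
  rw [hD.smoothMetric_g.symm, hD.met_eH, hD.smoothMetric_g.symm, hD.met_EJ_H]; simp

/-- The connection form `α_J`. -/
def formJ : S → Euc 2 →ₗ[ℝ] ℝ := cform hD.smoothMetric_g D.F (vecEJ D) (vecEH D)

theorem smoothForm_formJ : SmoothForm hD.formJ :=
  smoothForm_cform _ hD.smooth hD.alongAt_eJ hD.alongAt_eH

theorem smoothForm_formH0 : SmoothForm (formH0 D) :=
  smoothForm_cform _ hD.reference.smooth_map
    (fun q => alongAt_minkowski.2 (hD.reference.smAt_dirH q))
    (fun q => alongAt_minkowski.2 (hD.reference.smooth_e q))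

theorem smoothField_gradTau : SmoothField (ghgt D.X D.T0) :=
  smoothField_gr hD.reference.smoothMetric hD.reference.smAt_hgt

/-- The physical integrand in terms of the mean curvature gauge. -/
theorem physicalIntegrand_eq (q : S) : D.physicalIntegrand q =
    -((1 - D.normSqGradTau q) * (D.normH q * Real.cosh (D.theta q) / √(1 - D.normSqGradTau q)))
      - (dd 2 D.theta q (ghgt D.X D.T0 q) + hD.formJ q (ghgt D.X D.T0 q)) := by
  set U : Euc 4 := -(Real.sinh (D.theta q) • vecEJ D q) + Real.cosh (D.theta q) • vecEH D q with hU
  have h1 := conn_rotation hD.smoothMetric_g hD.smooth (hD.alongAt_eJ q) (hD.alongAt_eH q)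
    (hD.smAt_theta q) hD.unit_vecEJ hD.unit_eH hD.orth_eJ_eH (ghgt D.X D.T0 q)
  have h2 : D.physicalIntegrand q = -√(1 - D.normSqGradTau q) * met D.g (D.F q) (vecH D q) U
      - conn D.g D.F (fun y => Real.cosh (D.theta y) • vecEJ D y - Real.sinh (D.theta y) • vecEH D y)
        q (D.gradTau q) U := rfl
  -- H is orthogonal to e_J, and ⟨H,e_H⟩ = −⟨H,H⟩/|H| = |H| since H is timelike.
  have h4 : met D.g (D.F q) (vecH D q) U = D.normH q * Real.cosh (D.theta q) := by
    rw [hU, map_add, map_neg, map_smul, map_smul, hD.met_H_eH, hD.smoothMetric_g.symm, hD.met_EJ_H]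
    simp only [smul_eq_mul]; ring
  have h3 : D.physicalIntegrand q = -√(1 - D.normSqGradTau q) * (D.normH q * Real.cosh (D.theta q))
      - (dd 2 D.theta q (ghgt D.X D.T0 q) + hD.formJ q (ghgt D.X D.T0 q)) := by
    rw [h2, h4, hD.gradTau_eq]
    exact congrArg _ h1
  rw [h3]
  have hs := hD.sqrt_pos q
  have hs2 : √(1 - D.normSqGradTau q) ^ 2 = 1 - D.normSqGradTau q :=
    Real.sq_sqrt (hD.one_sub_nsq_pos q).le
  generalize √(1 - D.normSqGradTau q) = s at *
  rw [← hs2]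
  field_simp

/-- The one-form dual to the current. -/
def formCurrent : S → Euc 2 →ₗ[ℝ] ℝ := fun q =>
  (D.normH0 q * Real.cosh (D.theta0 q) / √(1 + D.normSqGradTau q)
    - D.normH q * Real.cosh (D.theta q) / √(1 - D.normSqGradTau q)) • dform (hgt D.X D.T0) q
  - dform (fun y => D.theta0 y - D.theta y) q - formH0 D q + hD.formJ q

theorem smoothForm_formCurrent : SmoothForm hD.formCurrent :=
  (((SmoothForm.smul (fun q => (hD.smAt_coeff0 q).sub (hD.smAt_coeff q))
    (smoothForm_dform hD.reference.smAt_hgt)).sub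
    (smoothForm_dform fun q => (hD.smAt_theta0 q).sub (hD.smAt_theta q))).sub
    hD.smoothForm_formH0).add hD.smoothForm_formJ

theorem alphaJ_eq (q : S) : D.alphaJ q = hD.formJ q := rfl

theorem jNew_eq (q : S) : current D q = shp D.sigma q (hD.formCurrent q) := by
  have h : current D q
      = (D.normH0 q * Real.cosh (D.theta0 q) / √(1 + D.normSqGradTau q)) •
          shp D.sigma q (dform (hgt D.X D.T0) q)
        - (D.normH q * Real.cosh (D.theta q) / √(1 - D.normSqGradTau q)) •
          shp D.sigma q (dform (hgt D.X D.T0) q)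
        - shp D.sigma q (dform (fun y => D.theta0 y - D.theta y) q)
        - shp D.sigma q (D.alphaH0 q) + shp D.sigma q (D.alphaJ q) := rfl
  rw [h, alphaH0_eq, hD.alphaJ_eq]
  simp only [sharp_eq, formCurrent, LinearMap.add_apply, LinearMap.sub_apply, LinearMap.smul_apply,
    smul_eq_mul, Finset.smul_sum, ← Finset.sum_sub_distrib, ← Finset.sum_add_distrib, smul_smul,
    ← sub_smul, ← add_smul]
  refine Finset.sum_congr rfl fun i _ => Finset.sum_congr rfl fun j _ => ?_
  congr 1
  ring

/-- The mass density differs from the difference of the integrands by a total derivative. -/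
theorem density_identity [CompactSpace S] [ConnectedSpace S] (q : S) :
    √(1 + nsq D.X D.T0 q) * D.kHat q - D.physicalIntegrand q
      = D.rhoNew q + dd 2 (hgt D.X D.T0) q (current D q) := by
  have h1 := hD.reference.sqrt_mul_curvature q
  have h2 := hD.physicalIntegrand_eq q
  -- dτ(j) = σ(∇τ, j), which is the one-form dual to j evaluated on ∇τ.
  have h3 : dd 2 (hgt D.X D.T0) q (current D q) = hD.formCurrent q (ghgt D.X D.T0 q) := by
    rw [hD.jNew_eq, ← met_gr hD.smoothMetric_sigma, hD.smoothMetric_sigma.symm,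
      met_sharp (hD.smoothMetric_sigma.symm q) (hD.smoothMetric_sigma.nondeg q), hD.sigma_eq]
  have h4 : dform (hgt D.X D.T0) q (ghgt D.X D.T0 q) = nsq D.X D.T0 q :=
    (met_gr hD.reference.smoothMetric _ q _).symm
  have h5 : dform (fun y => D.theta0 y - D.theta y) q (ghgt D.X D.T0 q)
      = dd 2 D.theta0 q (ghgt D.X D.T0 q) - dd 2 D.theta q (ghgt D.X D.T0 q) := by
    have := (dd_sub (hD.smAt_theta0 q).dfAt (hD.smAt_theta q).dfAt).2
    exact congrArg (fun L : Euc 2 →L[ℝ] ℝ => L (ghgt D.X D.T0 q)) this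
  have h6 : √(1 + nsq D.X D.T0 q) * D.kHat q
      = (1 + nsq D.X D.T0 q) *
          (D.normH0 q * Real.cosh (D.theta0 q) / √(1 + nsq D.X D.T0 q))
        - (dd 2 D.theta0 q (ghgt D.X D.T0 q) + formH0 D q (ghgt D.X D.T0 q)) := by
    rw [hD.theta0_eq, hD.kHat_eq, normH0_eq]; exact h1
  -- With A₀ and A the two terms of ρ, the left side contains (1+n)A₀ + (1−n)A. Its part free of n
  -- is ρ; the rest, with the angle differentials and connection forms, is the current paired with
  -- ∇τ.
  rw [h6, h2, h3, formCurrent, Configuration.rhoNew, LinearMap.add_apply, LinearMap.sub_apply,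
    LinearMap.sub_apply, LinearMap.smul_apply, h4, h5, hD.normSqGradTau_eq, smul_eq_mul]
  ring

/-- Continuity is read off from `sqrt_mul_curvature`, in which every other term is smooth, so the
mean curvature vector of the projection need not be treated directly. -/
theorem continuous_kHat [CompactSpace S] [ConnectedSpace S] : Continuous D.kHat := by
  have h : ∀ q, SmAt 2 (fun q => (√(1 + nsq D.X D.T0 q))⁻¹ * (
      (1 + nsq D.X D.T0 q) * (D.normH0 q * Real.cosh (D.theta0 q) / √(1 + D.normSqGradTau q))
        - (dd 2 (angle D.X D.T0) q (ghgt D.X D.T0 q) + formH0 D q (ghgt D.X D.T0 q)))) q := fun q =>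
    (hD.reference.smAt_inv_sqrt q).mul
      (((contMDiffAt_const.add (hD.reference.smAt_nsq q)).mul (hD.smAt_coeff0 q)).sub
        ((smAt_dd_field (hD.reference.smAt_angle q) hD.smoothField_gradTau).add
          (hD.smoothForm_formH0.smAt_apply hD.smoothField_gradTau q)))
  refine (continuous_iff_continuousAt.2 fun q => (h q).continuousAt).congr fun q => ?_
  have h1 := hD.reference.sqrt_mul_curvature q
  rw [inv_mul_eq_iff_eq_mul₀ (hD.reference.sqrt_pos q).ne', hD.theta0_eq, hD.normSqGradTau_eq,
    hD.kHat_eq, normH0_eq]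
  exact h1.symm

theorem continuous_physicalIntegrand : Continuous D.physicalIntegrand := by
  have h : ∀ q, SmAt 2 (fun q =>
    -((1 - D.normSqGradTau q) * (D.normH q * Real.cosh (D.theta q) / √(1 - D.normSqGradTau q)))
      - (dd 2 D.theta q (ghgt D.X D.T0 q) + hD.formJ q (ghgt D.X D.T0 q))) q := fun q =>
    (((contMDiffAt_const.sub (hD.smAt_nsq q)).mul (hD.smAt_coeff q)).neg).sub
      ((smAt_dd_field (hD.smAt_theta q) hD.smoothField_gradTau).add
          (hD.smoothForm_formJ.smAt_apply hD.smoothField_gradTau q))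
  exact (continuous_iff_continuousAt.2 fun q => (h q).continuousAt).congr fun q =>
    (hD.physicalIntegrand_eq q).symm

theorem continuous_rhoNew : Continuous D.rhoNew :=
  continuous_iff_continuousAt.2 fun q =>
    (hD.smAt_coeff0 q).continuousAt.add (hD.smAt_coeff q).continuousAt

/-- cosh(arsinh x) = √(1+x²), with the length of the mean curvature vector absorbed into the root.
-/
theorem rhoNew_eq (q : S) : D.rhoNew q =
    √(D.normH0 q ^ 2 + D.lapTau q ^ 2 / (1 + D.normSqGradTau q)) / √(1 + D.normSqGradTau q)
    + √(D.normH q ^ 2 + D.lapTau q ^ 2 / (1 - D.normSqGradTau q)) / √(1 - D.normSqGradTau q) := by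
  have key : ∀ {a x l : ℝ}, 0 < a → 0 < x →
      a * Real.cosh (Real.arsinh (l / (a * √x))) = √(a ^ 2 + l ^ 2 / x) := by
    intro a x l ha hx
    rw [Real.cosh_arsinh]
    have : a ^ 2 + l ^ 2 / x = a ^ 2 * (1 + (l / (a * √x)) ^ 2) := by
      rw [div_pow, mul_pow, Real.sq_sqrt hx.le]
      field_simp
    rw [this, Real.sqrt_mul (sq_nonneg a), Real.sqrt_sq ha.le]
  have hx : 0 < 1 + D.normSqGradTau q := by linarith [hD.nsq_nonneg q]
  rw [Configuration.rhoNew, Configuration.theta0, Configuration.theta, key (hD.normH0_pos q) hx,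
    key (hD.normH_pos q) (hD.one_sub_nsq_pos q), neg_sq]

/-- det(σ + dτ⊗dτ) = (1+|∇τ|²) det σ. -/
theorem sigmaHat_eq : riemannianMeasure D.sigmaHat
    = (riemannianMeasure D.sigma).withDensity
      fun q => ENNReal.ofReal (√(1 + nsq D.X D.T0 q)) := by
  have h : D.sigmaHat = imet (proj D.X D.T0) := rfl
  rw [h, hD.sigma_eq]
  exact riemannianMeasure_withDensity hD.reference.smoothMetric hD.reference.pos
    hD.reference.smoothMetric_proj hD.reference.pos_proj
    (continuous_iff_continuousAt.2 fun q => (hD.reference.smAt_sqrt q).continuousAt)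
    hD.reference.sqrt_pos fun _ _ hy => hD.reference.volDensity_proj hy

theorem smoothField_jNew : SmoothField (current D) := by
  have h : current D = fun q => shp D.sigma q (hD.formCurrent q) := funext hD.jNew_eq
  rw [h]
  exact hD.smoothForm_formCurrent.smoothField_shp hD.smoothMetric_sigma

/-- The energy is the integral of the mass density. -/
theorem QLEnew_eq [T2Space S] [CompactSpace S] [ConnectedSpace S]
    (hcrit : ∀ p, divergence D.sigma D.jNew p = 0) :
    D.QLEnew = 1 / (8 * Real.pi) * ∫ p, D.rhoNew p ∂riemannianMeasure D.sigma := by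
  have := isFiniteMeasure_riemannianMeasure hD.smoothMetric_sigma hD.pos
  have hsq : Continuous fun q => √(1 + nsq D.X D.T0 q) :=
    continuous_iff_continuousAt.2 fun q => (hD.reference.smAt_sqrt q).continuousAt
  have hint : ∀ {f : S → ℝ}, Continuous f → Integrable f (riemannianMeasure D.sigma) :=
    fun hf => hf.integrable_of_hasCompactSupport (HasCompactSupport.of_compactSpace _)
  have h1 : ∫ q, D.kHat q ∂riemannianMeasure D.sigmaHat
      = ∫ q, √(1 + nsq D.X D.T0 q) * D.kHat q ∂riemannianMeasure D.sigma := by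
    rw [hD.sigmaHat_eq, integral_withDensity_eq_integral_toReal_smul hsq.measurable.ennreal_ofReal
      (by simp)]
    refine integral_congr_ae (Eventually.of_forall fun q => ?_)
    simp only [smul_eq_mul]
    rw [ENNReal.toReal_ofReal (Real.sqrt_nonneg _)]
  have hdd : Continuous fun q => dd 2 (hgt D.X D.T0) q (current D q) :=
    continuous_iff_continuousAt.2 fun q =>
      (smAt_dd_field (hD.reference.smAt_hgt q) hD.smoothField_jNew).continuousAt
  -- The Euler–Lagrange equation enters here: τ is the test function for the divergence-free
  -- current.
  have h2 : ∫ q, dd 2 (hgt D.X D.T0) q (current D q) ∂riemannianMeasure D.sigma = 0 :=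
    integral_dd_eq_zero hD.smoothMetric_sigma hD.pos hD.smoothField_jNew hcrit hD.reference.smAt_hgt
  have h3 := integral_sub (f := fun q => √(1 + nsq D.X D.T0 q) * D.kHat q)
    (hint (hsq.mul hD.continuous_kHat)) (hint hD.continuous_physicalIntegrand)
  rw [Configuration.QLEnew, h1, ← mul_sub, ← h3]
  simp only [hD.density_identity]
  rw [integral_add (hint hD.continuous_rhoNew) (hint hdd), h2, add_zero]

end Configuration.Admissible

end QuasiLocal

end

/-! ### Integrability, the energy identity and positivity -/

theorem mainTheorem2
    {N : Type*} [TopologicalSpace N] [T2Space N]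
    [ChartedSpace (EuclideanSpace ℝ (Fin 4)) N] [IsManifold (𝓡 4) ∞ N]
    {S : Type*} [TopologicalSpace S] [T2Space S] [CompactSpace S] [ConnectedSpace S]
    [MeasurableSpace S] [BorelSpace S]
    [ChartedSpace (EuclideanSpace ℝ (Fin 2)) S] [IsManifold (𝓡 2) ∞ S]
    (D : QuasiLocal.Configuration N S) (hD : D.Admissible)
    (hcrit : ∀ p, QuasiLocal.divergence D.sigma D.jNew p = 0) :
    -- all the integrals below exist
    Integrable D.kHat (QuasiLocal.riemannianMeasure D.sigmaHat) ∧
    Integrable D.physicalIntegrand (QuasiLocal.riemannianMeasure D.sigma) ∧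
    Integrable D.rhoNew (QuasiLocal.riemannianMeasure D.sigma) ∧
    -- the energy reduces to the integral of the mass density
    D.QLEnew = 1 / (8 * Real.pi) * ∫ p, D.rhoNew p ∂(QuasiLocal.riemannianMeasure D.sigma) ∧
    -- the mass density is a sum of two nonnegative terms
    (∀ p,
      D.rhoNew p =
        √(D.normH0 p ^ 2 + D.lapTau p ^ 2 / (1 + D.normSqGradTau p)) / √(1 + D.normSqGradTau p)
        + √(D.normH p ^ 2 + D.lapTau p ^ 2 / (1 - D.normSqGradTau p)) / √(1 - D.normSqGradTau p) ∧
      0 ≤ √(D.normH0 p ^ 2 + D.lapTau p ^ 2 / (1 + D.normSqGradTau p))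
        / √(1 + D.normSqGradTau p) ∧
      0 ≤ √(D.normH p ^ 2 + D.lapTau p ^ 2 / (1 - D.normSqGradTau p))
        / √(1 - D.normSqGradTau p)) ∧
    -- and the new quasi-local mass is nonnegative
    0 ≤ D.QLEnew := by
  have hsig := QuasiLocal.isFiniteMeasure_riemannianMeasure hD.smoothMetric_sigma hD.pos
  have hhat : IsFiniteMeasure (QuasiLocal.riemannianMeasure D.sigmaHat) :=
    QuasiLocal.isFiniteMeasure_riemannianMeasure hD.reference.smoothMetric_proj hD.reference.pos_proj
  have hterm : ∀ p,
      D.rhoNew p =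
        √(D.normH0 p ^ 2 + D.lapTau p ^ 2 / (1 + D.normSqGradTau p)) / √(1 + D.normSqGradTau p)
        + √(D.normH p ^ 2 + D.lapTau p ^ 2 / (1 - D.normSqGradTau p)) / √(1 - D.normSqGradTau p) ∧
      0 ≤ √(D.normH0 p ^ 2 + D.lapTau p ^ 2 / (1 + D.normSqGradTau p))
        / √(1 + D.normSqGradTau p) ∧
      0 ≤ √(D.normH p ^ 2 + D.lapTau p ^ 2 / (1 - D.normSqGradTau p))
        / √(1 - D.normSqGradTau p) := fun p =>
    ⟨hD.rhoNew_eq p, div_nonneg (Real.sqrt_nonneg _) (Real.sqrt_nonneg _),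
      div_nonneg (Real.sqrt_nonneg _) (Real.sqrt_nonneg _)⟩
  have hE := hD.QLEnew_eq hcrit
  refine ⟨hD.continuous_kHat.integrable_of_hasCompactSupport (HasCompactSupport.of_compactSpace _),
    hD.continuous_physicalIntegrand.integrable_of_hasCompactSupport
      (HasCompactSupport.of_compactSpace _),
    hD.continuous_rhoNew.integrable_of_hasCompactSupport (HasCompactSupport.of_compactSpace _),
    hE, hterm, ?_⟩
  rw [hE]
  refine mul_nonneg (by positivity) (integral_nonneg fun p => ?_)
  have := hterm p
  exact this.1 ▸ add_nonneg this.2.1 this.2.2
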